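/- Let $k$ be a field of characteristic $p>0$, let $E=\langle g_1,\dots,g_r\rangle$ be an elementary abelian $p$-group of rank $r$, and put $X_j=g_j-1\in kE$. For a field extension $K/k$ and $0\neq\alpha=(\alpha_1,\dots,\alpha_r)\in K^r$ put $X_\alpha=\sum_j\alpha_jX_j\in KE$. A finitely generated $kE$-module $M$ has constant Jordan type if the number of Jordan blocks of each length $1,\dots,p$ of $X_\alpha$ acting on $K\otimes_kM$ is independent of $K$ and of $\alpha\neq0$. Let $\mathcal C(kE)$ be the category of these modules, with the exact structure given by the locally split short exact sequences, that is, the short exact sequences of $kE$-modules that split on restriction to $k[X_\alpha]/(X_\alpha^p)$ for every $0\neq\alpha\in k^r$. Let $\mathbb P^{r-1}=\operatorname{Proj}k[Y_1,\dots,Y_r]$ with structure sheaf $\mathcal O$. For a $kE$-module $M$ and $n\in\mathbb Z$ let $\theta_M\colon M\otimes_k\mathcal O(n)\to M\otimes_k\mathcal O(n+1)$ be the map $\theta_M(m\otimes f)=\sum_{j=1}^rX_jm\otimes Y_jf$, and for $i\ge1$ let $$\mathcal F_i(M)=\frac{\operatorname{Ker}\theta_M\cap\operatorname{Im}\theta_M^{\,i-1}}{\operatorname{Ker}\theta_M\cap\operatorname{Im}\theta_M^{\,i}},$$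 a subquotient of $M\otimes_k\mathcal O$ that is functorial in $M$; here $\operatorname{Im}\theta_M^{\,j}$ is the image of $\theta_M^{\,j}\colon M\otimes_k\mathcal O(-j)\to M\otimes_k\mathcal O$. Then for $1\le i\le p-1$, $\mathcal F_i$ is an exact functor from $\mathcal C(kE)$ to the category of coherent sheaves on $\mathbb P^{r-1}$: it is additive, $\mathcal F_i(M)$ is coherent for every $M$ in $\mathcal C(kE)$, and for every locally split short exact sequence $0\to M_1\to M_2\to M_3\to0$ in $\mathcal C(kE)$ the sequence $0\to\mathcal F_i(M_1)\to\mathcal F_i(M_2)\to\mathcal F_i(M_3)\to0$ of sheaves is exact. -/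

import Mathlib

open CategoryTheory AlgebraicGeometry TopologicalSpace Opposite
open scoped TensorProduct

universe u v w

noncomputable section

namespace BPBundles

section Twist

variable {k A : Type u} [Field k] [CommRing A] [Algebra k A]
variable (𝒜 : ℕ → Submodule k A)
variable (V : Type u) [AddCommGroup V] [Module k V]

/-- The degree `d` part of the graded `A`-module `A ⊗[k] V` (with `V` in degree `0`), `d : ℤ`;
it is zero for `d < 0`. -/
def piece (d : ℤ) : Submodule k (A ⊗[k] V) :=
  Submodule.span k {t | ∃ (m : ℕ) (a : A) (v : V), (m : ℤ) = d ∧ a ∈ 𝒜 m ∧ t = a ⊗ₜ[k] v}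

variable {𝒜 V} in
theorem smul_mem_piece [GradedAlgebra 𝒜] {m : ℕ} {d e : ℤ} {a : A} (ha : a ∈ 𝒜 m) {t : A ⊗[k] V}
    (ht : t ∈ piece 𝒜 V d) (he : m + d = e) : a • t ∈ piece 𝒜 V e := by
  unfold piece at ht
  induction ht using Submodule.span_induction with
  | mem x hx =>
    obtain ⟨n, b, v, hn, hb, rfl⟩ := hx
    refine Submodule.subset_span ⟨m + n, a * b, v, ?_, SetLike.mul_mem_graded ha hb, ?_⟩
    · push_cast; rw [hn, he]
    · rw [TensorProduct.smul_tmul', smul_eq_mul]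
  | zero => rw [smul_zero]; exact zero_mem _
  | add x y _ _ hx hy => rw [smul_add]; exact add_mem hx hy
  | smul c x _ hx => rw [smul_comm]; exact Submodule.smul_mem _ c hx

variable [GradedAlgebra 𝒜]

instance (x : ProjectiveSpectrum.top 𝒜) :
    (ProjectiveSpectrum.asHomogeneousIdeal (𝒜 := 𝒜) x).toIdeal.IsPrime :=
  ProjectiveSpectrum.isPrime x

/-- The localization of `A ⊗[k] V` at the homogeneous prime `x`. -/
abbrev LocAt (x : ProjectiveSpectrum 𝒜) : Type u :=
  LocalizedModule x.asHomogeneousIdeal.toIdeal.primeCompl (A ⊗[k] V)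

variable {V} in
/-- On the open set `U`, the function `f` is a single fraction `t / s` with `s` homogeneous of
degree `e` and `t ∈ A ⊗[k] V` homogeneous of degree `e + n`. -/
def IsFrac (n : ℤ) {U : Opens (ProjectiveSpectrum.top 𝒜)} (f : ∀ x : U, LocAt 𝒜 V x.1) : Prop :=
  ∃ (e : ℕ) (t : A ⊗[k] V) (s : A), t ∈ piece 𝒜 V (e + n) ∧ s ∈ 𝒜 e ∧
    ∀ x : U, ∃ hs : s ∉ (x.1.asHomogeneousIdeal).toIdeal, f x = LocalizedModule.mk t ⟨s, hs⟩

/-- `f` is locally a fraction of degree `n`; these functions are the sections of `V ⊗ 𝒪(n)`. -/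
def isLocFrac (n : ℤ) : TopCat.LocalPredicate (fun x : ProjectiveSpectrum.top 𝒜 => LocAt 𝒜 V x) :=
  TopCat.PrelocalPredicate.sheafify
    { pred := fun f => IsFrac 𝒜 n f
      res := by
        rintro U W i f ⟨e, t, s, ht, hs, h⟩
        exact ⟨e, t, s, ht, hs, fun x => h (i x)⟩ }

/-- Sections over `U` of `V ⊗ 𝒪(n)` as an additive group. -/
def sectionsAddSubgroup (n : ℤ) (U : (Opens (ProjectiveSpectrum.top 𝒜))ᵒᵖ) :
    AddSubgroup (∀ x : U.unop, LocAt 𝒜 V x.1) where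
  carrier := {f | (isLocFrac 𝒜 V n).pred f}
  zero_mem' x := ⟨U.unop, x.2, 𝟙 _, 0, 0, 1, zero_mem _, SetLike.GradedOne.one_mem,
    fun y => ⟨fun h => y.1.isPrime.one_notMem h, by simp⟩⟩
  add_mem' := by
    intro a b ha hb x
    obtain ⟨Va, ma, ia, da, ta, sa, hta, hsa, wa⟩ := ha x
    obtain ⟨Vb, mb, ib, db, tb, sb, htb, hsb, wb⟩ := hb x
    refine ⟨Va ⊓ Vb, ⟨ma, mb⟩, Opens.infLELeft _ _ ≫ ia, da + db, sb • ta + sa • tb, sa * sb,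
      add_mem (smul_mem_piece hsb hta (by push_cast; ring))
        (smul_mem_piece hsa htb (by push_cast; ring)), SetLike.mul_mem_graded hsa hsb,
      fun y => ?_⟩
    obtain ⟨h1, e1⟩ := wa ⟨y.1, y.2.1⟩
    obtain ⟨h2, e2⟩ := wb ⟨y.1, y.2.2⟩
    exact ⟨(y.1.asHomogeneousIdeal.toIdeal.primeCompl).mul_mem h1 h2,
      congr($e1 + $e2).trans (LocalizedModule.mk_add_mk ..)⟩
  neg_mem' := by
    intro a ha x
    obtain ⟨Va, ma, ia, da, ta, sa, hta, hsa, wa⟩ := ha x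
    refine ⟨Va, ma, ia, da, -ta, sa, neg_mem hta, hsa, fun y => ?_⟩
    obtain ⟨h1, e1⟩ := wa y
    exact ⟨h1, congr(-$e1).trans (LocalizedModule.mk_neg ..).symm⟩

/-- The sheaf of types underlying `V ⊗ 𝒪(n)`. -/
def twistInType (n : ℤ) : TopCat.Sheaf (Type u) (ProjectiveSpectrum.top 𝒜) :=
  TopCat.subsheafToTypes (isLocFrac 𝒜 V n)

instance (n : ℤ) (U : (Opens (ProjectiveSpectrum.top 𝒜))ᵒᵖ) :
    AddCommGroup ((twistInType 𝒜 V n).1.obj U) :=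
  inferInstanceAs (AddCommGroup (sectionsAddSubgroup 𝒜 V n U))

/-- The presheaf of abelian groups underlying `V ⊗ 𝒪(n)`. -/
def twistAb (n : ℤ) : TopCat.Presheaf AddCommGrpCat.{u} (ProjectiveSpectrum.top 𝒜) where
  obj U := AddCommGrpCat.of ((twistInType 𝒜 V n).1.obj U)
  map i := AddCommGrpCat.ofHom
    { toFun := (twistInType 𝒜 V n).1.map i
      map_zero' := rfl
      map_add' := fun _ _ => rfl }

instance structureModule (n : ℤ) (U : (Opens (ProjectiveSpectrum.top 𝒜))ᵒᵖ) :
    Module ((ProjectiveSpectrum.Proj.structureSheaf 𝒜).1.obj U)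
      ((twistInType 𝒜 V n).1.obj U) where
  smul a f := ⟨fun x => (a.1 x).val • f.1 x, by
    intro x
    obtain ⟨Va, ma, ia, da, ⟨ra, hra⟩, ⟨sa, hsa⟩, hwa, wa⟩ := a.2 x
    obtain ⟨Vb, mb, ib, db, tb, sb, htb, hsb, wb⟩ := f.2 x
    refine ⟨Va ⊓ Vb, ⟨ma, mb⟩, Opens.infLELeft _ _ ≫ ia, da + db, ra • tb, sa * sb,
      smul_mem_piece hra htb (by push_cast; ring), SetLike.mul_mem_graded hsa hsb, fun y => ?_⟩
    have e1 := wa ⟨y.1, y.2.1⟩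
    obtain ⟨h2, e2⟩ := wb ⟨y.1, y.2.2⟩
    refine ⟨(y.1.asHomogeneousIdeal.toIdeal.primeCompl).mul_mem (hwa ⟨y.1, y.2.1⟩) h2, ?_⟩
    refine (congr(($e1).val • $e2)).trans ?_
    rw [HomogeneousLocalization.val_mk]
    exact LocalizedModule.mk_smul_mk ..⟩
  one_smul f := Subtype.ext (funext fun x => by
    change (1 : HomogeneousLocalization _ _).val • f.1 x = _
    rw [HomogeneousLocalization.val_one, one_smul])
  mul_smul a b f := Subtype.ext (funext fun x => by
    change (a.1 x * b.1 x).val • f.1 x = (a.1 x).val • (b.1 x).val • f.1 x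
    rw [HomogeneousLocalization.val_mul, mul_smul])
  smul_zero a := Subtype.ext (funext fun x => smul_zero _)
  smul_add a f g := Subtype.ext (funext fun x => smul_add _ _ _)
  add_smul a b f := Subtype.ext (funext fun x => by
    change (a.1 x + b.1 x).val • f.1 x = (a.1 x).val • f.1 x + (b.1 x).val • f.1 x
    rw [HomogeneousLocalization.val_add, add_smul])
  zero_smul f := Subtype.ext (funext fun x => by
    change (0 : HomogeneousLocalization _ _).val • f.1 x = 0
    rw [HomogeneousLocalization.val_zero, zero_smul])

/-- The action of `𝒪` on the presheaf `V ⊗ 𝒪(n)`, over the scheme `Proj 𝒜`. -/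
instance twistModule (n : ℤ) (U : (Opens (Proj 𝒜))ᵒᵖ) :
    Module ((Proj 𝒜).ringCatSheaf.obj.obj U)
      ((show (Opens (Proj 𝒜))ᵒᵖ ⥤ Ab.{u} from twistAb 𝒜 V n).obj U) :=
  structureModule 𝒜 V n U

/-- The presheaf `V ⊗ 𝒪(n)` as a presheaf of modules. -/
def twistPresheaf (n : ℤ) : (Proj 𝒜).PresheafOfModules :=
  PresheafOfModules.ofPresheaf (show (Opens (Proj 𝒜))ᵒᵖ ⥤ Ab.{u} from twistAb 𝒜 V n)
    (fun _ _ _ _ _ => rfl)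

/-- The sheaf of modules `V ⊗ 𝒪(n)` on `Proj 𝒜`. -/
def twist (n : ℤ) : (Proj 𝒜).Modules where
  val := twistPresheaf 𝒜 V n
  isSheaf := (TopCat.Presheaf.isSheaf_iff_isSheaf_comp (forget AddCommGrpCat) _).2
    (twistInType 𝒜 V n).2

variable {V} {W : Type u} [AddCommGroup W] [Module k W]

/-- An `A`-linear map `A ⊗[k] V → A ⊗[k] W` that is homogeneous of degree `c`. -/
def IsHomogeneousMap (φ : A ⊗[k] V →ₗ[A] A ⊗[k] W) (c : ℤ) : Prop :=
  ∀ (d : ℤ) (t : A ⊗[k] V), t ∈ piece 𝒜 V d → φ t ∈ piece 𝒜 W (d + c)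

/-- The morphism of sheaves `V ⊗ 𝒪(n) ⟶ W ⊗ 𝒪(m)`, `m = n + c`, induced by a homogeneous
`A`-linear map of degree `c`. -/
def twistMap (φ : A ⊗[k] V →ₗ[A] A ⊗[k] W) {c : ℤ} (hφ : IsHomogeneousMap 𝒜 φ c) (n m : ℤ)
    (hm : m = n + c) : twist 𝒜 V n ⟶ twist 𝒜 W m where
  val :=
    { app U := ModuleCat.ofHom
        { toFun := fun f => ⟨fun x =>
            LocalizedModule.map (x.1.asHomogeneousIdeal.toIdeal.primeCompl) φ (f.1 x), by
              intro x
              obtain ⟨Va, ma, ia, e, t, s, ht, hs, h⟩ := f.2 x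
              refine ⟨Va, ma, ia, e, φ t, s, ?_, hs, fun y => ?_⟩
              · have := hφ _ t ht
                rwa [add_assoc, ← hm] at this
              · obtain ⟨h1, h2⟩ := h y
                exact ⟨h1, (congrArg _ h2).trans (LocalizedModule.map_mk ..)⟩⟩
          map_add' := fun f g => Subtype.ext (funext fun x => map_add _ _ _)
          map_smul' := fun a f => Subtype.ext (funext fun x =>
            (LocalizedModule.map (x.1.asHomogeneousIdeal.toIdeal.primeCompl) φ).map_smul
              (a.1 x).val (f.1 x)) }
      naturality := fun _ => rfl }

theorem twistMap_comp {W' : Type u} [AddCommGroup W'] [Module k W']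
    {φ : A ⊗[k] V →ₗ[A] A ⊗[k] W} {ψ : A ⊗[k] W →ₗ[A] A ⊗[k] W'} {χ : A ⊗[k] V →ₗ[A] A ⊗[k] W'}
    {c d e : ℤ} (hφ : IsHomogeneousMap 𝒜 φ c) (hψ : IsHomogeneousMap 𝒜 ψ d)
    (hχ : IsHomogeneousMap 𝒜 χ e) (h : ψ ∘ₗ φ = χ) {n m l : ℤ} (h1 : m = n + c) (h2 : l = m + d)
    (h3 : l = n + e) :
    twistMap 𝒜 φ hφ n m h1 ≫ twistMap 𝒜 ψ hψ m l h2 = twistMap 𝒜 χ hχ n l h3 := by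
  subst h
  ext U f
  refine Subtype.ext (funext fun x => ?_)
  change LocalizedModule.map (x.1.asHomogeneousIdeal.toIdeal.primeCompl) ψ
    (LocalizedModule.map (x.1.asHomogeneousIdeal.toIdeal.primeCompl) φ (f.1 x)) =
    LocalizedModule.map (x.1.asHomogeneousIdeal.toIdeal.primeCompl) (ψ ∘ₗ φ) (f.1 x)
  generalize f.1 x = y
  induction y using LocalizedModule.induction_on with
  | h m s => rw [LocalizedModule.map_mk, LocalizedModule.map_mk, LocalizedModule.map_mk]; rfl

theorem twistMap_id {φ : A ⊗[k] V →ₗ[A] A ⊗[k] V} (hφ : IsHomogeneousMap 𝒜 φ 0)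
    (h : φ = LinearMap.id) (n : ℤ) (hn : n = n + 0) : twistMap 𝒜 φ hφ n n hn = 𝟙 _ := by
  subst h
  ext U f
  refine Subtype.ext (funext fun x => ?_)
  change LocalizedModule.map (x.1.asHomogeneousIdeal.toIdeal.primeCompl) LinearMap.id (f.1 x) =
    f.1 x
  generalize f.1 x = y
  induction y using LocalizedModule.induction_on with
  | h m s => rw [LocalizedModule.map_mk]; rfl

end Twist

section Functor

variable {p : ℕ} {k : Type u} [Field k] {r : ℕ} {E : Type v} [CommGroup E]
  [Module (ZMod p) (Additive E)] (g : Module.Basis (Fin r) (ZMod p) (Additive E))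

open MvPolynomial (homogeneousSubmodule)

attribute [local instance] MvPolynomial.gradedAlgebra

variable (k r) in
/-- The projective space `ℙ^{r-1}` over `k`, with homogeneous coordinate ring
`k[Y_1, …, Y_r]`. -/
abbrev ProjSpace : Scheme.{u} := Proj (homogeneousSubmodule (Fin r) k)

variable (k) in
/-- The element `X_j = g_j - 1` of the group algebra `kE`. -/
def X (j : Fin r) : MonoidAlgebra k E := MonoidAlgebra.of k E (g j).toMul - 1

attribute [local instance] ModuleCat.moduleOfAlgebraModule
  ModuleCat.isScalarTower_of_algebra_moduleCat

/-- The action of `x : kE` on a `kE`-module as a `k`-linear endomorphism. -/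
def act (M : ModuleCat.{u} (MonoidAlgebra k E)) (x : MonoidAlgebra k E) : M →ₗ[k] M :=
  Algebra.lsmul k k M x

/-- The `k`-linear map underlying a morphism of `kE`-modules. -/
def lin {M N : ModuleCat.{u} (MonoidAlgebra k E)} (f : M ⟶ N) : M →ₗ[k] N :=
  f.hom.restrictScalars k

/-- The operator `m ⊗ f ↦ ∑ j, X_j m ⊗ Y_j f` on `k[Y_1, …, Y_r] ⊗ M`. -/
def thetaLin (M : ModuleCat.{u} (MonoidAlgebra k E)) :
    MvPolynomial (Fin r) k ⊗[k] M →ₗ[MvPolynomial (Fin r) k] MvPolynomial (Fin r) k ⊗[k] M :=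
  ∑ j : Fin r, (MvPolynomial.X j : MvPolynomial (Fin r) k) •
    (act M (X k g j)).baseChange (MvPolynomial (Fin r) k)

theorem baseChange_mem_piece {V W : Type u} [AddCommGroup V] [Module k V] [AddCommGroup W]
    [Module k W] (f : V →ₗ[k] W) {d : ℤ} {t : MvPolynomial (Fin r) k ⊗[k] V}
    (ht : t ∈ piece (homogeneousSubmodule (Fin r) k) V d) :
    f.baseChange (MvPolynomial (Fin r) k) t ∈ piece (homogeneousSubmodule (Fin r) k) W d := by
  unfold piece at ht
  induction ht using Submodule.span_induction with
  | mem x hx =>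
    obtain ⟨n, b, v, hn, hb, rfl⟩ := hx
    exact Submodule.subset_span ⟨n, b, f v, hn, hb, LinearMap.baseChange_tmul ..⟩
  | zero => rw [map_zero]; exact zero_mem _
  | add x y _ _ hx hy => rw [map_add]; exact add_mem hx hy
  | smul c x _ hx => rw [LinearMap.map_smul_of_tower]; exact Submodule.smul_mem _ c hx

theorem isHomogeneousMap_baseChange {V W : Type u} [AddCommGroup V] [Module k V] [AddCommGroup W]
    [Module k W] (f : V →ₗ[k] W) :
    IsHomogeneousMap (homogeneousSubmodule (Fin r) k)
      (f.baseChange (MvPolynomial (Fin r) k)) 0 := by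
  intro d t ht
  rw [add_zero]
  exact baseChange_mem_piece f ht

theorem isHomogeneousMap_thetaLin (M : ModuleCat.{u} (MonoidAlgebra k E)) :
    IsHomogeneousMap (homogeneousSubmodule (Fin r) k) (thetaLin g M) 1 := by
  intro d t ht
  rw [thetaLin, LinearMap.sum_apply]
  refine sum_mem fun j _ => ?_
  rw [LinearMap.smul_apply]
  exact smul_mem_piece (m := 1) ((MvPolynomial.mem_homogeneousSubmodule _ _).2
    (MvPolynomial.isHomogeneous_X k j)) (baseChange_mem_piece _ ht) (by push_cast; ring)

theorem isHomogeneousMap_thetaLin_pow (M : ModuleCat.{u} (MonoidAlgebra k E)) (j : ℕ) :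
    IsHomogeneousMap (homogeneousSubmodule (Fin r) k) (thetaLin g M ^ j) j := by
  induction j with
  | zero => intro d t ht; simpa using ht
  | succ j ih =>
    intro d t ht
    rw [pow_succ, Module.End.mul_apply]
    have := ih _ _ (isHomogeneousMap_thetaLin g M d t ht)
    rwa [add_assoc, add_comm (1 : ℤ), ← Nat.cast_succ] at this

theorem thetaLin_comp_baseChange {M N : ModuleCat.{u} (MonoidAlgebra k E)} (f : M ⟶ N) :
    (lin f).baseChange (MvPolynomial (Fin r) k) ∘ₗ thetaLin g M =
      thetaLin g N ∘ₗ (lin f).baseChange (MvPolynomial (Fin r) k) := by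
  refine TensorProduct.AlgebraTensorModule.ext fun a m => ?_
  simp only [LinearMap.comp_apply, thetaLin, LinearMap.sum_apply, LinearMap.smul_apply,
    LinearMap.baseChange_tmul, map_sum, map_smul]
  refine Finset.sum_congr rfl fun j _ => ?_
  congr 2
  exact f.hom.map_smul (X k g j) m

theorem thetaLin_pow_comp_baseChange {M N : ModuleCat.{u} (MonoidAlgebra k E)} (f : M ⟶ N)
    (j : ℕ) :
    (lin f).baseChange (MvPolynomial (Fin r) k) ∘ₗ thetaLin g M ^ j =
      (thetaLin g N ^ j) ∘ₗ (lin f).baseChange (MvPolynomial (Fin r) k) := by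
  induction j with
  | zero => rfl
  | succ j ih =>
    rw [pow_succ, pow_succ, Module.End.mul_eq_comp, Module.End.mul_eq_comp, ← LinearMap.comp_assoc,
      ih, LinearMap.comp_assoc, thetaLin_comp_baseChange, LinearMap.comp_assoc]

variable (r) in
/-- The sheaf `M ⊗ 𝒪(n)` on `ℙ^{r-1}`. -/
def tw (M : ModuleCat.{u} (MonoidAlgebra k E)) (n : ℤ) : (ProjSpace k r).Modules :=
  twist (homogeneousSubmodule (Fin r) k) M n

variable (r) in
/-- The map `M ⊗ 𝒪(n) ⟶ N ⊗ 𝒪(n)` induced by a homomorphism `M ⟶ N`. -/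
def twHom {M N : ModuleCat.{u} (MonoidAlgebra k E)} (f : M ⟶ N) (n : ℤ) : tw r M n ⟶ tw r N n :=
  twistMap (homogeneousSubmodule (Fin r) k) _ (isHomogeneousMap_baseChange (lin f)) n n
    (add_zero n).symm

/-- The map `θ_M : M ⊗ 𝒪(n) ⟶ M ⊗ 𝒪(n+1)`, `θ_M (m ⊗ f) = ∑ j, X_j m ⊗ Y_j f`. -/
def theta (M : ModuleCat.{u} (MonoidAlgebra k E)) (n m : ℤ) (h : m = n + 1) :
    tw r M n ⟶ tw r M m :=
  twistMap (homogeneousSubmodule (Fin r) k) _ (isHomogeneousMap_thetaLin g M) n m h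

/-- The `j`-fold iterate `θ_M ^ j : M ⊗ 𝒪(-j) ⟶ M ⊗ 𝒪` (see `thetaPow_zero`, `thetaPow_succ`). -/
def thetaPow (M : ModuleCat.{u} (MonoidAlgebra k E)) (j : ℕ) :
    tw r M (-j) ⟶ tw r M 0 :=
  twistMap (homogeneousSubmodule (Fin r) k) _ (isHomogeneousMap_thetaLin_pow g M j) (-j) 0
    (by ring)

theorem thetaPow_zero (M : ModuleCat.{u} (MonoidAlgebra k E)) :
    thetaPow g M 0 = 𝟙 (tw r M 0) :=
  twistMap_id _ _ (pow_zero _) 0 rfl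

theorem thetaPow_succ (M : ModuleCat.{u} (MonoidAlgebra k E)) (j : ℕ) :
    thetaPow g M (j + 1) =
      theta g M (-(j + 1 : ℕ)) (-j) (by push_cast; ring) ≫ thetaPow g M j :=
  (twistMap_comp _ _ _ _ (pow_succ _ _).symm _ _ _).symm

theorem twHom_theta {M N : ModuleCat.{u} (MonoidAlgebra k E)} (f : M ⟶ N) (n m : ℤ)
    (h : m = n + 1) : twHom r f n ≫ theta g N n m h = theta g M n m h ≫ twHom r f m := by
  have hc : IsHomogeneousMap (homogeneousSubmodule (Fin r) k)
      (thetaLin g N ∘ₗ (lin f).baseChange (MvPolynomial (Fin r) k)) 1 := fun d t ht =>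
    isHomogeneousMap_thetaLin g N d _ (baseChange_mem_piece _ ht)
  exact (twistMap_comp _ _ _ hc rfl _ _ h).trans
    (twistMap_comp _ _ _ hc (thetaLin_comp_baseChange g f) _ _ h).symm

theorem twHom_thetaPow {M N : ModuleCat.{u} (MonoidAlgebra k E)} (f : M ⟶ N) (j : ℕ) :
    twHom r f (-j) ≫ thetaPow g N j = thetaPow g M j ≫ twHom r f 0 := by
  have hc : IsHomogeneousMap (homogeneousSubmodule (Fin r) k)
      ((thetaLin g N ^ j) ∘ₗ (lin f).baseChange (MvPolynomial (Fin r) k)) j := fun d t ht =>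
    isHomogeneousMap_thetaLin_pow g N j d _ (baseChange_mem_piece _ ht)
  have h : (0 : ℤ) = -j + j := by ring
  exact (twistMap_comp _ _ _ hc rfl _ _ h).trans
    (twistMap_comp _ _ _ hc (thetaLin_pow_comp_baseChange g f j) _ _ h).symm

theorem twHom_id (M : ModuleCat.{u} (MonoidAlgebra k E)) (n : ℤ) :
    twHom r (𝟙 M) n = 𝟙 _ :=
  twistMap_id _ _ (LinearMap.baseChange_id) n _

theorem twHom_comp {M N P : ModuleCat.{u} (MonoidAlgebra k E)} (f : M ⟶ N) (f' : N ⟶ P) (n : ℤ) :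
    twHom r (f ≫ f') n = twHom r f n ≫ twHom r f' n := by
  have h : (lin f').baseChange (MvPolynomial (Fin r) k) ∘ₗ
      (lin f).baseChange (MvPolynomial (Fin r) k) =
      (lin (f ≫ f')).baseChange (MvPolynomial (Fin r) k) :=
    (LinearMap.baseChange_comp (lin f) (lin f')).symm
  exact (twistMap_comp _ _ _ _ h _ _ _).symm

/-- The subsheaf `Ker θ_M ∩ Im θ_M ^ j` of `M ⊗ 𝒪`. -/
def kerIm (M : ModuleCat.{u} (MonoidAlgebra k E)) (j : ℕ) : Subobject (tw r M 0) :=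
  Limits.kernelSubobject (theta g M 0 1 (zero_add 1).symm) ⊓
    Limits.imageSubobject (thetaPow g M j)

theorem kerIm_antitone (M : ModuleCat.{u} (MonoidAlgebra k E)) : Antitone (kerIm g M) := by
  refine antitone_nat_of_succ_le fun j => ?_
  refine inf_le_inf_left _ ?_
  have h : ∀ (φ : tw r M (-(j + 1 : ℕ)) ⟶ tw r M 0) (ψ : tw r M (-(j + 1 : ℕ)) ⟶ tw r M (-j)),
      φ = ψ ≫ thetaPow g M j →
      Limits.imageSubobject φ ≤ Limits.imageSubobject (thetaPow g M j) := by
    rintro _ ψ rfl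
    exact Limits.imageSubobject_comp_le _ _
  exact h _ _ (thetaPow_succ g M j)

theorem kerIm_factors {M N : ModuleCat.{u} (MonoidAlgebra k E)} (f : M ⟶ N) (j : ℕ) :
    (kerIm g N j).Factors ((kerIm g M j).arrow ≫ twHom r f 0) := by
  refine (Subobject.inf_factors _).2 ⟨?_, ?_⟩
  · rw [Limits.kernelSubobject_factors_iff, Category.assoc, twHom_theta, ← Category.assoc]
    have h : (kerIm g M j).Factors (kerIm g M j).arrow := Subobject.factors_self _
    rw [(Limits.kernelSubobject_factors_iff _ _).1 ((Subobject.inf_factors _).1 h).1,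
      Limits.zero_comp]
  · have h1 : (Limits.imageSubobject (thetaPow g N j)).Factors
        ((Limits.imageSubobject (thetaPow g M j)).arrow ≫ twHom r f 0) := by
      have := Limits.imageSubobjectMap_arrow (f := thetaPow g M j) (g := thetaPow g N j)
        (Arrow.homMk (twHom r f (-j)) (twHom r f 0) (twHom_thetaPow g f j))
      exact this ▸ Subobject.factors_comp_arrow _
    have h : (kerIm g M j).Factors (kerIm g M j).arrow := Subobject.factors_self _
    rw [← Subobject.factorThru_arrow _ _ ((Subobject.inf_factors _).1 h).2, Category.assoc]
    exact Subobject.factors_of_factors_right _ h1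

/-- The map `Ker θ_M ∩ Im θ_M ^ j ⟶ Ker θ_N ∩ Im θ_N ^ j` induced by `f : M ⟶ N`. -/
def kerImMap {M N : ModuleCat.{u} (MonoidAlgebra k E)} (f : M ⟶ N) (j : ℕ) :
    (kerIm g M j : (ProjSpace k r).Modules) ⟶ (kerIm g N j : (ProjSpace k r).Modules) :=
  (kerIm g N j).factorThru _ (kerIm_factors g f j)

/-- The inclusion of `Ker θ_M ∩ Im θ_M ^ i` in `Ker θ_M ∩ Im θ_M ^ (i - 1)`. -/
def kerImIncl (M : ModuleCat.{u} (MonoidAlgebra k E)) (i : ℕ) :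
    (kerIm g M i : (ProjSpace k r).Modules) ⟶ (kerIm g M (i - 1) : (ProjSpace k r).Modules) :=
  Subobject.ofLE _ _ (kerIm_antitone g M (Nat.sub_le i 1))

theorem kerImIncl_kerImMap {M N : ModuleCat.{u} (MonoidAlgebra k E)} (f : M ⟶ N) (i : ℕ) :
    kerImIncl g M i ≫ kerImMap g f (i - 1) = kerImMap g f i ≫ kerImIncl g N i := by
  rw [← cancel_mono (kerIm g N (i - 1)).arrow]
  simp [kerImIncl, kerImMap]

/-- The functor `ℱ_i`, with
`ℱ_i(M) = (Ker θ_M ∩ Im θ_M ^ (i - 1)) / (Ker θ_M ∩ Im θ_M ^ i)` for `i ≥ 1`. -/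
def sheafF (i : ℕ) : ModuleCat.{u} (MonoidAlgebra k E) ⥤ (ProjSpace k r).Modules where
  obj M := Limits.cokernel (kerImIncl g M i)
  map f := Limits.cokernel.map _ _ (kerImMap g f i) (kerImMap g f (i - 1))
    (kerImIncl_kerImMap g f i)
  map_id M := by
    have h : kerImMap g (𝟙 M) (i - 1) = 𝟙 _ := by
      rw [← cancel_mono (kerIm g M (i - 1)).arrow]
      simp [kerImMap, twHom_id]
    rw [← cancel_epi (Limits.cokernel.π _)]
    simp [h]
  map_comp {M N P} f f' := by
    have h : kerImMap g (f ≫ f') (i - 1) = kerImMap g f (i - 1) ≫ kerImMap g f' (i - 1) := by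
      rw [← cancel_mono (kerIm g P (i - 1)).arrow]
      simp [kerImMap, twHom_comp]
    rw [← cancel_epi (Limits.cokernel.π _)]
    simp [h]

/-! ### Constant Jordan type -/

/-- `a j` is the number of Jordan blocks of length `j + 1` (and eigenvalue `0`) of the nilpotent
endomorphism `f`: there is a basis consisting of strings
`b_0, …, b_j` with `f b_l = b_{l-1}` and `f b_0 = 0`, with `a j` strings of length `j + 1`
for each `j < p`. -/
def HasJordanType {K V : Type u} [Field K] [AddCommGroup V] [Module K V] (f : V →ₗ[K] V)
    (a : Fin p → ℕ) : Prop :=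
  ∃ b : Module.Basis (Σ j : Fin p, Fin (a j) × Fin (j + 1)) K V,
    ∀ (j : Fin p) (m : Fin (a j)) (l : Fin (j + 1)),
      f (b ⟨j, m, l⟩) = if (l : ℕ) = 0 then 0 else
        b ⟨j, m, ⟨(l : ℕ) - 1, (Nat.sub_le _ _).trans_lt l.2⟩⟩

/-- The action of `X_α = ∑ j, α_j X_j` on `K ⊗[k] M`, where `K` is a field extension of `k` and
`α ∈ K ^ r`. -/
def actAlpha (M : ModuleCat.{u} (MonoidAlgebra k E)) (K : Type u) [Field K] [Algebra k K]
    (α : Fin r → K) : K ⊗[k] M →ₗ[K] K ⊗[k] M :=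
  ∑ j : Fin r, α j • (act M (X k g j)).baseChange K

/-- Finitely generated `kE`-modules of constant Jordan type: the numbers of Jordan blocks of
`X_α` on `M_K` do not depend on the field extension `K` of `k` and on `0 ≠ α ∈ K ^ r`. -/
def constantJordanType : ObjectProperty (ModuleCat.{u} (MonoidAlgebra k E)) := fun M =>
  Module.Finite (MonoidAlgebra k E) M ∧
    ∃ a : Fin p → ℕ, ∀ (K : Type u) [Field K] [Algebra k K] (α : Fin r → K), α ≠ 0 →
      HasJordanType (actAlpha g M K α) a

/-- The sequence `0 ⟶ M₁ ⟶ M₂ ⟶ M₃ ⟶ 0` of `kE`-modules is exact and, for every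
`0 ≠ α ∈ k ^ r`, it splits as a sequence of `k[X_α]`-modules, i.e. the surjection has a `k`-linear
section that commutes with `X_α`. -/
structure LocallySplitExact {M₁ M₂ M₃ : ModuleCat.{u} (MonoidAlgebra k E)} (f : M₁ ⟶ M₂)
    (h : M₂ ⟶ M₃) : Prop where
  injective : Function.Injective f
  exact : Function.Exact f h
  surjective : Function.Surjective h
  split : ∀ α : Fin r → k, α ≠ 0 → ∃ s : M₃ →ₗ[k] M₂, (∀ x, h (s x) = x) ∧
    ∀ x, s ((∑ j, α j • X k g j) • x) = (∑ j, α j • X k g j) • s x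

variable (k) in
/-- The functor `ℱ_i` on the category `𝒞(kE)` of modules of constant Jordan type. -/
def jordanF (i : ℕ) :
    (constantJordanType (k := k) g).FullSubcategory ⥤ (ProjSpace k r).Modules :=
  (constantJordanType g).ι ⋙ sheafF g i

end Functor

/-- Coherent sheaves on a (locally Noetherian) scheme: quasi-coherent of finite type. -/
def IsCoherent {Y : Scheme.{u}} (F : Y.Modules) : Prop :=
  SheafOfModules.IsQuasicoherent F ∧ SheafOfModules.IsFiniteType F

end BPBundles

end

/-! The operator `θ_M` is the universal `X_α`: its fibre at a point α of projective space, over any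
field `K`, is `X_α` acting on `K ⊗ M`. For a module of constant Jordan type the rank of `X_α ^ j` is
the same at all points, so the cokernel of `θ_M ^ j` has fibres of constant dimension. Over the
localization of the polynomial ring at a prime that omits some `Y_l`, a local domain, equality of
the closed and the generic fibre dimension makes this cokernel free (`free_of_finrank_le`,
`free_thetaCoker`). Both halves of the theorem rest on this freeness.

Coherence: free cokernels make the images of the powers of θ direct summands locally, then also `Ker
θ ∩ Im θ ^ j`, and successive quotients of the latter are projective
(`projective_quotient_ker_inf_range`). A basis of such a localized quotient can be picked among the
classes of homogeneous elements, and it remains a basis on a neighbourhood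
(`exists_homogeneous_local_basis`, `exists_isIso_free_restrict`). So `ℱ_i(M)` is locally free of
finite rank.

Exactness: at a rational point α the splitting makes the ranks of `X_α ^ j` on the three modules add
up. The ranks are constant, so they also add up at the generic point, and there this means that a
θ^j-image in `M₂` that lies in `M₁` is a θ^j-image in `M₁`. As the cokernels are locally
torsion-free, the same holds near every point (`LocallySplitExact.exists_smul_mem_range`). This
saturation makes `Ker θ ∩ Im θ ^ j` an exact functor on locally split sequences for every `j`
(`LocallySplitExact.shortExact_kerIm`), and a diagram chase (`shortExact_cokernel`) passes to the
quotients `ℱ_i`. -/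

noncomputable section

namespace BPBundles

/-! ### Ranks of powers of a nilpotent operator -/

section LinearAlgebra

/-- The rank of the `m`-th power of a nilpotent operator with `a j` Jordan blocks of length
`j + 1`. -/
def jordanRank {p : ℕ} (a : Fin p → ℕ) (m : ℕ) : ℕ :=
  Fintype.card {s : Σ j : Fin p, Fin (a j) × Fin (j + 1) // (s.2.2 : ℕ) + m ≤ s.1}

theorem HasJordanType.pow_apply {p : ℕ} {K V : Type u} [Field K] [AddCommGroup V] [Module K V]
    {f : V →ₗ[K] V} {a : Fin p → ℕ}
    {b : Module.Basis (Σ j : Fin p, Fin (a j) × Fin (j + 1)) K V}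
    (hb : ∀ (j : Fin p) (m : Fin (a j)) (l : Fin (j + 1)),
      f (b ⟨j, m, l⟩) = if (l : ℕ) = 0 then 0 else
        b ⟨j, m, ⟨(l : ℕ) - 1, (Nat.sub_le _ _).trans_lt l.2⟩⟩)
    (n : ℕ) (j : Fin p) (m : Fin (a j)) (l : Fin (j + 1)) :
    (f ^ n) (b ⟨j, m, l⟩) = if (l : ℕ) < n then 0 else
      b ⟨j, m, ⟨(l : ℕ) - n, (Nat.sub_le _ _).trans_lt l.2⟩⟩ := by
  induction n with
  | zero => simp
  | succ n ih =>
    rw [pow_succ', Module.End.mul_apply, ih]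
    split_ifs with h1 h2 h2
    · simp
    · omega
    · rw [hb, if_pos (by simp; omega)]
    · rw [hb, if_neg (by simp; omega)]
      congr 5

/-- `f ^ n` sends each basis vector to zero or to the one `n` places lower in its string, so the
range is spanned by the basis vectors with at least `n` others above them. -/
theorem HasJordanType.finrank_range_pow {p : ℕ} {K V : Type u} [Field K] [AddCommGroup V]
    [Module K V] {f : V →ₗ[K] V} {a : Fin p → ℕ} (h : HasJordanType f a) (n : ℕ) :
    Module.finrank K (LinearMap.range (f ^ n)) = jordanRank a n := by
  obtain ⟨b, hb⟩ := h
  have hr : LinearMap.range (f ^ n) = Submodule.span K (Set.range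
      (fun s : {s : Σ j : Fin p, Fin (a j) × Fin (j + 1) // (s.2.2 : ℕ) + n ≤ s.1} => b s.1)) := by
    rw [LinearMap.range_eq_map, ← b.span_eq, Submodule.map_span]
    apply le_antisymm
    · rw [Submodule.span_le]
      rintro _ ⟨_, ⟨⟨j, m, l⟩, rfl⟩, rfl⟩
      rw [SetLike.mem_coe, HasJordanType.pow_apply hb]
      split_ifs with h
      · exact zero_mem _
      · refine Submodule.subset_span ⟨⟨⟨j, m, ⟨(l : ℕ) - n, (Nat.sub_le _ _).trans_lt l.2⟩⟩, ?_⟩,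
          rfl⟩
        have := l.2
        simp only
        omega
    · rw [Submodule.span_le]
      rintro _ ⟨⟨⟨j, m, l⟩, hl⟩, rfl⟩
      simp only at hl
      refine Submodule.subset_span ⟨_, ⟨⟨j, m, ⟨(l : ℕ) + n, by omega⟩⟩, rfl⟩, ?_⟩
      rw [HasJordanType.pow_apply hb, if_neg (by simp)]
      simp
  rw [hr, jordanRank, finrank_span_eq_card]
  exact b.linearIndependent.comp _ Subtype.val_injective

theorem HasJordanType.finite {p : ℕ} {K V : Type u} [Field K] [AddCommGroup V]
    [Module K V] {f : V →ₗ[K] V} {a : Fin p → ℕ} (h : HasJordanType f a) : Module.Finite K V :=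
  Module.Finite.of_basis h.choose

/-! ### Ranks in short exact sequences of vector spaces with an operator -/

section Exact

variable {K : Type*} [Field K] {V₁ V₂ V₃ : Type*} [AddCommGroup V₁] [AddCommGroup V₂]
  [AddCommGroup V₃] [Module K V₁] [Module K V₂] [Module K V₃]
  {f : V₁ →ₗ[K] V₂} {h : V₂ →ₗ[K] V₃}
  {T₁ : V₁ →ₗ[K] V₁} {T₂ : V₂ →ₗ[K] V₂} {T₃ : V₃ →ₗ[K] V₃}

/-- Rank-nullity for `h` restricted to the range of `T₂`: the image is the range of `T₃` because `h`
is surjective, and the kernel is the part of the range that lies in `V₁`. -/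
theorem finrank_range_eq_finrank_comap_add [FiniteDimensional K V₂]
    (hf : Function.Injective f) (he : Function.Exact f h)
    (hs : Function.Surjective h) (hh : h ∘ₗ T₂ = T₃ ∘ₗ h) :
    Module.finrank K (LinearMap.range T₂) =
      Module.finrank K ((LinearMap.range T₂).comap f) + Module.finrank K (LinearMap.range T₃) := by
  have e1 := LinearMap.finrank_range_add_finrank_ker (h.domRestrict (LinearMap.range T₂))
  have e2 : LinearMap.range (h.domRestrict (LinearMap.range T₂)) = LinearMap.range T₃ := by
    rw [LinearMap.range_domRestrict, ← LinearMap.range_comp, hh, LinearMap.range_comp,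
      LinearMap.range_eq_top.2 hs, ← LinearMap.range_eq_map]
  have e3 : Module.finrank K (LinearMap.ker (h.domRestrict (LinearMap.range T₂))) =
      Module.finrank K ((LinearMap.range T₂).comap f) := by
    rw [(Submodule.equivMapOfInjective f hf _).finrank_eq, ← Submodule.finrank_map_subtype_eq]
    refine congrArg (fun W : Submodule K V₂ => Module.finrank K W) ?_
    ext x
    simp only [LinearMap.ker_domRestrict, Submodule.mem_map, Submodule.mem_comap]
    constructor
    · rintro ⟨⟨y, hy⟩, h1, rfl⟩
      obtain ⟨z, rfl⟩ := (he y).1 h1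
      exact ⟨z, hy, rfl⟩
    · rintro ⟨z, h1, rfl⟩
      exact ⟨⟨f z, h1⟩, (he _).2 ⟨z, rfl⟩, rfl⟩
  rw [← e1, e2, e3, add_comm]

theorem range_le_comap (hc : f ∘ₗ T₁ = T₂ ∘ₗ f) :
    LinearMap.range T₁ ≤ (LinearMap.range T₂).comap f := by
  rintro _ ⟨x, rfl⟩
  exact ⟨f x, (LinearMap.congr_fun hc x).symm⟩

/-- If `f x = T₂ y`, then `s (h y)` is killed by `T₂`, so it can be subtracted from `y`; the
difference comes from `V₁`. -/
theorem comap_range_eq_of_split (hc : f ∘ₗ T₁ = T₂ ∘ₗ f) (hf : Function.Injective f)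
    (he : Function.Exact f h) (hh : h ∘ₗ T₂ = T₃ ∘ₗ h) {s : V₃ →ₗ[K] V₂}
    (hs : h ∘ₗ s = LinearMap.id) (hs' : s ∘ₗ T₃ = T₂ ∘ₗ s) :
    (LinearMap.range T₂).comap f = LinearMap.range T₁ := by
  refine le_antisymm ?_ (range_le_comap hc)
  rintro x ⟨y, hy⟩
  obtain ⟨z, hz⟩ := (he (y - s (h y))).1 (by
    rw [map_sub, ← LinearMap.comp_apply h s, hs, LinearMap.id_apply, sub_self])
  have h1 : T₂ (s (h y)) = 0 := by
    rw [← LinearMap.comp_apply T₂ s, ← hs', LinearMap.comp_apply, ← LinearMap.comp_apply T₃ h,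
      ← hh, LinearMap.comp_apply, hy, (he (f x)).2 ⟨x, rfl⟩, map_zero]
  refine ⟨z, hf ?_⟩
  rw [← LinearMap.comp_apply f T₁, hc, LinearMap.comp_apply, hz, map_sub, hy, h1, sub_zero]

/-- The range of `T₁` always lies in the preimage, whose dimension is the difference of the other
two ranks. Additivity of ranks thus replaces a splitting at points where none is given. -/
theorem comap_range_eq_of_finrank [FiniteDimensional K V₁] [FiniteDimensional K V₂]
    (hc : f ∘ₗ T₁ = T₂ ∘ₗ f) (hf : Function.Injective f)
    (he : Function.Exact f h) (hs : Function.Surjective h) (hh : h ∘ₗ T₂ = T₃ ∘ₗ h)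
    (hr : Module.finrank K (LinearMap.range T₂) =
      Module.finrank K (LinearMap.range T₁) + Module.finrank K (LinearMap.range T₃)) :
    (LinearMap.range T₂).comap f = LinearMap.range T₁ := by
  refine (Submodule.eq_of_le_of_finrank_eq (range_le_comap hc) ?_).symm
  have := finrank_range_eq_finrank_comap_add hf he hs hh
  omega

end Exact

/-! ### Freeness over local domains, and direct summands -/

section Local

open IsLocalRing

/-- A finitely generated module over a local domain whose fibres at the closed and the generic
point have the same dimension is free. -/
theorem free_of_finrank_le {R : Type*} [CommRing R] [IsDomain R] [IsLocalRing R] (F : Type*)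
    [Field F] [Algebra R F] [IsFractionRing R F] {C : Type*} [AddCommGroup C] [Module R C]
    [Module.Finite R C]
    (h : Module.finrank (ResidueField R) (ResidueField R ⊗[R] C) ≤
      Module.finrank F (F ⊗[R] C)) : Module.Free R C := by
  have hfg : (⊤ : Submodule R C).FG := Module.Finite.fg_top
  obtain ⟨s, hs, hs'⟩ := hfg.exists_span_finset_card_eq_spanFinrank
  let φ : (s → R) →ₗ[R] C := Fintype.linearCombination R (fun c : s => (c : C))
  have hφ : Function.Surjective φ := by
    rw [← LinearMap.range_eq_top, Fintype.range_linearCombination, Subtype.range_coe_subtype]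
    simpa using hs'
  -- By Nakayama a minimal generating set has as many elements as the dimension of the closed fibre.
  have hcard : Fintype.card s ≤ Module.finrank F (F ⊗[R] C) := by
    refine le_trans (le_of_eq ?_) h
    rw [Fintype.card_coe, hs, ← TensorProduct.spanFinrank_top_eq_of_residueField _ hfg,
      ← Module.finrank_eq_spanFinrank_of_free]
    exact (LinearEquiv.baseChange R (ResidueField R) _ _ Submodule.topEquiv).finrank_eq
  -- A surjection from dimension `card s` onto a space of at least that dimension is injective.
  have hF : Function.Injective (φ.baseChange F) := by
    have hsurj : Function.Surjective (φ.baseChange F) :=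
      LinearMap.lTensor_surjective F hφ
    have h1 := LinearMap.finrank_range_add_finrank_ker (φ.baseChange F)
    have h2 : Module.finrank F (F ⊗[R] (s → R)) = Fintype.card s := by
      rw [Module.finrank_baseChange, Module.finrank_pi]
    rw [LinearMap.range_eq_top.2 hsurj, finrank_top, h2] at h1
    rw [← LinearMap.ker_eq_bot, ← Submodule.finrank_eq_zero (R := F)]
    omega
  have hinj : Function.Injective φ := by
    rw [← LinearMap.ker_eq_bot, LinearMap.ker_eq_bot']
    intro m hm
    have h2 : (1 : F) ⊗ₜ[R] m = 0 := by
      apply hF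
      rw [LinearMap.baseChange_tmul, hm, map_zero, TensorProduct.tmul_zero]
    have h3 := (IsLocalizedModule.eq_zero_iff (nonZeroDivisors R)
      (TensorProduct.mk R F (s → R) 1)).1 h2
    obtain ⟨c, hc⟩ := h3
    exact (smul_eq_zero.1 hc).resolve_left (nonZeroDivisors.coe_ne_zero c)
  exact Module.Free.of_equiv (LinearEquiv.ofBijective φ ⟨hinj, hφ⟩)

/-- A submodule is a direct summand. -/
def IsSummand {R V : Type*} [CommRing R] [AddCommGroup V] [Module R V] (W : Submodule R V) :
    Prop :=
  ∃ π : V →ₗ[R] W, ∀ x : W, π x = x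

variable {R V : Type*} [CommRing R] [AddCommGroup V] [Module R V]

theorem isSummand_of_projective_quotient (W : Submodule R V) [Module.Projective R (V ⧸ W)] :
    IsSummand W := by
  obtain ⟨s, hs⟩ := Module.projective_lifting_property W.mkQ LinearMap.id W.mkQ_surjective
  have hmem : ∀ x, (LinearMap.id - s ∘ₗ W.mkQ : V →ₗ[R] V) x ∈ W := fun x => by
    rw [← Submodule.Quotient.mk_eq_zero, ← Submodule.mkQ_apply, LinearMap.sub_apply, map_sub,
      LinearMap.comp_apply, ← LinearMap.comp_apply W.mkQ s, hs]
    simp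
  refine ⟨(LinearMap.id - s ∘ₗ W.mkQ).codRestrict W hmem, fun x => Subtype.ext ?_⟩
  simp [(Submodule.Quotient.mk_eq_zero W).2 x.2]

theorem IsSummand.projective [Module.Projective R V] {W : Submodule R V} (h : IsSummand W) :
    Module.Projective R W := by
  obtain ⟨π, hπ⟩ := h
  exact Module.Projective.of_split W.subtype π (LinearMap.ext hπ)

/-- `T` maps the range of `T ^ j` onto that of `T ^ (j + 1)`, which is projective, so this map
splits. Its kernel `Ker T ∩ Im T ^ j` is then a summand of `Im T ^ j`, which is itself a summand of
`V`. -/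
theorem isSummand_ker_inf_range [Module.Projective R V] (T : V →ₗ[R] V)
    (hT : ∀ j : ℕ, Module.Projective R (V ⧸ LinearMap.range (T ^ j))) (j : ℕ) :
    IsSummand (LinearMap.ker T ⊓ LinearMap.range (T ^ j)) := by
  obtain ⟨π, hπ⟩ := isSummand_of_projective_quotient (LinearMap.range (T ^ j))
  have := (isSummand_of_projective_quotient (LinearMap.range (T ^ (j + 1)))).projective
  let T' : LinearMap.range (T ^ j) →ₗ[R] LinearMap.range (T ^ (j + 1)) :=
    T.restrict (by rintro _ ⟨x, rfl⟩; exact ⟨x, by rw [pow_succ']; rfl⟩)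
  have hT' : Function.Surjective T' := by
    rintro ⟨_, x, rfl⟩
    exact ⟨⟨(T ^ j) x, x, rfl⟩,
      Subtype.ext (LinearMap.congr_fun (pow_succ' T j) x : (T ^ (j + 1)) x = _).symm⟩
  obtain ⟨s, hs⟩ := Module.projective_lifting_property T' LinearMap.id hT'
  have hs2 : ∀ y, T (s y) = y := fun y => congrArg Subtype.val (LinearMap.congr_fun hs y)
  let σ : V →ₗ[R] LinearMap.range (T ^ j) := (LinearMap.id - s ∘ₗ T') ∘ₗ π
  have hσ : ∀ x, ((LinearMap.range (T ^ j)).subtype ∘ₗ σ) x ∈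
      LinearMap.ker T ⊓ LinearMap.range (T ^ j) := by
    refine fun x => ⟨?_, (σ x).2⟩
    have h1 : T ((σ x : LinearMap.range (T ^ j)) : V) = T (π x) - T (s (T' (π x))) := by
      rw [← map_sub]; rfl
    exact h1.trans (by rw [hs2]; exact sub_self _)
  refine ⟨((LinearMap.range (T ^ j)).subtype ∘ₗ σ).codRestrict _ hσ, fun x => Subtype.ext ?_⟩
  have h1 : π x = ⟨x, x.2.2⟩ := hπ ⟨x, x.2.2⟩
  have h2 : T' ⟨x, x.2.2⟩ = 0 := Subtype.ext x.2.1
  have h3 : σ x = ⟨x, x.2.2⟩ := by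
    change π x - s (T' (π x)) = _
    rw [h1, h2, map_zero, sub_zero]
  exact (congrArg Subtype.val h3 : ((σ x : LinearMap.range (T ^ j)) : V) = x)

/-- A retraction `π` of `V` onto the smaller module restricts to the larger one, which is
projective; `id - π` kills the smaller module and so gives a section of the quotient map. -/
theorem projective_quotient_ker_inf_range [Module.Projective R V] (T : V →ₗ[R] V)
    (hT : ∀ j : ℕ, Module.Projective R (V ⧸ LinearMap.range (T ^ j))) (j : ℕ) :
    Module.Projective R ((LinearMap.ker T ⊓ LinearMap.range (T ^ j) : Submodule R V) ⧸
      (LinearMap.ker T ⊓ LinearMap.range (T ^ (j + 1))).submoduleOf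
        (LinearMap.ker T ⊓ LinearMap.range (T ^ j))) := by
  have := (isSummand_ker_inf_range T hT j).projective
  have hK' := isSummand_ker_inf_range T hT (j + 1)
  set K := LinearMap.ker T ⊓ LinearMap.range (T ^ j)
  set K' := LinearMap.ker T ⊓ LinearMap.range (T ^ (j + 1))
  obtain ⟨π, hπ⟩ := hK'
  have hle : K' ≤ K := inf_le_inf_left _ (by
    rintro _ ⟨x, rfl⟩
    exact ⟨T x, by rw [pow_succ]; rfl⟩)
  let σ : K →ₗ[R] K := LinearMap.id - Submodule.inclusion hle ∘ₗ π ∘ₗ K.subtype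
  have hσ : K'.submoduleOf K ≤ LinearMap.ker σ := fun x hx => by
    have : π x = ⟨x, hx⟩ := hπ ⟨x.1, hx⟩
    rw [LinearMap.mem_ker]
    apply Subtype.ext
    simp [σ, this]
  refine Module.Projective.of_split ((K'.submoduleOf K).liftQ σ hσ) (K'.submoduleOf K).mkQ ?_
  apply Submodule.linearMap_qext
  ext x
  rw [LinearMap.comp_assoc, Submodule.liftQ_mkQ]
  simp only [LinearMap.comp_apply, LinearMap.id_apply, σ, LinearMap.sub_apply, map_sub]
  rw [sub_eq_self, Submodule.mkQ_apply, Submodule.Quotient.mk_eq_zero]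
  exact (π x).2

end Local

end LinearAlgebra

end BPBundles

end

noncomputable section

namespace BPBundles

variable {p : ℕ} {k : Type u} [Field k] {r : ℕ} {E : Type v} [CommGroup E]
  [Module (ZMod p) (Additive E)] (g : Module.Basis (Fin r) (ZMod p) (Additive E))

attribute [local instance] ModuleCat.moduleOfAlgebraModule
  ModuleCat.isScalarTower_of_algebra_moduleCat

/-! ### Local freeness of the cokernels of the powers of θ -/

section Cokernel

variable (M : ModuleCat.{u} (MonoidAlgebra k E))

/-- The cokernel of `θ_M ^ j` as a graded module. -/
abbrev thetaCoker (j : ℕ) : Type u :=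
  (MvPolynomial (Fin r) k ⊗[k] M) ⧸ LinearMap.range (thetaLin g M ^ j)

section Field

variable (K : Type u) [Field K] [Algebra k K] [Algebra (MvPolynomial (Fin r) k) K]
  [IsScalarTower k (MvPolynomial (Fin r) k) K]

/-- `θ_M` is `X_α` with the coordinates `Y_j` in place of α; mapping the polynomial ring to `K`
specialises α. -/
theorem cancelBaseChange_thetaLin (x : K ⊗[MvPolynomial (Fin r) k] (MvPolynomial (Fin r) k ⊗[k] M)) :
    TensorProduct.AlgebraTensorModule.cancelBaseChange k (MvPolynomial (Fin r) k) K K M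
        ((thetaLin g M).baseChange K x) =
      actAlpha g M K (fun j => algebraMap (MvPolynomial (Fin r) k) K (MvPolynomial.X j))
        (TensorProduct.AlgebraTensorModule.cancelBaseChange k (MvPolynomial (Fin r) k) K K M x) := by
  induction x using TensorProduct.induction_on with
  | zero => simp
  | add x y hx hy => simp only [map_add, hx, hy]
  | tmul c x =>
    induction x using TensorProduct.induction_on with
    | zero => simp
    | add x y hx hy => simp only [map_add, TensorProduct.tmul_add, hx, hy]
    | tmul a m =>
      simp only [LinearMap.baseChange_tmul, thetaLin, LinearMap.sum_apply, LinearMap.smul_apply,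
        TensorProduct.tmul_sum, map_sum, actAlpha,
        TensorProduct.AlgebraTensorModule.cancelBaseChange_tmul, TensorProduct.smul_tmul',
        smul_eq_mul, mul_smul, algebraMap_smul]

theorem cancelBaseChange_thetaLin_pow (j : ℕ)
    (x : K ⊗[MvPolynomial (Fin r) k] (MvPolynomial (Fin r) k ⊗[k] M)) :
    TensorProduct.AlgebraTensorModule.cancelBaseChange k (MvPolynomial (Fin r) k) K K M
        ((thetaLin g M ^ j).baseChange K x) =
      (actAlpha g M K (fun j => algebraMap (MvPolynomial (Fin r) k) K (MvPolynomial.X j)) ^ j)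
        (TensorProduct.AlgebraTensorModule.cancelBaseChange k (MvPolynomial (Fin r) k) K K M x) := by
  induction j generalizing x with
  | zero => simp
  | succ j ih =>
    rw [pow_succ, pow_succ, Module.End.mul_apply, ← cancelBaseChange_thetaLin, ← ih,
      Module.End.mul_eq_comp, LinearMap.baseChange_comp, LinearMap.comp_apply]

/-- Tensoring is right exact, so the fibre of the cokernel is the cokernel on the fibre, and only
the rank of `X_α ^ j` enters. -/
theorem finrank_thetaCoker_add [FiniteDimensional K (K ⊗[k] M)] (j : ℕ) :
    Module.finrank K (K ⊗[MvPolynomial (Fin r) k] thetaCoker g M j) +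
      Module.finrank K (LinearMap.range (actAlpha g M K
        (fun j => algebraMap (MvPolynomial (Fin r) k) K (MvPolynomial.X j)) ^ j)) =
      Module.finrank K (K ⊗[k] M) := by
  let e := TensorProduct.AlgebraTensorModule.cancelBaseChange k (MvPolynomial (Fin r) k) K K M
  have := Module.Finite.equiv e.symm
  let q := (LinearMap.range (thetaLin g M ^ j)).mkQ.baseChange K
  have hq : Function.Surjective q :=
    LinearMap.lTensor_surjective K (Submodule.mkQ_surjective _)
  have hex : Function.Exact ((thetaLin g M ^ j).baseChange K) q :=
    lTensor_exact K (LinearMap.exact_map_mkQ_range _) (Submodule.mkQ_surjective _)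
  have h1 := LinearMap.finrank_range_add_finrank_ker q
  rw [LinearMap.range_eq_top.2 hq, finrank_top, e.finrank_eq,
    LinearMap.exact_iff.1 hex] at h1
  rw [← h1, add_right_inj,
    (e.submoduleMap (LinearMap.range ((thetaLin g M ^ j).baseChange K))).finrank_eq]
  refine congrArg (fun W : Submodule K (K ⊗[k] M) => Module.finrank K W) ?_
  ext y
  constructor
  · rintro ⟨z, rfl⟩
    refine ⟨_, ⟨e.symm z, rfl⟩, ?_⟩
    refine (cancelBaseChange_thetaLin_pow g M K j (e.symm z)).trans ?_
    exact congrArg _ (e.apply_symm_apply z)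
  · rintro ⟨_, ⟨z, rfl⟩, rfl⟩
    exact ⟨_, (cancelBaseChange_thetaLin_pow g M K j z).symm⟩

end Field

variable {M} in
theorem finite_of_constantJordanType (hr : 0 < r) (hM : constantJordanType (k := k) g M) :
    Module.Finite k M := by
  obtain ⟨-, a, ha⟩ := hM
  have h : (fun _ : Fin r => (1 : k)) ≠ 0 := fun h => one_ne_zero (congrFun h ⟨0, hr⟩)
  have := (ha k _ h).finite
  exact Module.Finite.equiv (TensorProduct.lid k M)

variable {M} in
-- The condition on `l` makes α nonzero: `K` lies over a point of projective space and not over the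
-- vertex of the cone.
theorem finrank_thetaCoker_eq (hM : constantJordanType (k := k) g M) :
    ∃ a : Fin p → ℕ, ∀ (K : Type u) [Field K] [Algebra k K] [Algebra (MvPolynomial (Fin r) k) K]
      [IsScalarTower k (MvPolynomial (Fin r) k) K] (l : Fin r),
      algebraMap (MvPolynomial (Fin r) k) K (MvPolynomial.X l) ≠ 0 → ∀ j : ℕ,
      Module.finrank K (K ⊗[MvPolynomial (Fin r) k] thetaCoker g M j) + jordanRank a j =
        Module.finrank k M := by
  have hM' := hM
  obtain ⟨-, a, ha⟩ := hM
  refine ⟨a, fun K _ _ _ _ l hl j => ?_⟩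
  have := finite_of_constantJordanType g l.pos hM'
  rw [← (ha K (fun j => algebraMap (MvPolynomial (Fin r) k) K (MvPolynomial.X j))
    fun h => hl (congrFun h l)).finrank_range_pow, finrank_thetaCoker_add,
    Module.finrank_baseChange]

variable {M} in
/-- The cokernel of `θ_M ^ j` is locally free on projective space if `M` has constant Jordan
type. -/
theorem free_thetaCoker (hM : constantJordanType (k := k) g M) (R : Type u) [CommRing R]
    [IsDomain R] [IsLocalRing R] [Algebra k R] [Algebra (MvPolynomial (Fin r) k) R]
    [IsScalarTower k (MvPolynomial (Fin r) k) R] (l : Fin r)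
    (hl : IsUnit (algebraMap (MvPolynomial (Fin r) k) R (MvPolynomial.X l))) (j : ℕ) :
    Module.Free R (R ⊗[MvPolynomial (Fin r) k] thetaCoker g M j) := by
  obtain ⟨a, ha⟩ := finrank_thetaCoker_eq g hM
  have := finite_of_constantJordanType g l.pos hM
  -- The unit `Y_l` of `R` stays nonzero in every field over `R`, so all these fibres have the same
  -- dimension; it is used for the residue field and the fraction field.
  have hK : ∀ (K : Type u) [Field K] [Algebra R K],
      Module.finrank K (K ⊗[R] (R ⊗[MvPolynomial (Fin r) k] thetaCoker g M j)) + jordanRank a j =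
        Module.finrank k M := fun K _ _ => by
    let _ : Algebra (MvPolynomial (Fin r) k) K := Algebra.compHom K (algebraMap _ R)
    let _ : Algebra k K := Algebra.compHom K (algebraMap k R)
    have _ : IsScalarTower (MvPolynomial (Fin r) k) R K := .of_algebraMap_eq fun _ => rfl
    have _ : IsScalarTower k R K := .of_algebraMap_eq fun _ => rfl
    have _ : IsScalarTower k (MvPolynomial (Fin r) k) K := .to₁₂₄ k (MvPolynomial (Fin r) k) R K
    rw [(TensorProduct.AlgebraTensorModule.cancelBaseChange (MvPolynomial (Fin r) k)
      R K K (thetaCoker g M j)).finrank_eq]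
    refine ha K l ?_ j
    rw [IsScalarTower.algebraMap_apply _ R K]
    exact (hl.map _).ne_zero
  have h1 := hK (IsLocalRing.ResidueField R)
  have h2 := hK (FractionRing R)
  exact free_of_finrank_le (FractionRing R) (by omega)

end Cokernel

end BPBundles

end

noncomputable section

namespace BPBundles

theorem comp_pow_eq {R V W : Type*} [CommRing R] [AddCommGroup V] [Module R V] [AddCommGroup W]
    [Module R W] {f : V →ₗ[R] W} {S : V →ₗ[R] V} {T : W →ₗ[R] W} (h : f ∘ₗ S = T ∘ₗ f) (j : ℕ) :
    f ∘ₗ (S ^ j) = (T ^ j) ∘ₗ f := by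
  induction j with
  | zero => rfl
  | succ j ih =>
    rw [pow_succ, pow_succ, Module.End.mul_eq_comp, Module.End.mul_eq_comp, ← LinearMap.comp_assoc,
      ih, LinearMap.comp_assoc, h, LinearMap.comp_assoc]

/-! ### Bases of the localized quotients -/

section LocalBasis

/-- A free module over the domain `R` has no `c`-torsion, so the class of `v` vanishes in the
localization at `P`, that is, some `s` outside `P` kills it. -/
theorem exists_smul_mem_range_of_free {A : Type*} [CommRing A] [IsDomain A] (P : Ideal A)
    [P.IsPrime] {V : Type*} [AddCommGroup V] [Module A V] (R : Type*) [CommRing R] [IsDomain R]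
    [Algebra A R] [IsLocalization.AtPrime R P] {θ : V →ₗ[A] V}
    [Module.Free (R) (R ⊗[A] (V ⧸ LinearMap.range θ))]
    {c : A} (hc : c ≠ 0) {v : V} (hv : c • v ∈ LinearMap.range θ) :
    ∃ s : A, s ∉ P ∧ s • v ∈ LinearMap.range θ := by
  have h1 : c • (1 : R) ⊗ₜ[A] (LinearMap.range θ).mkQ v = 0 := by
    rw [← TensorProduct.tmul_smul, ← map_smul, Submodule.mkQ_apply,
      (Submodule.Quotient.mk_eq_zero _).2 hv, TensorProduct.tmul_zero]
  rw [← algebraMap_smul (R), smul_eq_zero] at h1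
  have h2 := h1.resolve_left (by
    have := IsLocalization.AtPrime.faithfulSMul R A P
    rwa [FaithfulSMul.algebraMap_eq_zero_iff])
  obtain ⟨s, hs⟩ := (IsLocalizedModule.eq_zero_iff P.primeCompl
    (TensorProduct.mk A (R) (V ⧸ LinearMap.range θ) 1)).1 h2
  refine ⟨s, s.2, ?_⟩
  rwa [← Submodule.Quotient.mk_eq_zero, Submodule.Quotient.mk_smul]

theorem projective_quotient_range_baseChange {A : Type*} [CommRing A] {V : Type*}
    [AddCommGroup V] [Module A V] (R : Type*) [CommRing R] [Algebra A R] {θ : V →ₗ[A] V}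
    [Module.Free (R) (R ⊗[A] (V ⧸ LinearMap.range θ))] :
    Module.Projective (R) ((R ⊗[A] V) ⧸
      LinearMap.range (θ.baseChange (R))) := by
  let q := (LinearMap.range θ).mkQ.baseChange (R)
  have hq : Function.Surjective q :=
    LinearMap.lTensor_surjective _ (Submodule.mkQ_surjective _)
  have hex : Function.Exact (θ.baseChange (R)) q :=
    lTensor_exact _ (LinearMap.exact_map_mkQ_range _) (Submodule.mkQ_surjective _)
  rw [← LinearMap.exact_iff.1 hex]
  exact Module.Projective.of_equiv (q.quotKerEquivOfSurjective hq).symm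


variable {A : Type*} [CommRing A] (P : Ideal A) [P.IsPrime] {V : Type*}
  [AddCommGroup V] [Module A V] {R : Type*} [CommRing R] [Algebra A R] [IsLocalization.AtPrime R P]
  {V' : Type*} [AddCommGroup V'] [Module A V'] [Module R V'] [IsScalarTower A R V']
  (ι : V →ₗ[A] V') [IsLocalizedModule P.primeCompl ι]

theorem exists_smul_eq_of_isLocalizedModule (x : V') :
    ∃ s : A, s ∉ P ∧ ∃ v : V, s • x = ι v := by
  obtain ⟨⟨v, s⟩, h⟩ := IsLocalizedModule.surj P.primeCompl ι x
  exact ⟨s, s.2, v, h⟩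

theorem injective_of_isLocalizedModule {A : Type*} [CommRing A] [IsDomain A] (P : Ideal A)
    [P.IsPrime] {V V' : Type*} [AddCommGroup V] [Module A V] [AddCommGroup V'] [Module A V']
    (ι : V →ₗ[A] V') [IsLocalizedModule P.primeCompl ι] [Module.IsTorsionFree A V] :
    Function.Injective ι := by
  intro v w h
  obtain ⟨c, hc⟩ := (IsLocalizedModule.eq_iff_exists P.primeCompl ι).1 h
  have hc0 : (c : A) ≠ 0 := fun h0 => c.2 (h0 ▸ zero_mem P)
  exact smul_right_injective V hc0 hc

/-- The localized quotient `(Ker T ∩ Im T ^ j) / (Ker T ∩ Im T ^ (j + 1))` is projective over the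
local ring `R`, and the classes of the `θ ^ j (w i)` generate it. Some of them therefore form a
basis, and clearing denominators expresses this over `A`: independence modulo `Im θ ^ (j + 1)`, and
generation up to a factor outside `P`. -/
theorem exists_local_basis [IsDomain A] [IsNoetherianRing A] [Module.IsTorsionFree A V]
    [Module.Finite R V'] [Module.Projective R V']
    (θ : V →ₗ[A] V) (T : V' →ₗ[R] V') (hι : ∀ v, T (ι v) = ι (θ v))
    (hT : ∀ n : ℕ, Module.Projective R (V' ⧸ LinearMap.range (T ^ n)))
    (j : ℕ) {I : Type w} (w : I → V) (hw : ∀ i, (θ ^ (j + 1)) (w i) = 0)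
    (hspan : ∀ z, (θ ^ (j + 1)) z = 0 → z ∈ Submodule.span A (Set.range w)) :
    ∃ (κ : Type w) (_ : Fintype κ) (a : κ → I),
      (∀ (c : κ → A) (v : V), ∑ i, c i • (θ ^ j) (w (a i)) = (θ ^ (j + 1)) v → c = 0) ∧
      ∀ z, (θ ^ (j + 1)) z = 0 → ∃ h : A, h ∉ P ∧ ∃ (c : κ → A) (v : V),
        h • (θ ^ j) z = ∑ i, c i • (θ ^ j) (w (a i)) + (θ ^ (j + 1)) v := by
  have hTpow : ∀ (n : ℕ) (v : V), (T ^ n) (ι v) = ι ((θ ^ n) v) := fun n v => by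
    induction n with
    | zero => rfl
    | succ n ih => rw [pow_succ', pow_succ', Module.End.mul_apply, Module.End.mul_apply, ih, hι]
  have hG := projective_quotient_ker_inf_range T hT j
  have hTT : ∀ (n : ℕ) (x : V'), T ((T ^ n) x) = (T ^ (n + 1)) x := fun n x => by
    rw [pow_succ']; rfl
  set K := LinearMap.ker T ⊓ LinearMap.range (T ^ j)
  set K' := LinearMap.ker T ⊓ LinearMap.range (T ^ (j + 1))
  have hmem : ∀ z : V, (θ ^ (j + 1)) z = 0 → ι ((θ ^ j) z) ∈ K := fun z hz => by
    refine ⟨?_, ⟨ι z, hTpow j z⟩⟩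
    rw [SetLike.mem_coe, LinearMap.mem_ker, ← hTpow, hTT, hTpow, hz, map_zero]
  let N : Submodule A V := LinearMap.ker (θ ^ (j + 1))
  -- `μ z` is the class of `θ ^ j z`. Up to factors outside `P`, it vanishes exactly when `θ ^ j z`
  -- is a θ^(j+1)-image (`hμ1`, `hμ2`).
  let μ : N →ₗ[A] K ⧸ K'.submoduleOf K :=
    ((K'.submoduleOf K).mkQ.restrictScalars A) ∘ₗ
      (LinearMap.codRestrict (K.restrictScalars A)
        (ι ∘ₗ (θ ^ j) ∘ₗ N.subtype) (fun z => hmem z z.2))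
  have hμ : ∀ z : N, μ z = (K'.submoduleOf K).mkQ ⟨ι ((θ ^ j) z), hmem z z.2⟩ := fun z => rfl
  have hμ0 : ∀ z : N, μ z = 0 ↔ ι ((θ ^ j) (z : V)) ∈ K' := fun z => by
    rw [hμ, Submodule.mkQ_apply, Submodule.Quotient.mk_eq_zero]
    rfl
  have hμ1 : ∀ z : N, μ z = 0 → ∃ s : A, s ∉ P ∧ ∃ v, s • (θ ^ j) (z : V) = (θ ^ (j + 1)) v := by
    intro z hz
    obtain ⟨-, y, hy⟩ := (hμ0 z).1 hz
    obtain ⟨s, hs, v, hv⟩ := exists_smul_eq_of_isLocalizedModule P ι y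
    refine ⟨s, hs, v, injective_of_isLocalizedModule P ι ?_⟩
    rw [map_smul, ← hy, ← hTpow, ← hv, LinearMap.map_smul_of_tower]
  have hμ2 : ∀ (z : N) (v : V), (θ ^ j) (z : V) = (θ ^ (j + 1)) v → μ z = 0 := by
    intro z v hv
    refine (hμ0 z).2 ⟨(hmem z z.2).1, ι v, ?_⟩
    rw [hTpow, hv]
  let wN : I → N := fun i => ⟨w i, hw i⟩
  have hwN : Submodule.span A (Set.range wN) = ⊤ := by
    refine Submodule.map_injective_of_injective N.injective_subtype ?_
    rw [Submodule.map_span, ← Set.range_comp, Submodule.map_top, Submodule.range_subtype]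
    exact le_antisymm (Submodule.span_le.2 (by rintro _ ⟨i, rfl⟩; exact hw i)) hspan
  -- An element of `K` is `T ^ j y`; a multiple of `y` by some `s` outside `P` comes from `v` in
  -- `V`, and `θ ^ (j + 1) v = 0` because `V` embeds in its localization.
  have hv : Submodule.span R (Set.range (fun i => μ (wN i))) = ⊤ := by
    have hμs : ∀ z : N, μ z ∈ Submodule.span R (Set.range (fun i => μ (wN i))) := by
      intro z
      have h1 : μ z ∈ Submodule.map μ (Submodule.span A (Set.range wN)) :=
        ⟨z, by rw [hwN]; trivial, rfl⟩
      rw [Submodule.map_span, ← Set.range_comp] at h1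
      exact Submodule.span_le_restrictScalars A R _ h1
    rw [eq_top_iff]
    rintro x -
    obtain ⟨⟨_, hx, y, rfl⟩, rfl⟩ := Submodule.mkQ_surjective _ x
    obtain ⟨s, hs, v, hv⟩ := exists_smul_eq_of_isLocalizedModule P ι y
    have hvN : (θ ^ (j + 1)) v = 0 := by
      apply injective_of_isLocalizedModule P ι
      rw [map_zero, ← hTpow, ← hv, LinearMap.map_smul_of_tower, ← hTT,
        LinearMap.mem_ker.1 hx, smul_zero]
    have hunit : IsUnit (algebraMap A R s) := IsLocalization.map_units R (⟨s, hs⟩ : P.primeCompl)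
    rw [← Submodule.smul_mem_iff_of_isUnit _ hunit]
    convert hμs ⟨v, hvN⟩ using 1
    rw [hμ, ← map_smul]
    congr 1
    apply Subtype.ext
    change algebraMap A R s • (T ^ j) y = _
    rw [algebraMap_smul, ← LinearMap.map_smul_of_tower, hv, hTpow]
  have := IsLocalization.AtPrime.isLocalRing R P
  have := IsLocalization.isNoetherianRing P.primeCompl R inferInstance
  have := IsLocalization.AtPrime.faithfulSMul R A P
  have := isNoetherian_of_isNoetherianRing_of_finite R V'
  have := Module.finitePresentation_of_finite R (K ⧸ K'.submoduleOf K)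
  -- Over a local ring every generating family of a finitely presented flat module contains a basis.
  obtain ⟨κ, a, b, hb⟩ := Module.exists_basis_of_span_of_flat _ hv
  have := Module.Finite.finite_basis b
  have := Fintype.ofFinite κ
  have hsum : ∀ c : κ → A, μ (∑ i, c i • wN (a i)) = ∑ i, algebraMap A R (c i) • b i := fun c => by
    simp only [map_sum, map_smul, hb, algebraMap_smul]
  have hsum' : ∀ c : κ → A, (θ ^ j) ((∑ i, c i • wN (a i) : N) : V) =
      ∑ i, c i • (θ ^ j) (w (a i)) := fun c => by
    simp [wN]
  refine ⟨κ, this, a, fun c v hcv => ?_, fun z hz => ?_⟩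
  · have h1 := hμ2 (∑ i, c i • wN (a i)) v (by rw [hsum', hcv])
    rw [hsum] at h1
    funext i
    have h2 := Fintype.linearIndependent_iff.1 b.linearIndependent _ h1 i
    rwa [FaithfulSMul.algebraMap_eq_zero_iff] at h2
  -- A common denominator `s` moves the coordinates into `A`; the remaining error is killed by `μ`,
  -- so a second factor `u` makes it a θ^(j+1)-image.
  · obtain ⟨s, hs⟩ := IsLocalization.exist_integer_multiples_of_finite P.primeCompl
      (fun i => b.repr (μ ⟨z, hz⟩) i)
    choose c hc using hs
    have h1 : μ ((s : A) • ⟨z, hz⟩ - ∑ i, c i • wN (a i)) = 0 := by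
      rw [map_sub, hsum, map_smul, sub_eq_zero]
      conv_lhs => rw [← b.sum_repr (μ ⟨z, hz⟩)]
      rw [Finset.smul_sum]
      refine Finset.sum_congr rfl fun i _ => ?_
      rw [hc, smul_assoc]
    obtain ⟨u, hu, v, huv⟩ := hμ1 _ h1
    refine ⟨u * s, fun h => ?_, fun i => u * c i, v, ?_⟩
    · exact (Ideal.IsPrime.mem_or_mem ‹_› h).elim hu s.2
    · rw [← huv, Submodule.coe_sub, map_sub, hsum', smul_sub, Finset.smul_sum]
      simp [mul_smul]

theorem exists_local_basis_of_free {A : Type u} [CommRing A] [IsDomain A] [IsNoetherianRing A]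
    (P : Ideal A) [P.IsPrime] {V : Type u} [AddCommGroup V] [Module A V]
    [Module.Finite A V] [Module.Free A V] (R : Type u) [CommRing R] [Algebra A R]
    [IsLocalization.AtPrime R P] (θ : V →ₗ[A] V)
    (hθ : ∀ n : ℕ, Module.Free R (R ⊗[A] (V ⧸ LinearMap.range (θ ^ n))))
    (j : ℕ) {I : Type w} (w : I → V) (hw : ∀ i, (θ ^ (j + 1)) (w i) = 0)
    (hspan : ∀ z, (θ ^ (j + 1)) z = 0 → z ∈ Submodule.span A (Set.range w)) :
    ∃ (κ : Type w) (_ : Fintype κ) (a : κ → I),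
      (∀ (c : κ → A) (v : V), ∑ i, c i • (θ ^ j) (w (a i)) = (θ ^ (j + 1)) v → c = 0) ∧
      ∀ z, (θ ^ (j + 1)) z = 0 → ∃ h : A, h ∉ P ∧ ∃ (c : κ → A) (v : V),
        h • (θ ^ j) z = ∑ i, c i • (θ ^ j) (w (a i)) + (θ ^ (j + 1)) v := by
  refine exists_local_basis P (R := R) (V' := R ⊗[A] V) (TensorProduct.mk A R V 1) θ
    (θ.baseChange R) (fun v => rfl) (fun n => ?_) j w hw hspan
  have := projective_quotient_range_baseChange R (θ := θ ^ n)
  rwa [LinearMap.baseChange_pow] at this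

end LocalBasis

end BPBundles

end

noncomputable section

namespace BPBundles

variable {p : ℕ} {k : Type u} [Field k] {r : ℕ} {E : Type v} [CommGroup E]
  [Module (ZMod p) (Additive E)] {g : Module.Basis (Fin r) (ZMod p) (Additive E)}

attribute [local instance] ModuleCat.moduleOfAlgebraModule
  ModuleCat.isScalarTower_of_algebra_moduleCat

/-! ### Saturation: θ^j-images of `M₂` that lie in `M₁` -/

section Saturation

variable {M₁ M₂ M₃ : ModuleCat.{u} (MonoidAlgebra k E)} {f : M₁ ⟶ M₂} {h : M₂ ⟶ M₃}

theorem LocallySplitExact.exact_lin (H : LocallySplitExact g f h) :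
    Function.Exact (lin f) (lin h) := H.exact

theorem baseChange_comp_actAlpha (f : M₁ ⟶ M₂) (K : Type u) [Field K] [Algebra k K]
    (α : Fin r → K) :
    (lin f).baseChange K ∘ₗ actAlpha g M₁ K α = actAlpha g M₂ K α ∘ₗ (lin f).baseChange K := by
  refine TensorProduct.AlgebraTensorModule.ext fun a m => ?_
  simp only [LinearMap.comp_apply, actAlpha, LinearMap.sum_apply, LinearMap.smul_apply,
    LinearMap.baseChange_tmul, map_sum, map_smul]
  refine Finset.sum_congr rfl fun j _ => ?_
  congr 2
  exact f.hom.map_smul (X k g j) m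

theorem actAlpha_self (M : ModuleCat.{u} (MonoidAlgebra k E)) (α : Fin r → k) :
    actAlpha g M k α = (act M (∑ j, α j • X k g j)).baseChange k := by
  refine TensorProduct.AlgebraTensorModule.ext fun a m => ?_
  simp only [actAlpha, LinearMap.sum_apply, LinearMap.smul_apply, LinearMap.baseChange_tmul]
  have h1 : act M (∑ j, α j • X k g j) m = ∑ j, α j • act M (X k g j) m := by
    simp only [act, map_sum, map_smul, LinearMap.sum_apply, LinearMap.smul_apply]
  rw [h1, TensorProduct.tmul_sum]
  simp only [TensorProduct.tmul_smul]

/-- A section that commutes with `X_α` makes the image on `M₁` the preimage of the image on `M₂`.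
The tensor product with `k` is there because Jordan types are read off from `K ⊗ M`, also for `K =
k`. -/
theorem LocallySplitExact.finrank_range_actAlpha (H : LocallySplitExact g f h)
    [FiniteDimensional k M₂] {α : Fin r → k} (hα : α ≠ 0) (j : ℕ) :
    Module.finrank k (LinearMap.range (actAlpha g M₂ k α ^ j)) =
      Module.finrank k (LinearMap.range (actAlpha g M₁ k α ^ j)) +
      Module.finrank k (LinearMap.range (actAlpha g M₃ k α ^ j)) := by
  obtain ⟨s, hs, hs'⟩ := H.split α hα
  have hf : Function.Injective ((lin f).baseChange k) :=
    Module.Flat.lTensor_preserves_injective_linearMap (M := k) (lin f) H.injective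
  have hh : Function.Surjective ((lin h).baseChange k) :=
    LinearMap.lTensor_surjective k (g := lin h) H.surjective
  have he : Function.Exact ((lin f).baseChange k) ((lin h).baseChange k) :=
    lTensor_exact k H.exact_lin H.surjective
  rw [finrank_range_eq_finrank_comap_add hf he hh
    (comp_pow_eq (baseChange_comp_actAlpha (g := g) h k α) j),
    comap_range_eq_of_split (comp_pow_eq (baseChange_comp_actAlpha (g := g) f k α) j) hf he
    (comp_pow_eq (baseChange_comp_actAlpha (g := g) h k α) j) (s := s.baseChange k)
    ?_ (comp_pow_eq ?_ j)]
  · rw [← LinearMap.baseChange_comp, ← LinearMap.baseChange_id]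
    congr 1
    exact LinearMap.ext hs
  · rw [actAlpha_self, actAlpha_self, ← LinearMap.baseChange_comp, ← LinearMap.baseChange_comp]
    congr 1
    exact LinearMap.ext hs'

theorem LocallySplitExact.finite_left (H : LocallySplitExact g f h)
    [FiniteDimensional k M₂] : FiniteDimensional k M₁ :=
  FiniteDimensional.of_injective (lin f) H.injective

/-- The ranks do not depend on α, so their additivity, known at the rational point (1, …, 1) from
the splitting there, holds over every `K`, where no splitting is given. -/
theorem LocallySplitExact.comap_range_actAlpha (H : LocallySplitExact g f h)
    (h₁ : constantJordanType (k := k) g M₁) (h₂ : constantJordanType (k := k) g M₂)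
    (h₃ : constantJordanType (k := k) g M₃) (K : Type u) [Field K] [Algebra k K] {α : Fin r → K}
    (hα : α ≠ 0) (j : ℕ) :
    (LinearMap.range (actAlpha g M₂ K α ^ j)).comap ((lin f).baseChange K) =
      LinearMap.range (actAlpha g M₁ K α ^ j) := by
  obtain ⟨l, -⟩ := Function.ne_iff.1 hα
  have := finite_of_constantJordanType g l.pos h₂
  have := H.finite_left
  have hr := H.finrank_range_actAlpha (α := fun _ => 1) (fun h => one_ne_zero (congrFun h l)) j
  have h1 : (fun _ : Fin r => (1 : k)) ≠ 0 := fun h => one_ne_zero (congrFun h l)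
  obtain ⟨-, a₁, h₁⟩ := h₁
  obtain ⟨-, a₂, h₂⟩ := h₂
  obtain ⟨-, a₃, h₃⟩ := h₃
  refine comap_range_eq_of_finrank (h := (lin h).baseChange K) (comp_pow_eq (baseChange_comp_actAlpha (g := g) f K α) j)
    (Module.Flat.lTensor_preserves_injective_linearMap (M := K) (lin f) H.injective)
    (lTensor_exact K H.exact_lin H.surjective)
    (LinearMap.lTensor_surjective K (g := lin h) H.surjective)
    (comp_pow_eq (baseChange_comp_actAlpha (g := g) h K α) j) ?_
  rw [(h₁ K _ hα).finrank_range_pow, (h₂ K _ hα).finrank_range_pow,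
    (h₃ K _ hα).finrank_range_pow, ← (h₁ k _ h1).finrank_range_pow,
    ← (h₂ k _ h1).finrank_range_pow, ← (h₃ k _ h1).finrank_range_pow, hr]

theorem cancelBaseChange_baseChange (f : M₁ ⟶ M₂) (K : Type u) [Field K] [Algebra k K]
    [Algebra (MvPolynomial (Fin r) k) K] [IsScalarTower k (MvPolynomial (Fin r) k) K]
    (t : MvPolynomial (Fin r) k ⊗[k] M₁) :
    TensorProduct.AlgebraTensorModule.cancelBaseChange k (MvPolynomial (Fin r) k) K K M₂
        (1 ⊗ₜ (lin f).baseChange (MvPolynomial (Fin r) k) t) =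
      (lin f).baseChange K
        (TensorProduct.AlgebraTensorModule.cancelBaseChange k (MvPolynomial (Fin r) k) K K M₁
          (1 ⊗ₜ t)) := by
  induction t using TensorProduct.induction_on with
  | zero => simp
  | add x y hx hy => simp only [map_add, TensorProduct.tmul_add, hx, hy]
  | tmul a m => simp

/-- If `M₁`, `M₂`, `M₃` have constant Jordan type, then `θ ^ j`-images in `M₂` that lie in `M₁` are
locally `θ ^ j`-images in `M₁`. -/
theorem LocallySplitExact.exists_smul_mem_range (H : LocallySplitExact g f h)
    (h₁ : constantJordanType (k := k) g M₁) (h₂ : constantJordanType (k := k) g M₂)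
    (h₃ : constantJordanType (k := k) g M₃) (P : Ideal (MvPolynomial (Fin r) k)) [P.IsPrime]
    {l : Fin r} (hl : MvPolynomial.X l ∉ P) {j : ℕ} {t : MvPolynomial (Fin r) k ⊗[k] M₁}
    (ht : (lin f).baseChange (MvPolynomial (Fin r) k) t ∈ LinearMap.range (thetaLin g M₂ ^ j)) :
    ∃ s : MvPolynomial (Fin r) k, s ∉ P ∧ s • t ∈ LinearMap.range (thetaLin g M₁ ^ j) := by
  -- At the generic point, where α consists of the coordinates themselves, `t` is a θ^j-image.
  let K := FractionRing (MvPolynomial (Fin r) k)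
  let α : Fin r → K := fun j => algebraMap (MvPolynomial (Fin r) k) K (MvPolynomial.X j)
  have hα : α ≠ 0 := fun h => MvPolynomial.X_ne_zero (R := k) l
    ((FaithfulSMul.algebraMap_eq_zero_iff _ K).1 (congrFun h l))
  obtain ⟨y, hy⟩ := ht
  have h4 : TensorProduct.AlgebraTensorModule.cancelBaseChange k (MvPolynomial (Fin r) k) K K M₁
      (1 ⊗ₜ t) ∈ LinearMap.range (actAlpha g M₁ K α ^ j) := by
    rw [← H.comap_range_actAlpha h₁ h₂ h₃ K hα j, Submodule.mem_comap,
      ← cancelBaseChange_baseChange, ← hy]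
    exact ⟨_, (cancelBaseChange_thetaLin_pow g M₂ K j (1 ⊗ₜ y)).symm⟩
  obtain ⟨z, hz⟩ := h4
  obtain ⟨z, rfl⟩ := (TensorProduct.AlgebraTensorModule.cancelBaseChange k
    (MvPolynomial (Fin r) k) K K M₁).surjective z
  rw [← cancelBaseChange_thetaLin_pow, EmbeddingLike.apply_eq_iff_eq] at hz
  have h5 : (1 : K) ⊗ₜ[MvPolynomial (Fin r) k] (LinearMap.range (thetaLin g M₁ ^ j)).mkQ t = 0 := by
    have h6 := congrArg ((LinearMap.range (thetaLin g M₁ ^ j)).mkQ.baseChange K) hz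
    rw [LinearMap.baseChange_tmul, ← LinearMap.comp_apply, ← LinearMap.baseChange_comp,
      LinearMap.range_mkQ_comp, LinearMap.baseChange_zero, LinearMap.zero_apply] at h6
    exact h6.symm
  obtain ⟨c, hc⟩ := (IsLocalizedModule.eq_zero_iff (nonZeroDivisors _)
    (TensorProduct.mk (MvPolynomial (Fin r) k) K (thetaCoker g M₁ j) 1)).1 h5
  -- The generic point yields only a nonzero `c` with `c • t` in the image; freeness at `P` improves
  -- it to a factor outside `P`.
  have := free_thetaCoker g h₁ (Localization.AtPrime P) l
    (IsLocalization.map_units (Localization.AtPrime P) (⟨_, hl⟩ : P.primeCompl)) j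
  refine exists_smul_mem_range_of_free P (Localization.AtPrime P) (c := c)
    (nonZeroDivisors.coe_ne_zero c) ?_
  rwa [← Submodule.Quotient.mk_eq_zero, Submodule.Quotient.mk_smul]

end Saturation

end BPBundles

end

noncomputable section

namespace BPBundles

open MvPolynomial (homogeneousSubmodule)

attribute [local instance] MvPolynomial.gradedAlgebra

/-! ### Homogeneous components -/

section Components

variable {k : Type u} [Field k] {r : ℕ}

/-- The homogeneous component of degree `e : ℤ` of a polynomial. -/
def polyComponent (e : ℤ) : MvPolynomial (Fin r) k →ₗ[k] MvPolynomial (Fin r) k :=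
  if 0 ≤ e then MvPolynomial.homogeneousComponent e.toNat else 0

theorem polyComponent_of_mem {m : ℕ} {a : MvPolynomial (Fin r) k}
    (ha : a ∈ homogeneousSubmodule (Fin r) k m) (e : ℤ) :
    polyComponent e a = if (m : ℤ) = e then a else 0 := by
  unfold polyComponent
  split_ifs with h1 h2 h2
  · subst h2
    rw [Int.toNat_natCast, MvPolynomial.homogeneousComponent_of_mem ha, if_pos rfl]
  · rw [MvPolynomial.homogeneousComponent_of_mem ha, if_neg (by omega)]
  · omega
  · rfl

theorem polyComponent_natCast (m : ℕ) (a : MvPolynomial (Fin r) k) :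
    polyComponent (m : ℤ) a = MvPolynomial.homogeneousComponent m a := by
  simp [polyComponent]

theorem polyComponent_natCast_mem (m : ℕ) (a : MvPolynomial (Fin r) k) :
    polyComponent (m : ℤ) a ∈ homogeneousSubmodule (Fin r) k m := by
  rw [polyComponent_natCast]
  exact MvPolynomial.homogeneousComponent_mem m a

theorem polyComponent_of_neg {e : ℤ} (he : e < 0) (a : MvPolynomial (Fin r) k) :
    polyComponent e a = 0 := by
  rw [polyComponent, if_neg (by omega), LinearMap.zero_apply]

theorem exists_polyComponent_notMem {I : Ideal (MvPolynomial (Fin r) k)}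
    {a : MvPolynomial (Fin r) k} (ha : a ∉ I) : ∃ m : ℕ, polyComponent (m : ℤ) a ∉ I := by
  by_contra! h
  refine ha ?_
  rw [← MvPolynomial.sum_homogeneousComponent a]
  exact sum_mem fun m _ => polyComponent_natCast m a ▸ h m

theorem polyComponent_mul_mem {d n : ℕ} {y : MvPolynomial (Fin r) k}
    (hy : y ∈ homogeneousSubmodule (Fin r) k d) (a : MvPolynomial (Fin r) k) :
    polyComponent ((n : ℤ) - d) a * y ∈ homogeneousSubmodule (Fin r) k n := by
  rcases le_or_gt d n with h | h
  · obtain ⟨m, rfl⟩ := Nat.exists_eq_add_of_le' h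
    rw [show ((m + d : ℕ) : ℤ) - d = m by push_cast; ring]
    exact SetLike.mul_mem_graded (polyComponent_natCast_mem m a) hy
  · rw [polyComponent_of_neg (by omega), zero_mul]
    exact zero_mem _

/-- Two `k`-linear maps that agree on homogeneous polynomials are equal. -/
theorem linearMap_eq_of_homogeneous {W : Type*} [AddCommGroup W] [Module k W]
    {φ ψ : MvPolynomial (Fin r) k →ₗ[k] W}
    (h : ∀ (m : ℕ), ∀ a ∈ homogeneousSubmodule (Fin r) k m, φ a = ψ a) : φ = ψ := by
  refine LinearMap.ext fun a => ?_
  refine (congrArg φ (MvPolynomial.sum_homogeneousComponent a).symm).trans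
    (Eq.trans ?_ (congrArg ψ (MvPolynomial.sum_homogeneousComponent a)))
  rw [map_sum, map_sum]
  exact Finset.sum_congr rfl fun m _ => h m _ (MvPolynomial.homogeneousComponent_mem m a)

theorem polyComponent_mul {m : ℕ} {b : MvPolynomial (Fin r) k}
    (hb : b ∈ homogeneousSubmodule (Fin r) k m) (e : ℤ) (a : MvPolynomial (Fin r) k) :
    polyComponent e (a * b) = polyComponent (e - m) a * b := by
  have h : polyComponent e ∘ₗ LinearMap.mulRight k b =
      LinearMap.mulRight k b ∘ₗ polyComponent (r := r) (k := k) (e - m) := by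
    refine linearMap_eq_of_homogeneous fun n a ha => ?_
    simp only [LinearMap.comp_apply, LinearMap.mulRight_apply]
    rw [polyComponent_of_mem (SetLike.mul_mem_graded ha hb), polyComponent_of_mem ha]
    split_ifs with h1 h2 h2
    · rfl
    · push_cast at h1; omega
    · push_cast at h1; omega
    · rw [zero_mul]
  exact LinearMap.congr_fun h a

variable (V : Type u) [AddCommGroup V] [Module k V]

/-- The homogeneous component of degree `e : ℤ` of an element of `A ⊗[k] V`. -/
def component (e : ℤ) : MvPolynomial (Fin r) k ⊗[k] V →ₗ[k] MvPolynomial (Fin r) k ⊗[k] V :=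
  (polyComponent e).rTensor V

variable {V}

theorem component_mem (e : ℤ) (t : MvPolynomial (Fin r) k ⊗[k] V) :
    component V e t ∈ piece (homogeneousSubmodule (Fin r) k) V e := by
  induction t using TensorProduct.induction_on with
  | zero => rw [map_zero]; exact zero_mem _
  | add x y hx hy => rw [map_add]; exact add_mem hx hy
  | tmul a v =>
    rw [component, LinearMap.rTensor_tmul]
    rcases lt_or_ge e 0 with h | h
    · rw [polyComponent_of_neg h, TensorProduct.zero_tmul]; exact zero_mem _
    · lift e to ℕ using h
      exact Submodule.subset_span ⟨e, _, v, rfl, polyComponent_natCast_mem e a, rfl⟩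

theorem component_smul {d : ℤ} {t : MvPolynomial (Fin r) k ⊗[k] V}
    (ht : t ∈ piece (homogeneousSubmodule (Fin r) k) V d) (e : ℤ) (a : MvPolynomial (Fin r) k) :
    component V e (a • t) = polyComponent (e - d) a • t := by
  unfold piece at ht
  induction ht using Submodule.span_induction with
  | mem x hx =>
    obtain ⟨n, b, v, rfl, hb, rfl⟩ := hx
    rw [TensorProduct.smul_tmul', TensorProduct.smul_tmul', component, LinearMap.rTensor_tmul,
      smul_eq_mul, smul_eq_mul, polyComponent_mul hb]
  | zero => simp
  | add x y _ _ hx hy => rw [smul_add, map_add, hx, hy, smul_add]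
  | smul c x _ hx => rw [smul_comm, map_smul, hx, smul_comm]

theorem mem_of_component_mem (W : Submodule (MvPolynomial (Fin r) k) (MvPolynomial (Fin r) k ⊗[k] V))
    {t : MvPolynomial (Fin r) k ⊗[k] V} (h : ∀ d : ℕ, component V (d : ℤ) t ∈ W) : t ∈ W := by
  -- Asking for the equality at all `n ≥ N` lets two tensors share the larger of their bounds.
  have hN : ∃ N : ℕ, ∀ n ≥ N, t = ∑ d ∈ Finset.range n, component V (d : ℤ) t := by
    clear h
    induction t using TensorProduct.induction_on with
    | zero => exact ⟨0, fun n _ => by simp⟩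
    | add x y hx hy =>
      obtain ⟨N, hN⟩ := hx
      obtain ⟨N', hN'⟩ := hy
      refine ⟨max N N', fun n hn => ?_⟩
      simp only [map_add, Finset.sum_add_distrib]
      rw [← hN n (le_trans (le_max_left _ _) hn), ← hN' n (le_trans (le_max_right _ _) hn)]
    | tmul a v =>
      refine ⟨a.totalDegree + 1, fun n hn => ?_⟩
      simp only [component, LinearMap.rTensor_tmul, polyComponent_natCast]
      rw [← TensorProduct.sum_tmul]
      congr 1
      rw [← Finset.sum_subset (Finset.range_mono hn), MvPolynomial.sum_homogeneousComponent]
      intro d _ hd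
      exact MvPolynomial.homogeneousComponent_eq_zero _ _ (by simpa using hd)
  obtain ⟨N, hN⟩ := hN
  rw [hN N le_rfl]
  exact sum_mem fun d _ => h d

theorem component_map {W : Type u} [AddCommGroup W] [Module k W]
    {φ : MvPolynomial (Fin r) k ⊗[k] V →ₗ[MvPolynomial (Fin r) k] MvPolynomial (Fin r) k ⊗[k] W}
    {c : ℤ} (hφ : IsHomogeneousMap (homogeneousSubmodule (Fin r) k) φ c) (e : ℤ)
    (t : MvPolynomial (Fin r) k ⊗[k] V) :
    component W (e + c) (φ t) = φ (component V e t) := by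
  induction t using TensorProduct.induction_on with
  | zero => simp
  | add x y hx hy => simp only [map_add, hx, hy]
  | tmul a v =>
    have h1 : (1 : MvPolynomial (Fin r) k) ⊗ₜ[k] v ∈ piece (homogeneousSubmodule (Fin r) k) V 0 :=
      Submodule.subset_span ⟨0, 1, v, rfl, SetLike.GradedOne.one_mem, rfl⟩
    have h2 : a ⊗ₜ[k] v = a • ((1 : MvPolynomial (Fin r) k) ⊗ₜ[k] v) := by
      rw [TensorProduct.smul_tmul', smul_eq_mul, mul_one]
    rw [h2, map_smul, component_smul h1, component_smul (hφ _ _ h1), map_smul,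
      add_sub_add_right_eq_sub]

end Components

/-! ### Homogeneous local bases -/

section LocalBasis

variable {p : ℕ} {k : Type u} [Field k] {r : ℕ} {E : Type v} [CommGroup E]
  [Module (ZMod p) (Additive E)] {g : Module.Basis (Fin r) (ZMod p) (Additive E)}
  {M : ModuleCat.{u} (MonoidAlgebra k E)}

attribute [local instance] ModuleCat.moduleOfAlgebraModule
  ModuleCat.isScalarTower_of_algebra_moduleCat

/-- Some homogeneous component of `b`, of degree `d` say, lies outside `P`; the component of degree
`d + e` of the given relation is the desired one. -/
theorem exists_homogeneous_smul_eq (P : Ideal (MvPolynomial (Fin r) k)) {j : ℕ} {e : ℕ}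
    {t : MvPolynomial (Fin r) k ⊗[k] M} (ht : t ∈ piece (homogeneousSubmodule (Fin r) k) M e)
    {b : MvPolynomial (Fin r) k} (hb : b ∉ P) (h : b • t ∈ LinearMap.range (thetaLin g M ^ j)) :
    ∃ (d : ℕ) (u : MvPolynomial (Fin r) k) (w : MvPolynomial (Fin r) k ⊗[k] M),
      u ∈ homogeneousSubmodule (Fin r) k d ∧ u ∉ P ∧
      w ∈ piece (homogeneousSubmodule (Fin r) k) M ((d + e : ℕ) - j) ∧
      u • t = (thetaLin g M ^ j) w := by
  obtain ⟨d, hd⟩ := exists_polyComponent_notMem hb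
  obtain ⟨y, hy⟩ := h
  refine ⟨d, _, component M ((d + e : ℕ) - j) y, polyComponent_natCast_mem d b, hd,
    component_mem _ _, ?_⟩
  rw [← component_map (isHomogeneousMap_thetaLin_pow g M j), hy, component_smul ht]
  congr 3
  push_cast
  ring

/-- `Ker θ ^ (j + 1)` is generated by homogeneous elements, so the basis can be chosen among them.
It is finitely generated, so one denominator `h` serves all `z`; this `h` will cut out the
neighbourhood. The condition on `c i * y` encodes that `c i` has degree `m + e - d i`, and that it
contributes nothing when this is negative. -/
theorem exists_homogeneous_local_basis (hM : constantJordanType (k := k) g M)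
    (P : Ideal (MvPolynomial (Fin r) k)) [P.IsPrime] {l : Fin r} (hl : MvPolynomial.X l ∉ P)
    (j : ℕ) :
    ∃ (κ : Type u) (_ : Fintype κ) (d : κ → ℕ) (w : κ → MvPolynomial (Fin r) k ⊗[k] M)
      (m : ℕ) (h : MvPolynomial (Fin r) k),
      h ∈ homogeneousSubmodule (Fin r) k m ∧ h ∉ P ∧
      (∀ i, w i ∈ piece (homogeneousSubmodule (Fin r) k) M (d i - j)) ∧
      (∀ i, (thetaLin g M ^ (j + 1)) (w i) = 0) ∧
      (∀ (c : κ → MvPolynomial (Fin r) k) (v : MvPolynomial (Fin r) k ⊗[k] M),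
        ∑ i, c i • (thetaLin g M ^ j) (w i) = (thetaLin g M ^ (j + 1)) v → c = 0) ∧
      ∀ (e : ℕ), ∀ z ∈ piece (homogeneousSubmodule (Fin r) k) M (e - j),
        (thetaLin g M ^ (j + 1)) z = 0 →
        ∃ (c : κ → MvPolynomial (Fin r) k) (v : MvPolynomial (Fin r) k ⊗[k] M),
          (∀ i, ∀ y ∈ homogeneousSubmodule (Fin r) k (d i),
            c i * y ∈ homogeneousSubmodule (Fin r) k (m + e)) ∧
          v ∈ piece (homogeneousSubmodule (Fin r) k) M ((m + e : ℕ) - (j + 1 : ℕ)) ∧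
          h • (thetaLin g M ^ j) z =
            ∑ i, c i • (thetaLin g M ^ j) (w i) + (thetaLin g M ^ (j + 1)) v := by
  classical
  have := finite_of_constantJordanType g l.pos hM
  let R := Localization.AtPrime P
  let θ := thetaLin g M
  have hfree : ∀ n : ℕ, Module.Free R (R ⊗[MvPolynomial (Fin r) k] thetaCoker g M n) := fun n =>
    free_thetaCoker g hM R l (IsLocalization.map_units R (⟨_, hl⟩ : P.primeCompl)) n
  let I := {w : ℕ × (MvPolynomial (Fin r) k ⊗[k] M) //
    w.2 ∈ piece (homogeneousSubmodule (Fin r) k) M w.1 ∧ (θ ^ (j + 1)) w.2 = 0}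
  obtain ⟨κ, hκ, a, ha1, ha2⟩ := exists_local_basis_of_free P R θ hfree j (I := I) (fun i => i.1.2) (fun i => i.2.2)
    (fun z hz => mem_of_component_mem _ fun d => Submodule.subset_span
      ⟨⟨(d, component M d z), component_mem _ _, by
        rw [← component_map (isHomogeneousMap_thetaLin_pow g M (j + 1)), hz, map_zero]⟩, rfl⟩)
  let w : κ → MvPolynomial (Fin r) k ⊗[k] M := fun i => (a i).1.2
  -- `d i` is the degree of `θ ^ j (w i)`, hence the shift by `j`.
  let d : κ → ℕ := fun i => (a i).1.1 + j
  have hw : ∀ i, w i ∈ piece (homogeneousSubmodule (Fin r) k) M (d i - j) := fun i => by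
    have := (a i).2.1
    simpa [d] using this
  let Q : Submodule (MvPolynomial (Fin r) k) (MvPolynomial (Fin r) k ⊗[k] M) :=
    Submodule.span _ (Set.range fun i => (θ ^ j) (w i)) ⊔ LinearMap.range (θ ^ (j + 1))
  have hQ : ∀ y, y ∈ Q ↔ ∃ (c : κ → MvPolynomial (Fin r) k) (v : _),
      y = ∑ i, c i • (θ ^ j) (w i) + (θ ^ (j + 1)) v := fun y => by
    rw [Submodule.mem_sup]
    constructor
    · rintro ⟨y, hy, _, ⟨v, rfl⟩, rfl⟩
      obtain ⟨c, rfl⟩ := (Submodule.mem_span_range_iff_exists_fun _).1 hy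
      exact ⟨c, v, rfl⟩
    · rintro ⟨c, v, rfl⟩
      exact ⟨_, (Submodule.mem_span_range_iff_exists_fun _).2 ⟨c, rfl⟩, _, ⟨v, rfl⟩, rfl⟩
  have hu : ∃ h : MvPolynomial (Fin r) k, h ∉ P ∧
      ∀ z, (θ ^ (j + 1)) z = 0 → h • (θ ^ j) z ∈ Q := by
    obtain ⟨S, hS⟩ := IsNoetherian.noetherian (LinearMap.ker (θ ^ (j + 1)))
    have h1 : ∀ z : S, ∃ h : MvPolynomial (Fin r) k, h ∉ P ∧ h • (θ ^ j) (z : _) ∈ Q := fun z => by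
      obtain ⟨h, hP, c, v, hcv⟩ := ha2 z (LinearMap.mem_ker.1 (hS ▸ Submodule.subset_span z.2))
      exact ⟨h, hP, (hQ _).2 ⟨c, v, hcv⟩⟩
    choose h hP hh using h1
    -- The product of the denominators of finitely many generators works for the whole kernel.
    refine ⟨∏ z, h z, fun H => ?_, fun z hz => ?_⟩
    · obtain ⟨z, -, hz⟩ := (Ideal.IsPrime.prod_mem_iff (p := P)).1 H
      exact hP z hz
    · rw [← LinearMap.mem_ker, ← hS] at hz
      induction hz using Submodule.span_induction with
      | mem z hz =>
        rw [← Finset.prod_erase_mul _ _ (Finset.mem_univ (⟨z, hz⟩ : S)), mul_smul]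
        exact Q.smul_mem _ (hh ⟨z, hz⟩)
      | zero => simp
      | add x y _ _ hx hy => rw [map_add, smul_add]; exact add_mem hx hy
      | smul c x _ hx => rw [map_smul, smul_comm]; exact Q.smul_mem _ hx
  obtain ⟨h, hP, hh⟩ := hu
  obtain ⟨m, hm⟩ := exists_polyComponent_notMem hP
  refine ⟨κ, hκ, d, w, m, _, polyComponent_natCast_mem m h, hm, hw, fun i => (a i).2.2, ha1,
    fun e z hz hz0 => ?_⟩
  obtain ⟨c, v, hcv⟩ := (hQ _).1 (hh z hz0)
  refine ⟨fun i => polyComponent ((m + e : ℕ) - d i) (c i), component M ((m + e : ℕ) - (j + 1 : ℕ)) v,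
    fun i y hy => polyComponent_mul_mem hy _, component_mem _ _, ?_⟩
  have hdeg : ∀ (b : ℕ) (z : MvPolynomial (Fin r) k ⊗[k] M),
      z ∈ piece (homogeneousSubmodule (Fin r) k) M (b - j) →
      (θ ^ j) z ∈ piece (homogeneousSubmodule (Fin r) k) M b := fun b z hz => by
    have := isHomogeneousMap_thetaLin_pow g M j _ _ hz
    rwa [sub_add_cancel] at this
  have h2 := congrArg (component M ((m + e : ℕ) : ℤ)) hcv
  rw [component_smul (hdeg e z hz), map_add, map_sum] at h2
  have h3 := component_map (isHomogeneousMap_thetaLin_pow g M (j + 1))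
    ((m + e : ℕ) - (j + 1 : ℕ)) v
  rw [sub_add_cancel] at h3
  rw [show ((m + e : ℕ) : ℤ) - e = m by push_cast; ring, h3] at h2
  rw [h2]
  congr 1
  exact Finset.sum_congr rfl fun i _ => component_smul (hdeg (d i) (w i) (hw i)) _ _

end LocalBasis

end BPBundles

end

noncomputable section

namespace BPBundles

/-! ### Sections of sheaves of modules -/

section Modules

open Scheme.Modules

variable {Y : Scheme.{u}}

theorem section_eq_zero_of_locally {N : Y.Modules} {U : Y.Opens} (s : Γ(N, U))
    (h : ∀ x ∈ U, ∃ (U' : Y.Opens) (i : U' ≤ U), x ∈ U' ∧ N.presheaf.map (homOfLE i).op s = 0) :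
    s = 0 := by
  choose U' i hx hs using h
  refine TopCat.Sheaf.eq_of_locally_eq' (⟨N.presheaf, N.isSheaf⟩ : TopCat.Sheaf Ab Y)
    (fun x : U => U' x x.2) U (fun x => homOfLE (i x x.2)) ?_ _ _ fun x => ?_
  · intro x hxU
    exact Opens.mem_iSup.2 ⟨⟨x, hxU⟩, hx x hxU⟩
  · exact (hs x x.2).trans (map_zero _).symm

theorem hom_app_map {N N' : Y.Modules} (φ : N ⟶ N') {U U' : Y.Opens} (i : U' ≤ U) (s : Γ(N, U)) :
    φ.app U' (N.presheaf.map (homOfLE i).op s) = N'.presheaf.map (homOfLE i).op (φ.app U s) :=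
  ConcreteCategory.congr_hom (φ.mapPresheaf.naturality (homOfLE i).op) s

/-- A morphism whose sections locally lift along `ψ` vanishes in the cokernel of `ψ`. -/
theorem comp_cokernel_π_eq_zero {Z N W : Y.Modules} (φ : Z ⟶ N) (ψ : W ⟶ N)
    (h : ∀ (U : Y.Opens) (z : Γ(Z, U)), ∀ x ∈ U, ∃ (U' : Y.Opens) (i : U' ≤ U), x ∈ U' ∧
      ∃ w : Γ(W, U'), ψ.app U' w = N.presheaf.map (homOfLE i).op (φ.app U z)) :
    φ ≫ Limits.cokernel.π ψ = 0 := by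
  refine Scheme.Modules.hom_ext _ _ fun U => ?_
  ext z
  refine section_eq_zero_of_locally _ fun x hx => ?_
  obtain ⟨U', i, hx', w, hw⟩ := h U z x hx
  refine ⟨U', i, hx', ?_⟩
  rw [Hom.comp_app, ConcreteCategory.comp_apply, ← hom_app_map, ← hw, ← ConcreteCategory.comp_apply,
    ← Hom.comp_app, Limits.cokernel.condition]
  rfl

theorem app_injective_of_mono {N N' : Y.Modules} (φ : N ⟶ N') [Mono φ] (U : Y.Opens) :
    Function.Injective (φ.app U) := by
  have : Mono ((toPresheaf Y).map φ) := inferInstance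
  have : Mono (((toPresheaf Y).map φ).app (op U)) := inferInstance
  exact (AddCommGrpCat.mono_iff_injective _).1 this

end Modules

/-! ### Sections of `V ⊗ 𝒪(n)` as fractions -/

section Twist

variable {k A : Type u} [Field k] [CommRing A] [Algebra k A]
variable {𝒜 : ℕ → Submodule k A} [GradedAlgebra 𝒜]
variable {V : Type u} [AddCommGroup V] [Module k V]

/-- The value of a section of `V ⊗ 𝒪(n)` at a point. -/
def twistVal {n : ℤ} {U : (Proj 𝒜).Opens} (s : Γ(twist 𝒜 V n, U)) (x : ProjectiveSpectrum.top 𝒜)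
    (hx : x ∈ U) : LocAt 𝒜 V x :=
  (show (twistInType 𝒜 V n).1.obj (op U) from s).1 ⟨x, hx⟩

theorem twistVal_ext {n : ℤ} {U : (Proj 𝒜).Opens} {s t : Γ(twist 𝒜 V n, U)}
    (h : ∀ x hx, twistVal s x hx = twistVal t x hx) : s = t :=
  Subtype.ext (funext fun x => h x.1 x.2)

theorem twistVal_add {n : ℤ} {U : (Proj 𝒜).Opens} (s t : Γ(twist 𝒜 V n, U))
    (x : ProjectiveSpectrum.top 𝒜) (hx : x ∈ U) :
    twistVal (s + t) x hx = twistVal s x hx + twistVal t x hx := rfl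

theorem twistVal_zero {n : ℤ} {U : (Proj 𝒜).Opens}
    (x : ProjectiveSpectrum.top 𝒜) (hx : x ∈ U) :
    twistVal (0 : Γ(twist 𝒜 V n, U)) x hx = 0 := rfl

theorem twistVal_smul {n : ℤ} {U : (Proj 𝒜).Opens} (a : Γ(Proj 𝒜, U)) (s : Γ(twist 𝒜 V n, U))
    (x : ProjectiveSpectrum.top 𝒜) (hx : x ∈ U) :
    twistVal (a • s) x hx =
      ((show (ProjectiveSpectrum.Proj.structureSheaf 𝒜).1.obj (op U) from a).1 ⟨x, hx⟩).val •
        twistVal s x hx := rfl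

theorem twistVal_twistMap {W : Type u} [AddCommGroup W] [Module k W]
    {φ : A ⊗[k] V →ₗ[A] A ⊗[k] W} {c : ℤ} (hφ : IsHomogeneousMap 𝒜 φ c) (n m : ℤ)
    (hm : m = n + c) {U : (Proj 𝒜).Opens} (s : Γ(twist 𝒜 V n, U))
    (x : ProjectiveSpectrum.top 𝒜) (hx : x ∈ U) :
    twistVal ((twistMap 𝒜 φ hφ n m hm).app U s) x hx =
      LocalizedModule.map x.asHomogeneousIdeal.toIdeal.primeCompl φ (twistVal s x hx) := rfl

theorem exists_twistVal_eq_mk {n : ℤ} {U : (Proj 𝒜).Opens} (s : Γ(twist 𝒜 V n, U))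
    {x : ProjectiveSpectrum.top 𝒜} (hx : x ∈ U) :
    ∃ (U' : (Proj 𝒜).Opens) (i : U' ≤ U), x ∈ U' ∧ ∃ (e : ℕ) (t : A ⊗[k] V) (a : A),
      t ∈ piece 𝒜 V (e + n) ∧ a ∈ 𝒜 e ∧
      ∀ y (hy : y ∈ U'), ∃ ha : a ∉ y.asHomogeneousIdeal.toIdeal,
        twistVal s y (i hy) = LocalizedModule.mk t ⟨a, ha⟩ := by
  obtain ⟨U', hx', i, e, t, a, ht, ha, h⟩ :=
    (show (twistInType 𝒜 V n).1.obj (op U) from s).2 ⟨x, hx⟩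
  exact ⟨U', i.le, hx', e, t, a, ht, ha, fun y hy => h ⟨y, hy⟩⟩

/-- The section `t / a` of `V ⊗ 𝒪(n)`. -/
def twistFrac {n : ℤ} {U : (Proj 𝒜).Opens} {e : ℕ} (t : A ⊗[k] V) (a : A)
    (ht : t ∈ piece 𝒜 V (e + n)) (ha : a ∈ 𝒜 e)
    (hU : ∀ y ∈ U, a ∉ (ProjectiveSpectrum.asHomogeneousIdeal (𝒜 := 𝒜) y).toIdeal) :
    Γ(twist 𝒜 V n, U) :=
  show (twistInType 𝒜 V n).1.obj (op U) from
    ⟨fun x => LocalizedModule.mk t ⟨a, hU x.1 x.2⟩, fun x => ⟨U, x.2, 𝟙 _, e, t, a, ht, ha,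
      fun y => ⟨hU y.1 y.2, rfl⟩⟩⟩

/-- The function `b / a` on an open subset. -/
def fracFun {U : (Proj 𝒜).Opens} {e : ℕ} (b a : A) (hb : b ∈ 𝒜 e) (ha : a ∈ 𝒜 e)
    (hU : ∀ y ∈ U, a ∉ (ProjectiveSpectrum.asHomogeneousIdeal (𝒜 := 𝒜) y).toIdeal) :
    Γ(Proj 𝒜, U) :=
  show (ProjectiveSpectrum.Proj.structureSheaf 𝒜).1.obj (op U) from
    ⟨fun x => HomogeneousLocalization.mk ⟨e, ⟨b, hb⟩, ⟨a, ha⟩, hU x.1 x.2⟩, fun x =>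
      ⟨U, x.2, 𝟙 _, e, ⟨b, hb⟩, ⟨a, ha⟩, fun y => hU y.1 y.2, fun _ => rfl⟩⟩

theorem twistVal_fracFun_smul {n : ℤ} {U : (Proj 𝒜).Opens} {e : ℕ} (b a : A) (hb : b ∈ 𝒜 e)
    (ha : a ∈ 𝒜 e)
    (hU : ∀ y ∈ U, a ∉ (ProjectiveSpectrum.asHomogeneousIdeal (𝒜 := 𝒜) y).toIdeal)
    (s : Γ(twist 𝒜 V n, U)) (x : ProjectiveSpectrum.top 𝒜) (hx : x ∈ U) :
    twistVal (fracFun b a hb ha hU • s) x hx =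
      Localization.mk b (⟨a, hU x hx⟩ : x.asHomogeneousIdeal.toIdeal.primeCompl) •
        twistVal s x hx := by
  rw [twistVal_smul]
  congr 1

theorem fun_eq_zero_of_val {U : (Proj 𝒜).Opens} (a : Γ(Proj 𝒜, U))
    (h : ∀ x (hx : x ∈ U),
      ((show (ProjectiveSpectrum.Proj.structureSheaf 𝒜).1.obj (op U) from a).1 ⟨x, hx⟩).val = 0) :
    a = 0 :=
  Subtype.ext (funext fun x => HomogeneousLocalization.val_injective _ (by
    rw [h x.1 x.2]; exact HomogeneousLocalization.val_zero.symm))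

/-- The basic open subset `D(a)`. -/
def dOpen (a : A) : (Proj 𝒜).Opens := ProjectiveSpectrum.basicOpen 𝒜 a

/-- Lifting sections of `V ⊗ 𝒪(m)` locally along a homogeneous map of degree `j`. -/
theorem exists_twistMap_app_eq {W : Type u} [AddCommGroup W] [Module k W] {j : ℕ}
    {φ : A ⊗[k] V →ₗ[A] A ⊗[k] V} (hφ : IsHomogeneousMap 𝒜 φ j)
    {F : A ⊗[k] V →ₗ[A] A ⊗[k] W} (hF : IsHomogeneousMap 𝒜 F 0)
    {ψ : A ⊗[k] W →ₗ[A] A ⊗[k] W} (hψ : IsHomogeneousMap 𝒜 ψ j)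
    {n : ℤ} {m : ℕ} (h : (m : ℤ) = n + j)
    {U : (Proj 𝒜).Opens} (z : Γ(twist 𝒜 V m, U)) (w : Γ(twist 𝒜 W n, U))
    (hzw : (twistMap 𝒜 F hF m m (add_zero _).symm).app U z = (twistMap 𝒜 ψ hψ n m h).app U w)
    (x : ProjectiveSpectrum.top 𝒜) (hx : x ∈ U)
    (H : ∀ (e : ℕ) (t : A ⊗[k] V) (c : A), t ∈ piece 𝒜 V e →
      c ∉ x.asHomogeneousIdeal.toIdeal → F (c • t) ∈ LinearMap.range ψ →
      ∃ (d : ℕ) (u : A) (w : A ⊗[k] V), u ∈ 𝒜 d ∧ u ∉ x.asHomogeneousIdeal.toIdeal ∧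
        w ∈ piece 𝒜 V ((d + e : ℕ) - j) ∧ u • t = φ w) :
    ∃ (U' : (Proj 𝒜).Opens) (i : U' ≤ U), x ∈ U' ∧ ∃ w' : Γ(twist 𝒜 V n, U'),
      (twistMap 𝒜 φ hφ n m h).app U' w' =
        (twist 𝒜 V m).presheaf.map (homOfLE i).op z := by
  obtain ⟨U₁, i₁, hx₁, e, t, a, ht, ha, hta⟩ := exists_twistVal_eq_mk z hx
  obtain ⟨U₂, i₂, hx₂, e', t', b, ht', hb, htb⟩ := exists_twistVal_eq_mk w hx
  have hv := congrArg (fun s' => twistVal s' x hx) hzw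
  simp only [twistVal_twistMap] at hv
  obtain ⟨hax, hax'⟩ := hta x hx₁
  obtain ⟨hbx, hbx'⟩ := htb x hx₂
  rw [hax', hbx', LocalizedModule.map_mk, LocalizedModule.map_mk, LocalizedModule.mk_eq] at hv
  -- Equality of the two fractions at the single point `x` reads `c b F(t) = c a ψ(t')`, so `F`
  -- sends `(c b) t` into the range of `ψ`.
  obtain ⟨c, hc⟩ := hv
  have hcb : (c : A) * b ∉ x.asHomogeneousIdeal.toIdeal :=
    x.asHomogeneousIdeal.toIdeal.primeCompl.mul_mem c.2 hbx
  obtain ⟨d, u, t₁, hu, hux, ht₁, hut⟩ := H (e + m) t (c * b) (by exact_mod_cast ht) hcb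
    ⟨(c : A) • a • t', by
      rw [map_smul, map_smul, map_smul, mul_smul]; exact hc.symm⟩
  -- Where `u` is invertible, `t / a = u t / (u a) = φ(t₁) / (u a)`.
  let U' : (Proj 𝒜).Opens := U₁ ⊓ dOpen u
  refine ⟨U', inf_le_left.trans i₁, ⟨hx₁, hux⟩, twistFrac (e := d + e) t₁ (u * a)
    (by
      have he : ((d + e : ℕ) : ℤ) + n = (d + (e + m) : ℕ) - j := by push_cast; linarith
      rwa [he])
    (SetLike.mul_mem_graded hu ha)
    (fun (y : ProjectiveSpectrum.top 𝒜) hy =>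
      y.asHomogeneousIdeal.toIdeal.primeCompl.mul_mem hy.2 (hta y hy.1).1), ?_⟩
  refine twistVal_ext fun y hy => ?_
  obtain ⟨hay, hay'⟩ := hta y hy.1
  refine (LocalizedModule.map_mk ..).trans (Eq.trans ?_ hay'.symm)
  rw [← hut, LocalizedModule.mk_eq]
  exact ⟨1, by simp only [one_smul, Submonoid.smul_def, smul_smul, mul_comm]⟩


end Twist

end BPBundles

end

/-! ### Linear splittings and saturation on projective space -/

noncomputable section

namespace BPBundles

open Scheme.Modules

open MvPolynomial (homogeneousSubmodule)

attribute [local instance] MvPolynomial.gradedAlgebra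
attribute [local instance] ModuleCat.moduleOfAlgebraModule
  ModuleCat.isScalarTower_of_algebra_moduleCat

variable {p : ℕ} {k : Type u} [Field k] {r : ℕ} {E : Type v} [CommGroup E]
  [Module (ZMod p) (Additive E)] {g : Module.Basis (Fin r) (ZMod p) (Additive E)}

/-- Otherwise the prime would contain every polynomial without constant term, that is, the
irrelevant ideal. -/
theorem exists_X_notMem (x : ProjectiveSpectrum.top (homogeneousSubmodule (Fin r) k)) :
    ∃ l, (MvPolynomial.X l : MvPolynomial (Fin r) k) ∉ x.asHomogeneousIdeal.toIdeal := by
  by_contra! h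
  refine x.not_irrelevant_le fun q hq => ?_
  have key : ∀ q : MvPolynomial (Fin r) k,
      q - MvPolynomial.C (MvPolynomial.constantCoeff q) ∈ x.asHomogeneousIdeal.toIdeal := by
    intro q
    induction q using MvPolynomial.induction_on with
    | C a => simp
    | add q q' h1 h2 =>
      have := add_mem h1 h2
      rwa [sub_add_sub_comm, ← map_add, ← map_add] at this
    | mul_X q l _ => simpa using Ideal.mul_mem_left _ q (h l)
  have h0 : MvPolynomial.constantCoeff q = 0 := by
    rw [HomogeneousIdeal.mem_irrelevant_iff, GradedRing.proj_apply] at hq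
    have h2 := congrArg MvPolynomial.constantCoeff
      ((MvPolynomial.decomposition.decompose'_apply q 0).symm.trans hq)
    simpa [MvPolynomial.constantCoeff_eq, MvPolynomial.coeff_homogeneousComponent] using h2
  simpa [h0] using key q

section Linear

variable {V W : Type u} [AddCommGroup V] [Module k V] [AddCommGroup W] [Module k W]

variable (r) in
/-- The map `V ⊗ 𝒪(n) ⟶ W ⊗ 𝒪(n)` induced by a `k`-linear map. -/
def twLin (f : V →ₗ[k] W) (n : ℤ) :
    twist (homogeneousSubmodule (Fin r) k) V n ⟶ twist (homogeneousSubmodule (Fin r) k) W n :=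
  twistMap (homogeneousSubmodule (Fin r) k) _ (isHomogeneousMap_baseChange f) n n (add_zero n).symm

theorem twLin_id (n : ℤ) : twLin r (LinearMap.id : V →ₗ[k] V) n = 𝟙 _ :=
  twistMap_id _ _ (LinearMap.baseChange_id) n _

theorem twLin_comp {V' : Type u} [AddCommGroup V'] [Module k V'] (f : V →ₗ[k] W)
    (f' : W →ₗ[k] V') (n : ℤ) : twLin r f n ≫ twLin r f' n = twLin r (f' ∘ₗ f) n :=
  twistMap_comp _ _ _ _ (LinearMap.baseChange_comp f f').symm _ _ _

theorem twLin_add (f f' : V →ₗ[k] W) (n : ℤ) :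
    twLin r (f + f') n = twLin r f n + twLin r f' n := by
  refine Scheme.Modules.hom_ext _ _ fun U => ?_
  ext s
  refine twistVal_ext fun x hx => ?_
  rw [Hom.add_app, AddCommGrpCat.hom_add_apply, twistVal_add]
  unfold twLin
  rw [twistVal_twistMap, twistVal_twistMap, twistVal_twistMap, LinearMap.baseChange_add]
  rw [map_add, LinearMap.add_apply]

end Linear

theorem twHom_add {M N : ModuleCat.{u} (MonoidAlgebra k E)} (f f' : M ⟶ N) (n : ℤ) :
    twHom r (f + f') n = twHom r f n + twHom r f' n :=
  twLin_add (lin f) (lin f') n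

/-- A section of vector spaces suffices, so `ρ` and `σ` need not commute with θ. -/
theorem LocallySplitExact.exists_splitting {M₁ M₂ M₃ : ModuleCat.{u} (MonoidAlgebra k E)}
    {f : M₁ ⟶ M₂} {h : M₂ ⟶ M₃} (H : LocallySplitExact g f h) (n : ℤ) :
    ∃ (ρ : tw r M₂ n ⟶ tw r M₁ n) (σ : tw r M₃ n ⟶ tw r M₂ n),
      twHom r f n ≫ ρ = 𝟙 _ ∧ σ ≫ twHom r h n = 𝟙 _ ∧
        ρ ≫ twHom r f n + twHom r h n ≫ σ = 𝟙 _ := by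
  obtain ⟨s, hs⟩ := (lin h).exists_rightInverse_of_surjective
    (LinearMap.range_eq_top.2 H.surjective)
  have hs' : ∀ x, lin h (s x) = x := fun x => LinearMap.congr_fun hs x
  have hf : Function.Injective (lin f) := H.injective
  have hmem : ∀ x, x - s (lin h x) ∈ LinearMap.range (lin f) := fun x =>
    (H.exact_lin _).1 (by rw [map_sub, hs', sub_self])
  let e := LinearEquiv.ofInjective (lin f) hf
  let ρ : M₂ →ₗ[k] M₁ := e.symm.toLinearMap ∘ₗ
    LinearMap.codRestrict (LinearMap.range (lin f)) (LinearMap.id - s ∘ₗ lin h) hmem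
  have hρ : ∀ x, lin f (ρ x) = x - s (lin h x) := fun x =>
    congrArg Subtype.val (e.apply_symm_apply ⟨_, hmem x⟩)
  refine ⟨twLin r ρ n, twLin r s n, ?_, ?_, ?_⟩
  · have h1 : ρ ∘ₗ lin f = LinearMap.id := by
      ext x
      apply hf
      rw [LinearMap.comp_apply, hρ, (H.exact_lin _).2 ⟨x, rfl⟩, map_zero, sub_zero]
      rfl
    exact (twLin_comp _ _ _).trans ((congrArg (twLin r · n) h1).trans (twLin_id n))
  · exact (twLin_comp _ _ _).trans ((congrArg (twLin r · n) hs).trans (twLin_id n))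
  · have h1 : lin f ∘ₗ ρ + s ∘ₗ lin h = LinearMap.id := by
      ext x
      rw [LinearMap.add_apply, LinearMap.comp_apply, hρ]
      exact sub_add_cancel _ _
    refine Eq.trans ?_ ((congrArg (twLin r · n) h1).trans (twLin_id n))
    exact (congrArg₂ (· + ·) (twLin_comp _ _ _) (twLin_comp _ _ _)).trans (twLin_add _ _ _).symm

variable (g) in
/-- The iterate `θ_M ^ j : M ⊗ 𝒪(n) ⟶ M ⊗ 𝒪(n + j)`. -/
def thetaIter (M : ModuleCat.{u} (MonoidAlgebra k E)) (j : ℕ) (n m : ℤ) (h : m = n + j) :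
    tw r M n ⟶ tw r M m :=
  twistMap (homogeneousSubmodule (Fin r) k) _ (isHomogeneousMap_thetaLin_pow g M j) n m h

theorem thetaIter_comp_theta (M : ModuleCat.{u} (MonoidAlgebra k E)) (j : ℕ) (n m l : ℤ)
    (h : m = n + j) (h' : l = m + 1) :
    thetaIter g M j n m h ≫ theta g M m l h' =
      thetaIter g M (j + 1) n l (by rw [h', h, Nat.cast_succ, add_assoc]) :=
  twistMap_comp _ _ _ _ (pow_succ' _ _).symm _ _ _

theorem twHom_thetaIter {M N : ModuleCat.{u} (MonoidAlgebra k E)} (f : M ⟶ N) (j : ℕ) (n m : ℤ)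
    (h : m = n + j) :
    twHom r f n ≫ thetaIter g N j n m h = thetaIter g M j n m h ≫ twHom r f m := by
  have hc : IsHomogeneousMap (homogeneousSubmodule (Fin r) k)
      ((thetaLin g N ^ j) ∘ₗ (lin f).baseChange (MvPolynomial (Fin r) k)) j := fun d t ht =>
    isHomogeneousMap_thetaLin_pow g N j d _ (baseChange_mem_piece _ ht)
  exact (twistMap_comp _ _ _ hc rfl _ _ h).trans
    (twistMap_comp _ _ _ hc (thetaLin_pow_comp_baseChange g f j) _ _ h).symm

theorem exists_homogeneous_lift {M₁ M₂ M₃ : ModuleCat.{u} (MonoidAlgebra k E)} {f : M₁ ⟶ M₂}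
    {h : M₂ ⟶ M₃} (H : LocallySplitExact g f h) (h₁ : constantJordanType g M₁)
    (h₂ : constantJordanType g M₂) (h₃ : constantJordanType g M₃)
    (x : ProjectiveSpectrum.top (homogeneousSubmodule (Fin r) k)) (j e : ℕ)
    (t : MvPolynomial (Fin r) k ⊗[k] M₁) (c : MvPolynomial (Fin r) k)
    (ht : t ∈ piece (homogeneousSubmodule (Fin r) k) M₁ e)
    (hc : c ∉ x.asHomogeneousIdeal.toIdeal)
    (hct : (lin f).baseChange (MvPolynomial (Fin r) k) (c • t) ∈
      LinearMap.range (thetaLin g M₂ ^ j)) :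
    ∃ (d : ℕ) (u : MvPolynomial (Fin r) k) (w : MvPolynomial (Fin r) k ⊗[k] M₁),
      u ∈ homogeneousSubmodule (Fin r) k d ∧ u ∉ x.asHomogeneousIdeal.toIdeal ∧
        w ∈ piece (homogeneousSubmodule (Fin r) k) M₁ ((d + e : ℕ) - j) ∧
        u • t = (thetaLin g M₁ ^ j) w := by
  obtain ⟨l, hl⟩ := exists_X_notMem x
  obtain ⟨q, hq, hq'⟩ := H.exists_smul_mem_range h₁ h₂ h₃ _ hl hct
  rw [smul_smul] at hq'
  exact exists_homogeneous_smul_eq _ ht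
    (x.asHomogeneousIdeal.toIdeal.primeCompl.mul_mem hq hc) hq'

/-- Saturation for sheaves. Vanishing in the cokernel is the form that gives a preimage under `θ ^
j` after an epimorphic refinement. -/
theorem LocallySplitExact.comp_cokernel_π_thetaIter
    {M₁ M₂ M₃ : ModuleCat.{u} (MonoidAlgebra k E)} {f : M₁ ⟶ M₂} {h : M₂ ⟶ M₃}
    (H : LocallySplitExact g f h) (h₁ : constantJordanType g M₁) (h₂ : constantJordanType g M₂)
    (h₃ : constantJordanType g M₃) (j : ℕ) {n : ℤ} {m : ℕ} (hm : (m : ℤ) = n + j)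
    {A : (ProjSpace k r).Modules} (z : A ⟶ tw r M₁ m)
    (w : A ⟶ tw r M₂ n) (hzw : z ≫ twHom r f m = w ≫ thetaIter g M₂ j n m hm) :
    z ≫ Limits.cokernel.π (thetaIter g M₁ j n m hm) = 0 :=
  comp_cokernel_π_eq_zero _ _ fun U s x hx =>
    exists_twistMap_app_eq (isHomogeneousMap_thetaLin_pow g M₁ j)
      (isHomogeneousMap_baseChange (lin f)) (isHomogeneousMap_thetaLin_pow g M₂ j) hm (z.app U s)
      (w.app U s) congr($(hzw).app U s) x hx
      fun e t c => exists_homogeneous_lift H h₁ h₂ h₃ x j e t c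

end BPBundles

end

noncomputable section

namespace BPBundles

/-! ### Diagram chases in abelian categories -/

section Abelian

variable {C : Type*} [Category C] [Abelian C]

/-- One direction pulls back the epimorphism onto the image; the other lifts the epimorphism `π`,
which is strong, against the inclusion of the image. -/
theorem imageSubobject_factors_iff {S T A : C} (φ : S ⟶ T) (x : A ⟶ T) :
    (Limits.imageSubobject φ).Factors x ↔
      ∃ (A' : C) (π : A' ⟶ A) (_ : Epi π) (y : A' ⟶ S), π ≫ x = y ≫ φ := by
  constructor
  · intro h
    obtain ⟨A', π, hπ, y, hy⟩ := surjective_up_to_refinements_of_epi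
      (Limits.factorThruImageSubobject φ) ((Limits.imageSubobject φ).factorThru x h)
    refine ⟨A', π, hπ, y, ?_⟩
    have := congrArg (· ≫ (Limits.imageSubobject φ).arrow) hy
    simpa using this
  · rintro ⟨A', π, hπ, y, hy⟩
    have sq : CommSq (y ≫ Limits.factorThruImageSubobject φ) π (Limits.imageSubobject φ).arrow x :=
      ⟨by simp [hy]⟩
    have : StrongEpi π := strongEpi_of_epi π
    exact (Subobject.factors_iff _ _).2 ⟨sq.lift, sq.fac_right⟩

theorem exists_refinement_of_comp_cokernel_π {S T A : C} (φ : S ⟶ T) (x : A ⟶ T)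
    (hx : x ≫ Limits.cokernel.π φ = 0) :
    ∃ (A' : C) (π : A' ⟶ A) (_ : Epi π) (y : A' ⟶ S), π ≫ x = y ≫ φ :=
  (Limits.CokernelCofork.IsColimit.comp_π_eq_zero_iff_up_to_refinements
    (Limits.cokernelIsCokernel φ) x).1 hx

/-- Passage to cokernels in a short exact sequence of monomorphisms. -/
theorem shortExact_cokernel {S T : ShortComplex C} (hS : S.ShortExact) (hT : T.ShortExact)
    (φ : S ⟶ T) (h₃ : Mono φ.τ₃)
    (w : Limits.cokernel.map φ.τ₁ φ.τ₂ S.f T.f φ.comm₁₂ ≫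
      Limits.cokernel.map φ.τ₂ φ.τ₃ S.g T.g φ.comm₂₃ = 0) :
    (ShortComplex.mk _ _ w).ShortExact := by
  have := hS.mono_f
  have := hT.mono_f
  have := hS.epi_g
  have := hT.epi_g
  refine ShortComplex.ShortExact.mk' ?_ ?_ ?_
  · rw [ShortComplex.exact_iff_exact_up_to_refinements]
    intro A x hx
    obtain ⟨A₁, π₁, hπ₁, a, ha⟩ :=
      surjective_up_to_refinements_of_epi (Limits.cokernel.π φ.τ₂) x
    have h0 : (a ≫ T.g) ≫ Limits.cokernel.π φ.τ₃ = 0 := by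
      have := congrArg (π₁ ≫ ·) hx
      dsimp only at this
      rw [← Category.assoc, ha] at this
      simpa using this
    obtain ⟨A₂, π₂, hπ₂, b, hb⟩ := exists_refinement_of_comp_cokernel_π _ _ h0
    obtain ⟨A₃, π₃, hπ₃, c, hc⟩ := surjective_up_to_refinements_of_epi S.g b
    -- The image of `a` in the third term of `T` comes from `b`, which lifts to `c`; correcting `a`
    -- by the image of `c` moves it into the first term.
    have hd : (π₃ ≫ π₂ ≫ a - c ≫ φ.τ₂) ≫ T.g = 0 := by
      rw [Preadditive.sub_comp, Category.assoc, Category.assoc, Category.assoc, hb, φ.comm₂₃,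
        reassoc_of% hc, sub_self]
    refine ⟨A₃, π₃ ≫ π₂ ≫ π₁, inferInstance, hT.exact.lift _ hd ≫ Limits.cokernel.π φ.τ₁, ?_⟩
    simp only [Category.assoc, ha, Limits.cokernel.π_desc]
    rw [hT.exact.lift_f_assoc]
    simp
  · refine Preadditive.mono_of_cancel_zero _ fun {A} x hx => ?_
    obtain ⟨A₁, π₁, hπ₁, a, ha⟩ :=
      surjective_up_to_refinements_of_epi (Limits.cokernel.π φ.τ₁) x
    have h0 : (a ≫ T.f) ≫ Limits.cokernel.π φ.τ₂ = 0 := by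
      have := congrArg (π₁ ≫ ·) hx
      dsimp only at this
      rw [← Category.assoc, ha] at this
      simpa using this
    obtain ⟨A₂, π₂, hπ₂, b, hb⟩ := exists_refinement_of_comp_cokernel_π _ _ h0
    -- Injectivity of the third vertical map places `b` in the first term of `S`.
    have hb0 : b ≫ S.g = 0 := by
      rw [← cancel_mono φ.τ₃, Category.assoc, ← φ.comm₂₃, ← reassoc_of% hb, T.zero]
      simp
    have hc : π₂ ≫ a = hS.exact.lift b hb0 ≫ φ.τ₁ := by
      rw [← cancel_mono T.f, Category.assoc, Category.assoc, hb, φ.comm₁₂,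
        hS.exact.lift_f_assoc]
    rw [← cancel_epi π₁, ← cancel_epi π₂, ha, reassoc_of% hc]
    simp
  · have : Epi (Limits.cokernel.π φ.τ₂ ≫
        Limits.cokernel.map φ.τ₂ φ.τ₃ S.g T.g φ.comm₂₃) := by
      rw [Limits.cokernel.π_desc]
      infer_instance
    exact epi_of_epi (Limits.cokernel.π φ.τ₂) _

end Abelian

end BPBundles

end

/-! ### Exactness of `Ker θ ∩ Im θ ^ j` and of `ℱ_i` -/

noncomputable section

namespace BPBundles

open Scheme.Modules

variable {p : ℕ} {k : Type u} [Field k] {r : ℕ} {E : Type v} [CommGroup E]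
  [Module (ZMod p) (Additive E)] {g : Module.Basis (Fin r) (ZMod p) (Additive E)}
  {M M₁ M₂ M₃ : ModuleCat.{u} (MonoidAlgebra k E)}

theorem kerIm_factors_iff {j : ℕ} {A : (ProjSpace k r).Modules} (x : A ⟶ tw r M 0) :
    (kerIm g M j).Factors x ↔ x ≫ theta g M 0 1 (zero_add 1).symm = 0 ∧
      ∃ (A' : (ProjSpace k r).Modules) (π : A' ⟶ A) (_ : Epi π) (y : A' ⟶ tw r M (-j)),
        π ≫ x = y ≫ thetaPow g M j := by
  rw [kerIm, Subobject.inf_factors, Limits.kernelSubobject_factors_iff,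
    imageSubobject_factors_iff]

theorem kerImMap_arrow {M N : ModuleCat.{u} (MonoidAlgebra k E)} (f : M ⟶ N) (j : ℕ) :
    kerImMap g f j ≫ (kerIm g N j).arrow = (kerIm g M j).arrow ≫ twHom r f 0 :=
  Subobject.factorThru_arrow _ _ _

theorem LocallySplitExact.mono_twHom {f : M₁ ⟶ M₂} {h : M₂ ⟶ M₃}
    (H : LocallySplitExact g f h) (n : ℤ) : Mono (twHom r f n) := by
  obtain ⟨ρ, σ, h1, -, -⟩ := H.exists_splitting n
  exact mono_of_mono_fac h1

theorem LocallySplitExact.exists_comp_twHom_eq {f : M₁ ⟶ M₂} {h : M₂ ⟶ M₃}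
    (H : LocallySplitExact g f h) {n : ℤ} {A : (ProjSpace k r).Modules} (x : A ⟶ tw r M₂ n)
    (hx : x ≫ twHom r h n = 0) : ∃ z, z ≫ twHom r f n = x := by
  obtain ⟨ρ, σ, -, -, h3⟩ := H.exists_splitting n
  refine ⟨x ≫ ρ, ?_⟩
  have := congrArg (x ≫ ·) h3
  simpa [reassoc_of% hx] using this

theorem LocallySplitExact.comp_eq_zero {f : M₁ ⟶ M₂} {h : M₂ ⟶ M₃}
    (H : LocallySplitExact g f h) : f ≫ h = 0 := by
  ext x
  exact H.exact.apply_apply_eq_zero x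

theorem twHom_zero (n : ℤ) : twHom r (0 : M ⟶ M₁) n = 0 := by
  have := twHom_add (r := r) (0 : M ⟶ M₁) 0 n
  rwa [add_zero, left_eq_add] at this

theorem kerImMap_add (f f' : M ⟶ M₁) (j : ℕ) :
    kerImMap g (f + f') j = kerImMap g f j + kerImMap g f' j := by
  rw [← cancel_mono (kerIm g M₁ j).arrow, Preadditive.add_comp, kerImMap_arrow, kerImMap_arrow,
    kerImMap_arrow, twHom_add, Preadditive.comp_add]

instance (i : ℕ) : (sheafF (k := k) g i).Additive where
  map_add {M N f f'} := by
    refine (cancel_epi (Limits.cokernel.π (kerImIncl g M i))).1 ?_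
    refine Eq.trans ?_ (Preadditive.comp_add ..).symm
    simp [sheafF, kerImMap_add]
    rfl

instance (i : ℕ) : (jordanF k g i).Additive := by
  unfold jordanF
  infer_instance

theorem kerImMap_comp_eq_zero {f : M₁ ⟶ M₂} {h : M₂ ⟶ M₃}
    (H : LocallySplitExact g f h) (j : ℕ) : kerImMap g f j ≫ kerImMap g h j = 0 := by
  rw [← cancel_mono (kerIm g M₃ j).arrow, Category.assoc, kerImMap_arrow, ← Category.assoc,
    kerImMap_arrow, Category.assoc, ← twHom_comp, H.comp_eq_zero, twHom_zero]
  simp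

/-- The kernel condition descends because `M₁ ⊗ 𝒪(1)` embeds in `M₂ ⊗ 𝒪(1)`; the image condition is
saturation. -/
theorem LocallySplitExact.factors_of_comp {f : M₁ ⟶ M₂} {h : M₂ ⟶ M₃}
    (H : LocallySplitExact g f h) (h₁ : constantJordanType g M₁) (h₂ : constantJordanType g M₂)
    (h₃ : constantJordanType g M₃) {j : ℕ} {A : (ProjSpace k r).Modules} (z : A ⟶ tw r M₁ 0)
    (hz : (kerIm g M₂ j).Factors (z ≫ twHom r f 0)) : (kerIm g M₁ j).Factors z := by
  obtain ⟨hθ, A', π, hπ, y, hy⟩ := (kerIm_factors_iff _).1 hz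
  refine (kerIm_factors_iff _).2 ⟨?_, ?_⟩
  · have := H.mono_twHom (r := r) 1
    rw [← cancel_mono (twHom r f 1), Category.assoc, ← twHom_theta, ← Category.assoc, hθ,
      Limits.zero_comp]
  · obtain ⟨A'', π', hπ', y', hy'⟩ := exists_refinement_of_comp_cokernel_π _ _
      (H.comp_cokernel_π_thetaIter h₁ h₂ h₃ j (m := 0) (n := -j) (by simp) (π ≫ z) y
        ((Category.assoc _ _ _).trans hy))
    exact ⟨A'', π' ≫ π, inferInstance, y', (Category.assoc _ _ _).trans hy'⟩

theorem twHom_comp_assoc (f : M₁ ⟶ M₂) (f' : M₂ ⟶ M₃) (n : ℤ) {Z : (ProjSpace k r).Modules}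
    (q : tw r M₃ n ⟶ Z) : twHom r (f ≫ f') n ≫ q = twHom r f n ≫ twHom r f' n ≫ q := by
  rw [twHom_comp, Category.assoc]

/-- Write the given element as `θ ^ j w` and lift `w` to `σ w`. The lift may fail to lie in `Ker θ ^
(j + 1)`, and saturation for the exponent `j + 1` supplies a correction from `M₁`. -/
theorem LocallySplitExact.exists_comp_kerImMap_eq {f : M₁ ⟶ M₂} {h : M₂ ⟶ M₃}
    (H : LocallySplitExact g f h) (h₁ : constantJordanType g M₁) (h₂ : constantJordanType g M₂)
    (h₃ : constantJordanType g M₃) (j : ℕ) {A : (ProjSpace k r).Modules}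
    (x : A ⟶ (kerIm g M₃ j : (ProjSpace k r).Modules)) :
    ∃ (A' : (ProjSpace k r).Modules) (π : A' ⟶ A) (_ : Epi π)
      (y : A' ⟶ (kerIm g M₂ j : (ProjSpace k r).Modules)), π ≫ x = y ≫ kerImMap g h j := by
  obtain ⟨hθ, A₁, π₁, hπ₁, w, hw⟩ := (kerIm_factors_iff (x ≫ (kerIm g M₃ j).arrow)).1
    (Subobject.factors_comp_arrow _)
  obtain ⟨ρ, σ, -, hσ, -⟩ := H.exists_splitting (r := r) (-j)
  have e : (1 : ℤ) = -j + (j + 1 : ℕ) := by push_cast; ring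
  have hw' (N : ModuleCat.{u} (MonoidAlgebra k E)) : thetaPow g N j ≫
      theta g N 0 1 (zero_add 1).symm = thetaIter g N (j + 1) (-j) 1 e :=
    thetaIter_comp_theta N j (-j) 0 1 (by ring) (by ring)
  have hwθ : w ≫ thetaIter g M₃ (j + 1) (-j) 1 e = 0 := by
    rw [← hw', ← Category.assoc, ← hw, Category.assoc, hθ, Limits.comp_zero]
  -- `θ ^ (j + 1)` of the lift dies in `M₃`, so it comes from some `z` in `M₁`, and locally `z = θ ^
  -- (j + 1) v`.
  obtain ⟨z, hz⟩ := H.exists_comp_twHom_eq ((w ≫ σ) ≫ thetaIter g M₂ (j + 1) (-j) 1 e) (by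
    rw [Category.assoc, ← twHom_thetaIter, Category.assoc, reassoc_of% hσ, hwθ])
  obtain ⟨A₂, π₂, hπ₂, v, hv⟩ := exists_refinement_of_comp_cokernel_π _ _
    (H.comp_cokernel_π_thetaIter h₁ h₂ h₃ (j + 1) (m := 1) (n := -j) e z (w ≫ σ) hz)
  replace hv : π₂ ≫ z = v ≫ thetaIter g M₁ (j + 1) (-j) 1 e := hv
  -- The corrected lift is `σ w - v`; `v` comes from `M₁`, so the image in `M₃` is unchanged.
  have ht : (kerIm g M₂ j).Factors ((π₂ ≫ w ≫ σ - v ≫ twHom r f (-j)) ≫ thetaPow g M₂ j) := by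
    refine (kerIm_factors_iff _).2 ⟨?_, A₂, 𝟙 _, inferInstance, _, Category.id_comp _⟩
    simp only [Category.assoc, hw', Preadditive.sub_comp, twHom_thetaIter]
    rw [← reassoc_of% hv, hz, Category.assoc, sub_self]
  refine ⟨A₂, π₂ ≫ π₁, inferInstance, (kerIm g M₂ j).factorThru _ ht, ?_⟩
  rw [← cancel_mono (kerIm g M₃ j).arrow, Category.assoc, Category.assoc, hw, Category.assoc,
    kerImMap_arrow, Subobject.factorThru_arrow_assoc, Category.assoc, ← twHom_thetaPow,
    Preadditive.sub_comp]
  simp only [Category.assoc]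
  rw [reassoc_of% hσ, ← twHom_comp_assoc, H.comp_eq_zero, twHom_zero]
  simp

theorem LocallySplitExact.shortExact_kerIm {f : M₁ ⟶ M₂} {h : M₂ ⟶ M₃}
    (H : LocallySplitExact g f h) (h₁ : constantJordanType g M₁) (h₂ : constantJordanType g M₂)
    (h₃ : constantJordanType g M₃) (j : ℕ) :
    (ShortComplex.mk _ _ (kerImMap_comp_eq_zero H j)).ShortExact := by
  refine ShortComplex.ShortExact.mk' ?_ ?_ ?_
  · rw [ShortComplex.exact_iff_exact_up_to_refinements]
    intro A x hx
    obtain ⟨z, hz⟩ := H.exists_comp_twHom_eq (x ≫ (kerIm g M₂ j).arrow) (by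
      rw [Category.assoc, ← kerImMap_arrow, reassoc_of% hx, Limits.zero_comp])
    refine ⟨A, 𝟙 _, inferInstance, (kerIm g M₁ j).factorThru z
      (H.factors_of_comp h₁ h₂ h₃ z (hz ▸ Subobject.factors_comp_arrow _)), ?_⟩
    dsimp only
    rw [← cancel_mono (kerIm g M₂ j).arrow, Category.assoc, Category.assoc, kerImMap_arrow,
      Subobject.factorThru_arrow_assoc, hz, Category.id_comp]
  · have := H.mono_twHom (r := r) 0
    have : Mono (kerImMap g f j ≫ (kerIm g M₂ j).arrow) := by
      rw [kerImMap_arrow]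
      infer_instance
    exact mono_of_mono _ (kerIm g M₂ j).arrow
  · exact (epi_iff_surjective_up_to_refinements _).2 fun A x =>
      H.exists_comp_kerImMap_eq h₁ h₂ h₃ j x

instance (i : ℕ) : Mono (kerImIncl g M i) := by
  unfold kerImIncl
  infer_instance

theorem LocallySplitExact.shortExact_sheafF {f : M₁ ⟶ M₂} {h : M₂ ⟶ M₃}
    (H : LocallySplitExact g f h) (h₁ : constantJordanType g M₁) (h₂ : constantJordanType g M₂)
    (h₃ : constantJordanType g M₃) (i : ℕ) :
    ∃ w : (sheafF g i).map f ≫ (sheafF g i).map h = 0, (ShortComplex.mk _ _ w).ShortExact := by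
  have w : (sheafF g i).map f ≫ (sheafF g i).map h = 0 := by
    rw [← Functor.map_comp, H.comp_eq_zero, Functor.map_zero]
  exact ⟨w, shortExact_cokernel (H.shortExact_kerIm h₁ h₂ h₃ i)
    (H.shortExact_kerIm h₁ h₂ h₃ (i - 1))
    { τ₁ := kerImIncl g M₁ i
      τ₂ := kerImIncl g M₂ i
      τ₃ := kerImIncl g M₃ i
      comm₁₂ := kerImIncl_kerImMap g f i
      comm₂₃ := kerImIncl_kerImMap g h i } inferInstance w⟩

end BPBundles

end

/-! ### Independence and generation for sections -/

noncomputable section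

namespace BPBundles

/-- Clearing denominators gives a relation over `A`; all factors introduced are nonzero elements of
a domain and can be cancelled again. -/
theorem eq_zero_of_sum_smul_mk_eq {A N N' κ : Type*} [CommRing A] [IsDomain A] [AddCommGroup N]
    [Module A N] [AddCommGroup N'] [Module A N'] [Fintype κ] {S : Submonoid A} (hS : 0 ∉ S)
    {n : κ → N} {L : N' →ₗ[A] N} (hn : ∀ (c : κ → A) (v : N'), ∑ i, c i • n i = L v → c = 0)
    (a : κ → Localization S) (d : κ → S) (v : LocalizedModule S N')
    (h : ∑ i, a i • LocalizedModule.mk (n i) (d i) = LocalizedModule.map S L v) (i : κ) :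
    a i = 0 := by
  obtain ⟨b, hb⟩ := IsLocalization.exist_integer_multiples_of_finite S
    (fun i => a i * Localization.mk 1 (d i))
  choose c hc using hb
  have hne : ∀ s : S, (s : A) ≠ 0 := fun s hs => hS (hs ▸ s.2)
  have hterm : ∀ i, (b : A) • a i • LocalizedModule.mk (n i) (d i) =
      LocalizedModule.mk (c i • n i) 1 := by
    intro i
    have h1 : LocalizedModule.mk (n i) (d i) =
        (Localization.mk 1 (d i) : Localization S) • LocalizedModule.mk (n i) (1 : S) := by
      rw [LocalizedModule.mk_smul_mk, one_smul, mul_one]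
    rw [h1, ← mul_smul, ← smul_assoc, ← hc, ← Localization.mk_one_eq_algebraMap,
      LocalizedModule.mk_smul_mk, one_mul]
  have hsum : LocalizedModule.mk (∑ i, c i • n i) (1 : S) =
      LocalizedModule.map S L ((b : A) • v) := by
    have := congrArg (fun y => (b : A) • y) h
    simp only [Finset.smul_sum, hterm] at this
    have h2 : LocalizedModule.mk (∑ i, c i • n i) (1 : S) =
        LocalizedModule.mkLinearMap S N (∑ i, c i • n i) := rfl
    rw [h2, map_sum]
    refine Eq.trans this ?_
    exact ((LocalizedModule.map S L).map_smul_of_tower (b : A) v).symm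
  generalize (b : A) • v = v' at hsum
  have hc0 : c = 0 := by
    induction v' using LocalizedModule.induction_on with
    | h v₀ e =>
      rw [LocalizedModule.map_mk, LocalizedModule.mk_eq] at hsum
      obtain ⟨q, hq⟩ := hsum
      simp only [Submonoid.smul_def, one_smul, smul_smul, Finset.smul_sum] at hq
      rw [← map_smul] at hq
      have := hn (fun i => q * (e * c i)) _ hq
      funext i
      have h5 := (mul_eq_zero.1 (congrFun this i)).resolve_left (hne q)
      exact (mul_eq_zero.1 h5).resolve_left (hne e)
  have h3 := hc i
  rw [hc0, Pi.zero_apply, map_zero, Algebra.smul_def] at h3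
  have hu : IsUnit (algebraMap A (Localization S) b) := IsLocalization.map_units _ b
  have h4 := (hu.mul_right_eq_zero).1 h3.symm
  have hu' : IsUnit (Localization.mk 1 (d i) : Localization S) :=
    IsUnit.of_mul_eq_one (Localization.mk (d i : A) 1) (by
      rw [Localization.mk_mul, one_mul, mul_one, Localization.mk_self])
  exact (hu'.mul_left_eq_zero).1 h4

theorem localizedModule_mk_sum {A N κ : Type*} [CommRing A] [AddCommGroup N] [Module A N]
    {S : Submonoid A} (F : Finset κ) (n : κ → N) (s : S) :
    LocalizedModule.mk (∑ i ∈ F, n i) s = ∑ i ∈ F, LocalizedModule.mk (n i) s := by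
  have h (x : N) : LocalizedModule.mk x s =
      (Localization.mk 1 s : Localization S) • LocalizedModule.mkLinearMap S N x := by
    rw [LocalizedModule.mkLinearMap_apply, LocalizedModule.mk_smul_mk, one_smul, mul_one]
  simp only [h, map_sum, Finset.smul_sum]

section Twist

variable {k A : Type u} [Field k] [CommRing A] [Algebra k A]
variable {𝒜 : ℕ → Submodule k A} [GradedAlgebra 𝒜]
variable {V : Type u} [AddCommGroup V] [Module k V]

theorem twistVal_sum {ι : Type*} {n : ℤ} {U : (Proj 𝒜).Opens} (F : Finset ι)
    (s : ι → Γ(twist 𝒜 V n, U)) (x : ProjectiveSpectrum.top 𝒜) (hx : x ∈ U) :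
    twistVal (∑ i ∈ F, s i) x hx = ∑ i ∈ F, twistVal (s i) x hx :=
  map_sum (⟨⟨fun s : Γ(twist 𝒜 V n, U) => twistVal s x hx, twistVal_zero x hx⟩,
    fun s t => twistVal_add s t x hx⟩ : Γ(twist 𝒜 V n, U) →+ LocAt 𝒜 V x) s F

variable {κ : Type u} [Fintype κ] {j : ℕ} {φ ψ : A ⊗[k] V →ₗ[A] A ⊗[k] V}
  (hφ : IsHomogeneousMap 𝒜 φ j) (hψ : IsHomogeneousMap 𝒜 ψ (j + 1 : ℕ))
  {d : κ → ℕ} {w : κ → A ⊗[k] V} (hw : ∀ i, w i ∈ piece 𝒜 V (d i + -(j : ℤ)))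
  {y : A} (hy : y ∈ 𝒜 1)

/-- The section `w_i / y ^ (d_i)`. -/
def basisSection (i : κ) (U : (Proj 𝒜).Opens) (hU : U ≤ dOpen y) : Γ(twist 𝒜 V (-(j : ℤ)), U) :=
  twistFrac (e := d i) (w i) (y ^ d i) (hw i)
    (by simpa using SetLike.pow_mem_graded (d i) hy) fun (x : ProjectiveSpectrum.top 𝒜) hx =>
      x.asHomogeneousIdeal.toIdeal.primeCompl.pow_mem (hU hx) (d i)

/-- A function vanishes if all its values do. The independence `hind` is a statement over `A`, so it
passes to the localization at every point of `D(y)`. -/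
theorem eq_zero_of_sum_smul_basisSection [IsDomain A]
    (hind : ∀ (c : κ → A) (v : A ⊗[k] V), ∑ i, c i • φ (w i) = ψ v → c = 0)
    {U : (Proj 𝒜).Opens} (hU : U ≤ dOpen y) (a : κ → Γ(Proj 𝒜, U))
    (v : Γ(twist 𝒜 V (-(j + 1 : ℕ)), U))
    (h : ∑ i, a i • (twistMap 𝒜 φ hφ (-j) 0 (by ring)).app U (basisSection hw hy i U hU) =
      (twistMap 𝒜 ψ hψ (-(j + 1 : ℕ)) 0 (by ring)).app U v) (i : κ) : a i = 0 := by
  refine fun_eq_zero_of_val _ fun (x : ProjectiveSpectrum.top 𝒜) hx => ?_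
  have h1 := congrArg (fun s => twistVal s x hx) h
  simp only [twistVal_sum, twistVal_smul, twistVal_twistMap] at h1
  refine eq_zero_of_sum_smul_mk_eq (S := x.asHomogeneousIdeal.toIdeal.primeCompl)
    (fun h0 => h0 (zero_mem _)) hind
    (fun i => ((show (ProjectiveSpectrum.Proj.structureSheaf 𝒜).1.obj (op U) from a i).1
      ⟨x, hx⟩).val)
    (fun i => ⟨y ^ d i, x.asHomogeneousIdeal.toIdeal.primeCompl.pow_mem (hU hx) (d i)⟩)
    (twistVal v x hx) ?_ i
  refine Eq.trans (Finset.sum_congr rfl fun i _ => ?_) h1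
  exact congrArg _ (LocalizedModule.map_mk ..).symm

/-- Near `x`, `z = t / b` with `ψ t = 0`, and dividing the relation `hgen` by `h b` expresses `φ(t)
/ b` by the `φ(w_l) / y ^ (d_l)`, with coefficients `c_l y ^ (d_l) / (h b)`, up to `ψ(v) / (h b)`.
The quantifier over `U'` allows a later passage to a smaller open set. -/
theorem exists_eq_sum_smul_basisSection [Module.IsTorsionFree A (A ⊗[k] V)] [IsDomain A]
    {m : ℕ} {h : A} (hh : h ∈ 𝒜 m)
    (hgen : ∀ (e : ℕ) (z : A ⊗[k] V), z ∈ piece 𝒜 V ((e : ℤ) - j) → ψ z = 0 →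
      ∃ (c : κ → A) (v : A ⊗[k] V), (∀ i, ∀ b ∈ 𝒜 (d i), c i * b ∈ 𝒜 (m + e)) ∧
        v ∈ piece 𝒜 V (((m + e : ℕ) : ℤ) - (j + 1 : ℕ)) ∧
          h • φ z = ∑ i, c i • φ (w i) + ψ v)
    {U : (Proj 𝒜).Opens} (hU : U ≤ dOpen y) (hU' : U ≤ dOpen h)
    (z : Γ(twist 𝒜 V (-j), U)) (hz : (twistMap 𝒜 ψ hψ (-j) 1 (by push_cast; ring)).app U z = 0)
    (x : ProjectiveSpectrum.top 𝒜) (hx : x ∈ U) :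
    ∃ (U₁ : (Proj 𝒜).Opens), x ∈ U₁ ∧ ∀ (U' : (Proj 𝒜).Opens) (i : U' ≤ U), U' ≤ U₁ →
      ∃ (a : κ → Γ(Proj 𝒜, U')) (v : Γ(twist 𝒜 V (-(j + 1 : ℕ)), U')),
        (twistMap 𝒜 φ hφ (-j) 0 (by ring)).app U' ((twist 𝒜 V (-j)).presheaf.map (homOfLE i).op z) =
          ∑ i', a i' • (twistMap 𝒜 φ hφ (-j) 0 (by ring)).app U'
            (basisSection hw hy i' U' (i.trans hU)) +
          (twistMap 𝒜 ψ hψ (-(j + 1 : ℕ)) 0 (by ring)).app U' v := by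
  obtain ⟨U₁, i₁, hx₁, e, t, b, ht, hb, htb⟩ := exists_twistVal_eq_mk z hx
  -- A fraction that is zero at one point has zero numerator, as the module is torsion-free.
  have hψt : ψ t = 0 := by
    have h1 := congrArg (fun s => twistVal s x hx) hz
    obtain ⟨hbx, hbx'⟩ := htb x hx₁
    simp only [twistVal_twistMap] at h1
    rw [hbx', LocalizedModule.map_mk] at h1
    replace h1 : LocalizedModule.mk (ψ t) ⟨b, hbx⟩ =
      (0 : LocalizedModule x.asHomogeneousIdeal.toIdeal.primeCompl (A ⊗[k] V)) := h1
    rw [← LocalizedModule.zero_mk 1, LocalizedModule.mk_eq] at h1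
    obtain ⟨q, hq⟩ := h1
    simp only [Submonoid.smul_def, smul_zero, one_smul] at hq
    refine (smul_eq_zero.1 hq).resolve_left fun h0 => q.2 ?_
    rw [h0]
    exact zero_mem _
  obtain ⟨c, v, hc, hv, hcv⟩ := hgen e t (by rwa [sub_eq_add_neg]) hψt
  have hhb : ∀ U' ≤ U, U' ≤ U₁ → ∀ x ∈ U',
      h * b ∉ (ProjectiveSpectrum.asHomogeneousIdeal (𝒜 := 𝒜) x).toIdeal :=
    fun U' i i' (x : ProjectiveSpectrum.top 𝒜) hx =>
      x.asHomogeneousIdeal.toIdeal.primeCompl.mul_mem (hU' (i hx)) (htb x (i' hx)).1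
  refine ⟨U₁, hx₁, fun U' i i' => ⟨fun l => fracFun (e := m + e) (c l * y ^ d l) (h * b)
    (hc l _ (by simpa using SetLike.pow_mem_graded (d l) hy)) (SetLike.mul_mem_graded hh hb)
    (hhb U' i i'), twistFrac (e := m + e) v (h * b) (by rwa [sub_eq_add_neg] at hv)
    (SetLike.mul_mem_graded hh hb) (hhb U' i i'), ?_⟩⟩
  refine twistVal_ext fun (q : ProjectiveSpectrum.top 𝒜) hq => ?_
  obtain ⟨hbq, hbq'⟩ := htb q (i' hq)
  have hadd : LocalizedModule.mk (h • φ t) (⟨h * b, hhb U' i i' q hq⟩ :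
      q.asHomogeneousIdeal.toIdeal.primeCompl) =
      ∑ l, LocalizedModule.mk (c l • φ (w l)) ⟨h * b, hhb U' i i' q hq⟩ +
        LocalizedModule.mk (ψ v) ⟨h * b, hhb U' i i' q hq⟩ := by
    rw [hcv]
    -- `Option κ` treats the extra term `ψ v` as one more summand.
    have := localizedModule_mk_sum Finset.univ (fun l : Option κ => l.elim (ψ v) fun l =>
      c l • φ (w l)) (⟨h * b, hhb U' i i' q hq⟩ : q.asHomogeneousIdeal.toIdeal.primeCompl)
    simpa only [Fintype.sum_option, Option.elim, add_comm] using this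
  have hleft : LocalizedModule.mk (h • φ t) (⟨h * b, hhb U' i i' q hq⟩ :
      q.asHomogeneousIdeal.toIdeal.primeCompl) = LocalizedModule.mk (φ t) ⟨b, hbq⟩ := by
    rw [LocalizedModule.mk_eq]
    exact ⟨1, by simp only [one_smul, Submonoid.smul_def, smul_smul, mul_comm]⟩
  refine ((congrArg _ hbq').trans (LocalizedModule.map_mk ..)).trans (hleft.symm.trans ?_)
  rw [hadd, twistVal_add, twistVal_sum]
  refine congrArg₂ _ (Finset.sum_congr rfl fun l _ => ?_) (LocalizedModule.map_mk ..).symm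
  rw [twistVal_fracFun_smul]
  refine Eq.trans ?_ (congrArg _ (LocalizedModule.map_mk ..).symm)
  rw [LocalizedModule.mk_smul_mk, LocalizedModule.mk_eq]
  exact ⟨1, by simp only [one_smul, Submonoid.smul_def, smul_smul, Submonoid.coe_mul]; congr 1; ring⟩

end Twist

end BPBundles

end

/-! ### Locally free sheaves of finite rank are coherent -/

noncomputable section

namespace BPBundles

open Scheme.Modules

variable {Y : Scheme.{u}}

/-- Finite type and quasi-coherence refer to the site over `U`, local freeness to the scheme `U`.
The equivalence `overEquiv` carries generators across once the unit (`η`) and the restriction of `F`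
(`e`) are identified. -/
theorem exists_generatingSections_over (F : Y.Modules) (U : Y.Opens) (κ : Type u)
    (c : SheafOfModules.free (R := U.toScheme.ringCatSheaf) κ ⟶ F.restrict U.ι) (hc : IsIso c) :
    ∃ G : (SheafOfModules.over F U).GeneratingSections, G.I = κ ∧ IsIso G.π := by
  have hepi : Epi c := @IsIso.epi_of_iso _ _ _ _ _ hc
  let L : SheafOfModules U.toScheme.ringCatSheaf ⥤ SheafOfModules (Y.ringCatSheaf.over U) :=
    (overEquiv U).inverse
  have hL : Limits.PreservesColimitsOfSize.{u, u} L :=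
    (overEquiv U).symm.toAdjunction.leftAdjoint_preservesColimits
  let η : SheafOfModules.unit (Y.ringCatSheaf.over U) ≅
      L.obj (SheafOfModules.unit U.toScheme.ringCatSheaf) :=
    (overEquiv U).unitIso.app _ ≪≫ (overEquiv U).inverse.mapIso
      ((overFunctorEquiv U).app (SheafOfModules.unit Y.ringCatSheaf) ≪≫
        restrictUnitIso U.ι)
  let e : L.obj (F.restrict U.ι) ≅ SheafOfModules.over F U :=
    (overEquiv U).inverse.mapIso ((overFunctorEquiv U).app F).symm ≪≫
      ((overEquiv U).unitIso.app _).symm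
  let G₀ : (show SheafOfModules U.toScheme.ringCatSheaf from F.restrict U.ι).GeneratingSections :=
    (SheafOfModules.free.generatingSections κ).ofEpi c
  have h₀ : IsIso G₀.π := by
    rw [SheafOfModules.GeneratingSections.ofEpi_π, SheafOfModules.free.generatingSections_π]
    exact IsIso.comp_isIso' (IsIso.id _) hc
  let G₁ : (L.obj (F.restrict U.ι)).GeneratingSections := G₀.map L η
  have h₁ : IsIso G₁.π := inferInstanceAs (IsIso (G₀.map L η).π)
  refine ⟨G₁.ofEpi e.hom, rfl, ?_⟩
  rw [SheafOfModules.GeneratingSections.ofEpi_π]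
  exact IsIso.comp_isIso' h₁ (Iso.isIso_hom e)

theorem isCoherent_of_locally_free (F : Y.Modules)
    (h : ∀ x : Y, ∃ U : Y.Opens, x ∈ U ∧ ∃ (κ : Type u) (_ : Finite κ)
      (c : SheafOfModules.free (R := U.toScheme.ringCatSheaf) κ ⟶ F.restrict U.ι), IsIso c) :
    IsCoherent F := by
  choose U hxU κ hκ c hc using h
  choose G hG hGπ using fun x => exists_generatingSections_over F (U x) (κ x) (c x) (hc x)
  let q : SheafOfModules.LocalGeneratorsData.{u} (C := Y.Opens) F :=
    { I := Y
      X := U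
      coversTop := by
        rw [Opens.coversTop_iff]
        exact eq_top_iff.2 fun x _ => Opens.mem_iSup.2 ⟨x, hxU x⟩
      generators := G }
  have : q.IsLocallyFreeData := by
    refine { isIso := hGπ }
  refine ⟨q.quasiCoherentData.isQuasicoherent, ?_⟩
  have hft : q.IsFiniteType := { isFiniteType := fun x => ⟨(hG x).symm ▸ hκ x⟩ }
  constructor
  exact ⟨q, hft⟩

end BPBundles

end

/-! ### Maps out of finite free sheaves -/

noncomputable section

namespace BPBundles

open Scheme.Modules

variable {Y : Scheme.{u}}

variable (Y) in
/-- The structure sheaf as a sheaf of modules. -/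
abbrev unitModule : Y.Modules := SheafOfModules.unit Y.ringCatSheaf

variable (Y) in
/-- The free sheaf of modules on a type. -/
abbrev freeModule (κ : Type u) : Y.Modules := SheafOfModules.free (R := Y.ringCatSheaf) κ

variable (Y) in
/-- A coordinate inclusion of a free sheaf of modules. -/
abbrev freeInj {κ : Type u} (i : κ) : unitModule Y ⟶ freeModule Y κ := SheafOfModules.ιFree i

theorem freeModule_hom_ext {κ : Type u} {N : Y.Modules} {φ ψ : freeModule Y κ ⟶ N}
    (h : ∀ i, freeInj Y i ≫ φ = freeInj Y i ≫ ψ) : φ = ψ :=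
  Limits.Cofan.IsColimit.hom_ext (SheafOfModules.isColimitFreeCofan κ) _ _ h

/-- The morphism out of a free sheaf of modules given by a family of morphisms. -/
def freeDesc {κ : Type u} {N : Y.Modules} (φ : κ → (unitModule Y ⟶ N)) : freeModule Y κ ⟶ N :=
  Limits.Cofan.IsColimit.desc (SheafOfModules.isColimitFreeCofan κ) φ

theorem freeInj_freeDesc {κ : Type u} {N : Y.Modules} (φ : κ → (unitModule Y ⟶ N)) (i : κ) :
    freeInj Y i ≫ freeDesc φ = φ i :=
  Limits.Cofan.IsColimit.fac (SheafOfModules.isColimitFreeCofan κ) φ i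

/-- The morphism `𝒪 ⟶ N` given by a global section. -/
def unitDesc {N : Y.Modules} (s : Γ(N, ⊤)) : unitModule Y ⟶ N :=
  (SheafOfModules.unitHomEquiv _).symm
    (PresheafOfModules.sectionsMk (M := N.val)
      (fun U => N.presheaf.map (homOfLE (le_top : U.unop ≤ ⊤)).op s)
      (fun U U' f => by
        exact (ConcreteCategory.congr_hom (N.presheaf.map_comp
          (homOfLE (le_top : U.unop ≤ ⊤)).op f) s).symm))

theorem unitDesc_app {N : Y.Modules} (s : Γ(N, ⊤)) (W : Y.Opens) (a : Γ(Y, W)) :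
    (unitDesc s).app W a = a • N.presheaf.map (homOfLE (le_top : W ≤ ⊤)).op s := by
  rfl

variable {κ : Type u} [Fintype κ]

/-- The identity of a finite free sheaf is the sum of the coordinate projections followed by the
inclusions. -/
theorem exists_eq_sum_freeInj (W : Y.Opens) (x : Γ(freeModule Y κ, W)) :
    ∃ a : κ → Γ(Y, W), x = ∑ i, (freeInj Y i).app W (a i) := by
  classical
  let pr (i : κ) : freeModule Y κ ⟶ unitModule Y := freeDesc fun i' => if i' = i then 𝟙 _ else 0
  have h : ∑ i, pr i ≫ freeInj Y i = 𝟙 _ := by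
    refine freeModule_hom_ext fun i' => ?_
    rw [Preadditive.comp_sum, Finset.sum_eq_single i']
    · rw [← Category.assoc, freeInj_freeDesc, if_pos rfl, Category.id_comp, Category.comp_id]
    · intro b _ hb
      rw [← Category.assoc, freeInj_freeDesc, if_neg (Ne.symm hb), Limits.zero_comp]
    · simp
  refine ⟨fun i => (pr i).app W x, ?_⟩
  have h1 := congrArg (fun φ : freeModule Y κ ⟶ freeModule Y κ => φ.app W x) h
  let T : (freeModule Y κ ⟶ freeModule Y κ) →+ Γ(freeModule Y κ, W) :=
    ⟨⟨fun φ => φ.app W x, rfl⟩, fun _ _ => rfl⟩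
  exact h1.symm.trans (map_sum T _ _)

theorem freeDesc_app_sum {N : Y.Modules} (s : κ → Γ(N, ⊤)) (W : Y.Opens) (a : κ → Γ(Y, W)) :
    (freeDesc fun i => unitDesc (s i)).app W (∑ i, (freeInj Y i).app W (a i)) =
      ∑ i, a i • N.presheaf.map (homOfLE (le_top : W ≤ ⊤)).op (s i) := by
  rw [map_sum]
  refine Finset.sum_congr rfl fun i _ => ?_
  exact (congrArg (fun φ : unitModule Y ⟶ N => φ.app W (show Γ(unitModule Y, W) from a i))
    (freeInj_freeDesc (fun i => unitDesc (s i)) i)).trans (unitDesc_app _ _ _)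

/-- A criterion for sections of `Z` to give a basis of a quotient of `Z`. -/
theorem isIso_freeDesc_comp {Z F : Y.Modules} (q : Z ⟶ F) [Epi q] (s : κ → Γ(Z, ⊤))
    (hgen : ∀ (W : Y.Opens) (z : Γ(Z, W)), ∀ y ∈ W, ∃ (W' : Y.Opens) (i : W' ≤ W), y ∈ W' ∧
      ∃ a : κ → Γ(Y, W'), q.app W' (Z.presheaf.map (homOfLE i).op z) =
        q.app W' (∑ i, a i • Z.presheaf.map (homOfLE (le_top : W' ≤ ⊤)).op (s i)))
    (hind : ∀ (A : Y.Modules) (z : A ⟶ Z), z ≫ q = 0 → ∃ (A' : Y.Modules) (π : A' ⟶ A) (_ : Epi π),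
      ∀ (W : Y.Opens) (t : Γ(A', W)) (a : κ → Γ(Y, W)), (π ≫ z).app W t =
        ∑ i, a i • Z.presheaf.map (homOfLE (le_top : W ≤ ⊤)).op (s i) → a = 0) :
    IsIso ((freeDesc fun i => unitDesc (s i)) ≫ q) := by
  set c := freeDesc fun i => unitDesc (s i) with hc
  have : Epi (c ≫ q) := by
    refine Abelian.epi_of_cokernel_π_eq_zero _ ?_
    rw [← cancel_epi q, Limits.comp_zero]
    refine comp_cokernel_π_eq_zero _ _ fun W z y hy => ?_
    obtain ⟨W', i, hy', a, ha⟩ := hgen W z y hy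
    refine ⟨W', i, hy', ∑ i, (freeInj Y i).app W' (a i), ?_⟩
    rw [← hom_app_map, ha, Hom.comp_app, ConcreteCategory.comp_apply, hc, freeDesc_app_sum]
  have : Mono (c ≫ q) := by
    refine Preadditive.mono_of_cancel_zero _ fun {A} x hx => ?_
    obtain ⟨A', π, hπ, h⟩ := hind A (x ≫ c) ((Category.assoc _ _ _).trans hx)
    rw [← cancel_epi π, Limits.comp_zero]
    refine Scheme.Modules.hom_ext _ _ fun W => ?_
    ext t
    obtain ⟨a, ha⟩ := exists_eq_sum_freeInj W ((π ≫ x).app W t)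
    have ha0 := h W t a (by
      rw [← Category.assoc, Hom.comp_app, ConcreteCategory.comp_apply, ha, hc, freeDesc_app_sum])
    refine ha.trans ?_
    rw [ha0]
    exact Finset.sum_eq_zero fun i _ => map_zero _
  exact isIso_of_mono_of_epi _

/-- Taking sections over `U` is left exact. -/
theorem exists_kernel_section {N N' : Y.Modules} (φ : N ⟶ N') (U : Y.Opens) (s : Γ(N, U))
    (hs : φ.app U s = 0) :
    ∃ t : Γ(Limits.kernel φ, U), (Limits.kernel.ι φ).app U t = s := by
  let S : ShortComplex Y.Modules := ShortComplex.mk _ _ (Limits.kernel.condition φ)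
  have hS : S.Exact := S.exact_of_f_is_kernel (Limits.kernelIsKernel φ)
  let ev := (evaluation (Opens Y)ᵒᵖ AddCommGrpCat.{u}).obj (op U)
  have h₀ : Limits.PreservesLimitsOfShape Limits.WalkingParallelPair ev := inferInstance
  let T : Y.Modules ⥤ AddCommGrpCat.{u} := toPresheaf Y ⋙ ev
  have h₁ := Limits.preservesSmallestLimits_of_preservesLimits (toPresheaf Y)
  have h₂ : Limits.PreservesLimitsOfShape Limits.WalkingParallelPair T :=
    @Limits.comp_preservesLimitsOfShape _ _ _ _ _ _ _ _ (toPresheaf Y) ev inferInstance h₀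
  have hT : T.PreservesZeroMorphisms := ⟨fun _ _ => rfl⟩
  have := hS.map_of_mono_of_preservesKernel T inferInstance inferInstance
  obtain ⟨t, ht⟩ := (ShortComplex.ab_exact_iff _).1 this s hs
  exact ⟨t, ht⟩

end BPBundles

end

/-! ### `ℱ_{j+1}` as a quotient of `Ker θ ^ (j + 1)` -/

noncomputable section

namespace BPBundles

open Scheme.Modules

open MvPolynomial (homogeneousSubmodule)

attribute [local instance] MvPolynomial.gradedAlgebra
attribute [local instance] ModuleCat.moduleOfAlgebraModule
  ModuleCat.isScalarTower_of_algebra_moduleCat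

/-- `R` preserves cokernels, so `z ≫ R.map m` lifts to `R.obj X₁` after a refinement, and then along
the epimorphism `R.map b`. It is applied to the restriction to an open subset. -/
theorem exists_refinement_of_comp_map_cokernel {C D : Type*} [Category C] [Abelian C] [Category D]
    [Abelian D] (R : C ⥤ D) [R.PreservesZeroMorphisms] [R.PreservesEpimorphisms]
    [Limits.PreservesColimitsOfShape Limits.WalkingParallelPair R]
    {X₁ X₂ Z Z' : C} (a : X₁ ⟶ X₂) (b : Z' ⟶ X₁) [Epi b] (m : Z ⟶ X₂) {A : D} (z : A ⟶ R.obj Z)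
    (hz : z ≫ R.map (m ≫ Limits.cokernel.π a) = 0) :
    ∃ (A' : D) (π : A' ⟶ A) (_ : Epi π) (y : A' ⟶ R.obj Z'),
      π ≫ z ≫ R.map m = y ≫ R.map (b ≫ a) := by
  let S : ShortComplex C := ShortComplex.mk _ _ (Limits.cokernel.condition a)
  have hS : S.Exact := S.exact_of_g_is_cokernel (Limits.cokernelIsCokernel _)
  have hS' := hS.map_of_epi_of_preservesCokernel R inferInstance inferInstance
  rw [R.map_comp, ← Category.assoc] at hz
  obtain ⟨A₁, π₁, hπ₁, x, hx⟩ : ∃ (A₁ : D) (π₁ : A₁ ⟶ A) (_ : Epi π₁) (x : A₁ ⟶ R.obj X₁),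
      π₁ ≫ z ≫ R.map m = x ≫ R.map a := hS'.exact_up_to_refinements (z ≫ R.map m) hz
  obtain ⟨A₂, π₂, hπ₂, y, hy⟩ := surjective_up_to_refinements_of_epi (R.map b) x
  refine ⟨A₂, π₂ ≫ π₁, epi_comp _ _, y, ?_⟩
  rw [Category.assoc, hx, R.map_comp, ← Category.assoc, hy, Category.assoc]

variable {p : ℕ} {k : Type u} [Field k] {r : ℕ} {E : Type v} [CommGroup E]
  [Module (ZMod p) (Additive E)] (g : Module.Basis (Fin r) (ZMod p) (Additive E))
  (M : ModuleCat.{u} (MonoidAlgebra k E)) (j : ℕ)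

theorem one_eq_neg_add_succ : (1 : ℤ) = -(j : ℤ) + (j + 1 : ℕ) := by push_cast; ring

/-- The kernel of `θ_M ^ (j + 1)` on `M ⊗ 𝒪(-j)`. -/
abbrev kerIter : (ProjSpace k r).Modules :=
  Limits.kernel (thetaIter g M (j + 1) (-j) 1 (one_eq_neg_add_succ j))

/-- The inclusion of the kernel of `θ_M ^ (j + 1)` in `M ⊗ 𝒪(-j)`. -/
abbrev kerIterι : kerIter g M j ⟶ tw r M (-j) :=
  Limits.kernel.ι (thetaIter g M (j + 1) (-j) 1 (one_eq_neg_add_succ j))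

theorem thetaPow_comp_theta : thetaPow g M j ≫ theta g M 0 1 (zero_add 1).symm =
    thetaIter g M (j + 1) (-j) 1 (one_eq_neg_add_succ j) :=
  thetaIter_comp_theta M j (-j) 0 1 (by ring) (by ring)

theorem kerIter_factors : (kerIm g M j).Factors (kerIterι g M j ≫ thetaPow g M j) := by
  refine (kerIm_factors_iff _).2 ⟨?_, _, 𝟙 _, inferInstance, _, Category.id_comp _⟩
  rw [Category.assoc, thetaPow_comp_theta, Limits.kernel.condition]

/-- The map `θ_M ^ j` from `Ker θ_M ^ (j + 1)` to `Ker θ_M ∩ Im θ_M ^ j`. -/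
def kerIterMap : kerIter g M j ⟶ (kerIm g M j : (ProjSpace k r).Modules) :=
  (kerIm g M j).factorThru _ (kerIter_factors g M j)

theorem kerIterMap_arrow :
    kerIterMap g M j ≫ (kerIm g M j).arrow = kerIterι g M j ≫ thetaPow g M j :=
  Subobject.factorThru_arrow _ _ _

/-- If `θ ^ j y` is killed by θ, then `y` lies in `Ker θ ^ (j + 1)`. This replaces an image sheaf by
a kernel, whose sections can be computed directly. -/
instance : Epi (kerIterMap g M j) := by
  refine (epi_iff_surjective_up_to_refinements _).2 fun A x => ?_
  obtain ⟨hθ, A', π, hπ, y, hy⟩ := (kerIm_factors_iff (x ≫ (kerIm g M j).arrow)).1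
    (Subobject.factors_comp_arrow _)
  have h0 : y ≫ thetaIter g M (j + 1) (-j) 1 (one_eq_neg_add_succ j) = 0 := by
    rw [← thetaPow_comp_theta, ← Category.assoc, ← hy, Category.assoc, hθ, Limits.comp_zero]
  refine ⟨A', π, hπ, Limits.kernel.lift _ y h0, ?_⟩
  rw [← cancel_mono (kerIm g M j).arrow, Category.assoc, hy, Category.assoc, kerIterMap_arrow,
    Limits.kernel.lift_ι_assoc]

/-- The inclusion of `Ker θ_M ∩ Im θ_M ^ (j + 1)` in `Ker θ_M ∩ Im θ_M ^ j`. -/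
def kerImSucc : (kerIm g M (j + 1) : (ProjSpace k r).Modules) ⟶
    (kerIm g M j : (ProjSpace k r).Modules) :=
  Subobject.ofLE _ _ (kerIm_antitone g M (Nat.le_succ j))

theorem kerImSucc_arrow : kerImSucc g M j ≫ (kerIm g M j).arrow = (kerIm g M (j + 1)).arrow :=
  Subobject.ofLE_arrow _

/-- The quotient map from `Ker θ_M ^ (j + 1)` to `ℱ_{j + 1}(M)`. -/
def kerIterQuot : kerIter g M j ⟶ Limits.cokernel (kerImSucc g M j) :=
  kerIterMap g M j ≫ Limits.cokernel.π _

instance : Epi (kerIterQuot g M j) := by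
  unfold kerIterQuot
  exact epi_comp _ _

variable {g M j}

/-- Applying θ to `h` shows that `v` is killed by `θ ^ (j + 2)`, so `θ ^ (j + 1) v` is a section of
the subsheaf that is divided out. -/
theorem kerIterQuot_app_eq {O : (ProjSpace k r).Opens} (t t' : Γ(kerIter g M j, O))
    (v : Γ(tw r M (-(j + 1 : ℕ)), O))
    (h : (thetaPow g M j).app O ((kerIterι g M j).app O t) =
      (thetaPow g M j).app O ((kerIterι g M j).app O t') + (thetaPow g M (j + 1)).app O v) :
    (kerIterQuot g M j).app O t = (kerIterQuot g M j).app O t' := by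
  have hker (s : Γ(kerIter g M j, O)) :
      (theta g M 0 1 (zero_add 1).symm).app O
        ((thetaPow g M j).app O ((kerIterι g M j).app O s)) = 0 :=
    congr($(show kerIterι g M j ≫ thetaPow g M j ≫ theta g M 0 1 (zero_add 1).symm = 0 by
      rw [thetaPow_comp_theta, Limits.kernel.condition]).app O s)
  obtain ⟨v', hv'⟩ := exists_kernel_section
    (thetaIter g M (j + 1 + 1) (-(j + 1 : ℕ)) 1 (one_eq_neg_add_succ (j + 1))) O v (by
      rw [← thetaPow_comp_theta, Hom.comp_app, ConcreteCategory.comp_apply]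
      have := congrArg ((theta g M 0 1 (zero_add 1).symm).app O) h
      rw [map_add, hker, hker, zero_add] at this
      exact this.symm)
  have hmap (s : Γ(kerIter g M j, O)) : (kerIm g M j).arrow.app O ((kerIterMap g M j).app O s) =
      (thetaPow g M j).app O ((kerIterι g M j).app O s) :=
    congr($(kerIterMap_arrow g M j).app O s)
  have hmap' : (kerIm g M j).arrow.app O ((kerImSucc g M j).app O
      ((kerIterMap g M (j + 1)).app O v')) = (thetaPow g M (j + 1)).app O v := by
    rw [← hv']
    have h1 : kerIterMap g M (j + 1) ≫ kerImSucc g M j ≫ (kerIm g M j).arrow =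
        kerIterι g M (j + 1) ≫ thetaPow g M (j + 1) := by
      rw [kerImSucc_arrow, kerIterMap_arrow]
    exact congr($(h1).app O v')
  have key : (kerIterMap g M j).app O t = (kerIterMap g M j).app O t' +
      (kerImSucc g M j).app O ((kerIterMap g M (j + 1)).app O v') := by
    apply app_injective_of_mono (kerIm g M j).arrow O
    rw [map_add, hmap, hmap, hmap', h]
  have h0 : (Limits.cokernel.π (kerImSucc g M j)).app O ((kerImSucc g M j).app O
      ((kerIterMap g M (j + 1)).app O v')) = 0 :=
    congr($(Limits.cokernel.condition (kerImSucc g M j)).app O ((kerIterMap g M (j + 1)).app O v'))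
  change (Limits.cokernel.π (kerImSucc g M j)).app O ((kerIterMap g M j).app O t) =
    (Limits.cokernel.π (kerImSucc g M j)).app O ((kerIterMap g M j).app O t')
  rw [key, map_add, h0, add_zero]

theorem exists_refinement_of_comp_kerIterQuot (U : (ProjSpace k r).Opens)
    {A : U.toScheme.Modules} (z : A ⟶ (kerIter g M j).restrict U.ι)
    (hz : z ≫ (restrictFunctor U.ι).map (kerIterQuot g M j) = 0) :
    ∃ (A' : U.toScheme.Modules) (π : A' ⟶ A) (_ : Epi π)
      (v : A' ⟶ (tw r M (-(j + 1 : ℕ))).restrict U.ι),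
      π ≫ z ≫ (restrictFunctor U.ι).map (kerIterι g M j ≫ thetaPow g M j) =
        v ≫ (restrictFunctor U.ι).map (thetaPow g M (j + 1)) := by
  let R := restrictFunctor U.ι
  have hR : R.PreservesZeroMorphisms := ⟨fun _ _ => rfl⟩
  have hR' : Limits.PreservesColimitsOfShape Limits.WalkingParallelPair R := inferInstance
  obtain ⟨A', π, hπ, y, hy⟩ := exists_refinement_of_comp_map_cokernel R (kerImSucc g M j)
    (kerIterMap g M (j + 1)) (kerIterMap g M j) z hz
  refine ⟨A', π, hπ, y ≫ R.map (kerIterι g M (j + 1)), ?_⟩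
  have h1 : π ≫ z ≫ R.map (kerIterι g M j ≫ thetaPow g M j) =
      (π ≫ z ≫ R.map (kerIterMap g M j)) ≫ R.map (kerIm g M j).arrow := by
    rw [← kerIterMap_arrow, R.map_comp, Category.assoc, Category.assoc]
  have h2 : (y ≫ R.map (kerIterι g M (j + 1))) ≫ R.map (thetaPow g M (j + 1)) =
      (y ≫ R.map (kerIterMap g M (j + 1) ≫ kerImSucc g M j)) ≫ R.map (kerIm g M j).arrow := by
    rw [Category.assoc, Category.assoc, ← R.map_comp, ← R.map_comp, Category.assoc,
      kerImSucc_arrow, kerIterMap_arrow]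
  exact h1.trans ((congrArg (· ≫ R.map (kerIm g M j).arrow) hy).trans h2.symm)

end BPBundles

end

/-! ### Local freeness of `ℱ_i(M)` -/

noncomputable section

namespace BPBundles

open Scheme.Modules

open MvPolynomial (homogeneousSubmodule)

attribute [local instance] MvPolynomial.gradedAlgebra
attribute [local instance] ModuleCat.moduleOfAlgebraModule
  ModuleCat.isScalarTower_of_algebra_moduleCat

variable {p : ℕ} {k : Type u} [Field k] {r : ℕ} {E : Type v} [CommGroup E]
  [Module (ZMod p) (Additive E)] {g : Module.Basis (Fin r) (ZMod p) (Additive E)}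
  {M : ModuleCat.{u} (MonoidAlgebra k E)} {j : ℕ}

theorem restrict_map_app_sum_smul {Y : Scheme.{u}} (U : Y.Opens) {N N' : Y.Modules} (φ : N ⟶ N')
    {κ : Type*} [Fintype κ] (W : U.toScheme.Opens) (a : κ → Γ(U.toScheme, W))
    (s : κ → Γ(N.restrict U.ι, W)) (s' : κ → Γ(N', U.ι ''ᵁ W))
    (hs : ∀ i, φ.app (U.ι ''ᵁ W) (s i) = s' i) :
    ((restrictFunctor U.ι).map φ).app W (∑ i, a i • s i) =
      ∑ i, (U.ι.appIso W).inv (a i) • s' i := by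
  rw [map_sum]
  refine Finset.sum_congr rfl fun i _ => ?_
  rw [Hom.app_smul, ← hs]
  rfl

/-- On `U = D(h) ∩ D(Y_l)` the sections `w_i / Y_l ^ (d_i)` map to a basis: `Y_l` gives them the
right degree, and `h` is the denominator needed for generation. -/
theorem exists_isIso_free_restrict (hM : constantJordanType (k := k) g M)
    (x : ProjectiveSpectrum.top (homogeneousSubmodule (Fin r) k)) :
    ∃ U : (ProjSpace k r).Opens, x ∈ U ∧ ∃ (κ : Type u) (_ : Finite κ)
      (c : SheafOfModules.free (R := U.toScheme.ringCatSheaf) κ ⟶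
        (Limits.cokernel (kerImSucc g M j)).restrict U.ι), IsIso c := by
  obtain ⟨l, hl⟩ := exists_X_notMem x
  obtain ⟨κ, hκ, d, w, m, h, hhm, hhx, hwd, hwθ, hind, hgen⟩ :=
    exists_homogeneous_local_basis hM x.asHomogeneousIdeal.toIdeal hl j
  have hw : ∀ i, w i ∈ piece (homogeneousSubmodule (Fin r) k) M (d i + -(j : ℤ)) := fun i => by
    rw [← sub_eq_add_neg]
    exact hwd i
  have hX : (MvPolynomial.X l : MvPolynomial (Fin r) k) ∈ homogeneousSubmodule (Fin r) k 1 :=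
    (MvPolynomial.mem_homogeneousSubmodule _ _).2 (MvPolynomial.isHomogeneous_X k l)
  let U : (ProjSpace k r).Opens := dOpen h ⊓ dOpen (MvPolynomial.X l)
  have hU (W : U.toScheme.Opens) : U.ι ''ᵁ W ≤ U := by
    rintro _ ⟨y, -, rfl⟩
    exact y.2
  let b (i : κ) (W : U.toScheme.Opens) : Γ(tw r M (-j), U.ι ''ᵁ W) :=
    basisSection hw hX i (U.ι ''ᵁ W) ((hU W).trans inf_le_right)
  -- The `w_i` are killed by `θ ^ (j + 1)`, so their fractions are sections of the kernel.
  have hb (i : κ) : ∃ s : Γ(kerIter g M j, U.ι ''ᵁ ⊤),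
      (kerIterι g M j).app (U.ι ''ᵁ ⊤) s = b i ⊤ := by
    refine exists_kernel_section _ _ _ (twistVal_ext fun y hy => ?_)
    refine (LocalizedModule.map_mk ..).trans ?_
    rw [hwθ]
    exact LocalizedModule.zero_mk _
  choose s hs using hb
  let R := restrictFunctor U.ι
  have hsW (i : κ) (W : U.toScheme.Opens) : (kerIterι g M j).app (U.ι ''ᵁ W)
      ((R.obj (kerIter g M j)).presheaf.map (homOfLE (le_top : W ≤ ⊤)).op (s i)) = b i W := by
    refine (hom_app_map (kerIterι g M j) (Scheme.Hom.image_mono U.ι (le_top : W ≤ ⊤)) (s i)).trans ?_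
    rw [hs]
    rfl
  have hsum (W : U.toScheme.Opens) (a : κ → Γ(U.toScheme, W)) :
      (R.map (kerIterι g M j ≫ thetaPow g M j)).app W
        (∑ i, a i • (R.obj (kerIter g M j)).presheaf.map (homOfLE (le_top : W ≤ ⊤)).op (s i)) =
      ∑ i, (U.ι.appIso W).inv (a i) • (thetaPow g M j).app (U.ι ''ᵁ W) (b i W) :=
    restrict_map_app_sum_smul U _ W a _ _ fun i =>
      congrArg ((thetaPow g M j).app (U.ι ''ᵁ W)) (hsW i W)
  have hquot (W : U.toScheme.Opens) (t t' : Γ(R.obj (kerIter g M j), W))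
      (v : Γ(tw r M (-(j + 1 : ℕ)), U.ι ''ᵁ W))
      (ht : (R.map (kerIterι g M j ≫ thetaPow g M j)).app W t =
        (R.map (kerIterι g M j ≫ thetaPow g M j)).app W t' +
          (show Γ(R.obj (tw r M 0), W) from (thetaPow g M (j + 1)).app (U.ι ''ᵁ W) v)) :
      (R.map (kerIterQuot g M j)).app W t = (R.map (kerIterQuot g M j)).app W t' :=
    kerIterQuot_app_eq (O := U.ι ''ᵁ W) t t' v ht
  refine ⟨U, ⟨hhx, hl⟩, κ, inferInstance, _, isIso_freeDesc_comp
    (R.map (kerIterQuot g M j)) s ?_ ?_⟩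
  · intro W z y hy
    obtain ⟨U₁, hy₁, hU₁⟩ := exists_eq_sum_smul_basisSection
      (isHomogeneousMap_thetaLin_pow g M j) (isHomogeneousMap_thetaLin_pow g M (j + 1)) hw hX hhm
      hgen (U := U.ι ''ᵁ W) ((hU W).trans inf_le_right) ((hU W).trans inf_le_left)
      ((kerIterι g M j).app (U.ι ''ᵁ W) z)
      congr($(Limits.kernel.condition
        (thetaIter g M (j + 1) (-j) 1 (one_eq_neg_add_succ j))).app (U.ι ''ᵁ W) z)
      (U.ι y) ⟨y, hy, rfl⟩
    have hle : W ⊓ U.ι ⁻¹ᵁ U₁ ≤ W := inf_le_left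
    obtain ⟨a, v, hav⟩ := hU₁ (U.ι ''ᵁ (W ⊓ U.ι ⁻¹ᵁ U₁)) (Scheme.Hom.image_mono U.ι hle) (by
      rintro _ ⟨q, hq, rfl⟩
      exact hq.2)
    -- The coefficients are functions on an open subset of projective space; `appIso` reads them as
    -- functions on the scheme `U`.
    refine ⟨W ⊓ U.ι ⁻¹ᵁ U₁, hle, ⟨hy, hy₁⟩, fun i => (U.ι.appIso _).hom (a i), ?_⟩
    have hnat : (R.map (kerIterι g M j ≫ thetaPow g M j)).app (W ⊓ U.ι ⁻¹ᵁ U₁)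
        ((R.obj (kerIter g M j)).presheaf.map (homOfLE hle).op z) =
        (thetaPow g M j).app (U.ι ''ᵁ (W ⊓ U.ι ⁻¹ᵁ U₁)) ((tw r M (-j)).presheaf.map
          (homOfLE (Scheme.Hom.image_mono U.ι hle)).op ((kerIterι g M j).app (U.ι ''ᵁ W) z)) :=
      congrArg ((thetaPow g M j).app (U.ι ''ᵁ (W ⊓ U.ι ⁻¹ᵁ U₁)))
        (hom_app_map (kerIterι g M j) (Scheme.Hom.image_mono U.ι hle) z)
    refine hquot _ _ _ v (hnat.trans (hav.trans ?_))
    rw [hsum]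
    refine congrArg₂ _ (Finset.sum_congr rfl fun i _ => ?_) rfl
    rw [← ConcreteCategory.comp_apply, Iso.hom_inv_id]
    rfl
  · intro A z hz
    obtain ⟨A', π, hπ, v, hv⟩ := exists_refinement_of_comp_kerIterQuot U z hz
    refine ⟨A', π, hπ, fun W t a hta => ?_⟩
    have h0 := eq_zero_of_sum_smul_basisSection
      (isHomogeneousMap_thetaLin_pow g M j) (isHomogeneousMap_thetaLin_pow g M (j + 1)) hw hX
      hind ((hU W).trans inf_le_right) (fun i => (U.ι.appIso W).inv (a i)) (v.app W t) ?_
    · funext i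
      have := (congrArg (U.ι.appIso W).hom (h0 i)).trans (map_zero _)
      rw [← ConcreteCategory.comp_apply, Iso.inv_hom_id] at this
      exact this
    · refine (hsum W a).symm.trans ?_
      rw [← hta]
      exact congr($(hv).app W t)

theorem isCoherent_sheafF (hM : constantJordanType (k := k) g M) {i : ℕ} (hi : 1 ≤ i) :
    IsCoherent ((sheafF g i).obj M) := by
  -- With `i = j + 1` the truncated difference `i - 1` is `j`, and the inclusion that defines `ℱ_i`
  -- is `kerImSucc`.
  obtain ⟨j, rfl⟩ := Nat.exists_eq_add_of_le' hi
  exact isCoherent_of_locally_free _ fun x => exists_isIso_free_restrict hM x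

end BPBundles

end

theorem mainTheorem5 {p : ℕ} [Fact p.Prime] {k : Type u} [Field k] [CharP k p] {r : ℕ}
    {E : Type v} [CommGroup E] [Module (ZMod p) (Additive E)]
    (g : Module.Basis (Fin r) (ZMod p) (Additive E)) (i : ℕ) (hi : 1 ≤ i) (hip : i ≤ p - 1) :
    (∀ M, BPBundles.IsCoherent ((BPBundles.jordanF k g i).obj M)) ∧
    (BPBundles.jordanF k g i).Additive ∧
    ∀ ⦃M₁ M₂ M₃ : (BPBundles.constantJordanType (k := k) g).FullSubcategory⦄
      (f : M₁ ⟶ M₂) (h : M₂ ⟶ M₃), BPBundles.LocallySplitExact g f.hom h.hom →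
        ∃ w : (BPBundles.jordanF k g i).map f ≫ (BPBundles.jordanF k g i).map h = 0,
          (ShortComplex.mk _ _ w).ShortExact := by
  refine ⟨fun M => BPBundles.isCoherent_sheafF M.property hi, inferInstance,
    fun M₁ M₂ M₃ f h H => ?_⟩
  exact H.shortExact_sheafF M₁.property M₂.property M₃.property i
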